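/- **Setting.** Let $(\Omega,\mathcal F,(\mathcal F_t)_{t\ge 0},\mathbb Q)$ be a filtered probability space with a $(w+v+u)$-dimensional $\mathcal F_t$-Brownian motion $(W,V,U)$, let $T\ge 0$ and, for $\epsilon\in(0,1)$, let $(X^\epsilon,Z^\epsilon)$ be a continuous adapted solution in $\mathbb R^m\times\mathbb R^n$ of $$dX^\epsilon_t=\big[b+\tfrac1\epsilon b_{\mathrm I}\big](X^\epsilon_t,Z^\epsilon_t)\,dt+\sigma(X^\epsilon_t,Z^\epsilon_t)\,dW_t,\qquad dZ^\epsilon_t=\tfrac1{\epsilon^2}f(X^\epsilon_t,Z^\epsilon_t)\,dt+\tfrac1\epsilon g(X^\epsilon_t,Z^\epsilon_t)\,dV_t,$$ with Borel measurable coefficients, observed through $dY^\epsilon_t=h(X^\epsilon_t,Z^\epsilon_t)\,dt+dB_t$, $Y^\epsilon_0=0\in\mathbb R^d$, where $B=\alpha W+\gamma U$, $\alpha\alpha^*+\gamma\gamma^*=I$ and $\gamma\gamma^*\succ0$. Write $a=\sigma\sigma^*$, $\mathcal G_F=\sum_i f_i\partial_{z_i}+\frac12\sum_{i,j}(gg^*)_{ij}\partial_{z_i}\partial_{z_j}$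 and $$\mathcal G^\epsilon=\tfrac1{\epsilon^2}\mathcal G_F+\tfrac1\epsilon\sum_i b_{\mathrm I,i}\partial_{x_i}+\sum_i b_i\partial_{x_i}+\tfrac12\sum_{i,j}a_{ij}\partial_{x_i}\partial_{x_j}.$$ For each $x$ let $\mu_\infty(\cdot;x)$ be a stationary distribution, measurable in $x$, of $dZ=f(x,Z)\,dt+g(x,Z)\,dV$, and let $\Phi=\mathcal G_F^{-1}(-b_{\mathrm I})$ be the solution of $\mathcal G_F\Phi=-b_{\mathrm I}$ that is $C^2$ in $z$, $C^1$ in $x$, bounded in $z$ for each $x$ and satisfies $\int\Phi(x,z)\,\mu_\infty(dz;x)=0$. A bar denotes integration in $z$ against $\mu_\infty(dz;x)$. Let $$\mathcal G^\dagger=\sum_i(\bar b+\tilde b)_i\partial_{x_i}+\tfrac12\sum_{i,j}(\bar a+\tilde a)_{ij}\partial_{x_i}\partial_{x_j},\qquad \tilde b=\overline{(\nabla_x\Phi)b_{\mathrm I}},\qquad \tilde a=\overline{b_{\mathrm I}\otimes\Phi+\Phi\otimes b_{\mathrm I}},$$ all these averages being assumed to exist. Let $\rho^\epsilon$ and $\rho^0$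 be weakly continuous adapted processes of finite (nonnegative) measures on $\mathbb R^m\times\mathbb R^n$ and on $\mathbb R^m$, respectively, that solve on $[0,T]$ the Zakai equation and the homogenized Zakai equation driven by $Y^\epsilon$, $$\rho^\epsilon_t(\varphi)=\mathbb E_{\mathbb Q}[\varphi(X^\epsilon_0,Z^\epsilon_0)]+\int_0^t\rho^\epsilon_s(\mathcal G^\epsilon\varphi)\,ds+\int_0^t\langle\rho^\epsilon_s(\varphi h+\alpha\sigma^*\nabla_x\varphi),dY^\epsilon_s\rangle,\qquad \varphi\in C^2_b(\mathbb R^m\times\mathbb R^n),$$ $$\rho^0_t(\varphi)=\mathbb E_{\mathbb Q}[\varphi(X^\epsilon_0)]+\int_0^t\rho^0_s(\mathcal G^\dagger\varphi)\,ds+\int_0^t\langle\rho^0_s(\varphi\bar h+\alpha\bar\sigma^*\nabla_x\varphi),dY^\epsilon_s\rangle,\qquad \varphi\in C^2_b(\mathbb R^m),$$ and let $\rho^{\epsilon,x}$ be the $x$-marginal of $\rho^\epsilon$. (Since $\rho^0$ is driven by $Y^\epsilon$, it depends on $\epsilon$ as well.) Let $S(\mathbb R^m)$ be the space of finite signed Borel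 measures with the weak topology induced by $C_b(\mathbb R^m)$, let $C([0,T];S(\mathbb R^m))$ carry the topology of uniform convergence, and let $\Rightarrow$ be convergence in distribution under $\mathbb Q$ in this space as $\epsilon\to0^+$. **Lemma.** Assume that $h$, $\bar h$ and the coefficients of $\mathcal G^\dagger$ are bounded, and that $\rho^{\epsilon,x}-\rho^0\Rightarrow0$. Then: 1. For every $\epsilon$, $\mathbb Q$-almost surely $\rho^\epsilon_t\ne0$ and $\rho^0_t\ne0$ for all $t\in[0,T]$, so that $\pi^0_t=\rho^0_t/\rho^0_t(1)$ is well defined, and so is $\rho^{\epsilon,x}_t/\rho^{\epsilon,x}_t(1)$. 2. If $\pi^{\epsilon,x}_t=\rho^{\epsilon,x}_t/\rho^{\epsilon,x}_t(1)$, then $\pi^{\epsilon,x}-\pi^0\Rightarrow0$. 3. Let $\mathcal Y^\epsilon_t$ be generated by $(Y^\epsilon_s)_{s\le t}$ and the $\mathbb Q$-null sets, $D^\epsilon_t=\exp\big(-\int_0^t\langle h(X^\epsilon_s,Z^\epsilon_s),dB_s\rangle-\frac12\int_0^t|h(X^\epsilon_s,Z^\epsilon_s)|^2ds\big)$ and $d\mathbb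 P^\epsilon=D^\epsilon_T\,d\mathbb Q$. If $\rho^\epsilon$ is the unnormalized filter, i.e. $\rho^\epsilon_t(\varphi)=\mathbb E_{\mathbb P^\epsilon}[\varphi(X^\epsilon_t,Z^\epsilon_t)(D^\epsilon_t)^{-1}\mid\mathcal Y^\epsilon_t]$ almost surely for all $t\le T$ and $\varphi\in C^2_b$, and $\pi^\epsilon$ is the filter, i.e. a weakly continuous process of probability measures with $\pi^\epsilon_t(\varphi)=\mathbb E_{\mathbb Q}[\varphi(X^\epsilon_t,Z^\epsilon_t)\mid\mathcal Y^\epsilon_t]$ almost surely for all $t\le T$ and $\varphi\in C^2_b$, then the $x$-marginals $\pi^{\epsilon,x}$ of $\pi^\epsilon$ satisfy $\pi^{\epsilon,x}-\pi^0\Rightarrow0$. -/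

import Mathlib

open MeasureTheory ProbabilityTheory Filter Topology Set
open scoped NNReal ENNReal BoundedContinuousFunction Matrix

namespace MultiscaleFilter

noncomputable section

/-! ### Finite signed measures with the weak topology -/

/-- The space `S(𝕏)` of finite signed Borel measures on `𝕏`. -/
def WeakSignedMeasure (𝕏 : Type*) [MeasurableSpace 𝕏] : Type _ := SignedMeasure 𝕏

instance (𝕏 : Type*) [MeasurableSpace 𝕏] : AddCommGroup (WeakSignedMeasure 𝕏) :=
  inferInstanceAs (AddCommGroup (SignedMeasure 𝕏))

/-- The integral `μ(φ)` of `φ` against a finite signed measure `μ`. -/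
def WeakSignedMeasure.pairing {𝕏 : Type*} [MeasurableSpace 𝕏]
    (μ : WeakSignedMeasure 𝕏) (φ : 𝕏 → ℝ) : ℝ :=
  VectorMeasure.integral (F := ℝ) (G := ℝ) (show SignedMeasure 𝕏 from μ) φ
    (ContinuousLinearMap.lsmul ℝ ℝ).flip

/-- The weak topology on `S(𝕏)`: the coarsest topology for which `μ ↦ μ(φ)` is continuous for
every bounded continuous `φ`. -/
instance (𝕏 : Type*) [TopologicalSpace 𝕏] [MeasurableSpace 𝕏] :
    TopologicalSpace (WeakSignedMeasure 𝕏) :=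
  TopologicalSpace.induced (fun μ (φ : 𝕏 →ᵇ ℝ) => μ.pairing φ) inferInstance

/-- The signed measure `μ - ν`. -/
def subMeasure {𝕏 : Type*} [MeasurableSpace 𝕏] (μ ν : FiniteMeasure 𝕏) : WeakSignedMeasure 𝕏 :=
  ((μ : Measure 𝕏).toSignedMeasure - (ν : Measure 𝕏).toSignedMeasure : SignedMeasure 𝕏)

theorem pairing_subMeasure {𝕏 : Type*} [TopologicalSpace 𝕏] [MeasurableSpace 𝕏]
    [OpensMeasurableSpace 𝕏] (μ ν : FiniteMeasure 𝕏) (φ : 𝕏 →ᵇ ℝ) :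
    (subMeasure μ ν).pairing φ
      = ∫ x, φ x ∂(μ : Measure 𝕏) - ∫ x, φ x ∂(ν : Measure 𝕏) := by
  unfold subMeasure WeakSignedMeasure.pairing
  erw [VectorMeasure.integral_sub_vectorMeasure]
  · rw [VectorMeasure.integral_toSignedMeasure, VectorMeasure.integral_toSignedMeasure]
  · rw [VectorMeasure.Integrable, Measure.variation_toSignedMeasure]
    exact φ.integrable _
  · rw [VectorMeasure.Integrable, Measure.variation_toSignedMeasure]
    exact φ.integrable _

/-- `C(K; S(𝕏))` for a compact time interval `K` carries Mathlib's compact-open topology, that is,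
the topology of uniform convergence, and its Borel `σ`-algebra. -/
instance (K 𝕏 : Type*) [TopologicalSpace K] [TopologicalSpace 𝕏] [MeasurableSpace 𝕏] :
    MeasurableSpace C(K, WeakSignedMeasure 𝕏) := borel _

instance (K 𝕏 : Type*) [TopologicalSpace K] [TopologicalSpace 𝕏] [MeasurableSpace 𝕏] :
    BorelSpace C(K, WeakSignedMeasure 𝕏) := ⟨rfl⟩

/-! ### Measure-valued paths -/

section Paths

variable {K 𝕏 𝕐 : Type*} [TopologicalSpace K]
  [TopologicalSpace 𝕏] [MeasurableSpace 𝕏] [OpensMeasurableSpace 𝕏]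

/-- The signed-measure-valued path `t ↦ μ_t - ν_t`. -/
def subPath (μ ν : C(K, FiniteMeasure 𝕏)) : C(K, WeakSignedMeasure 𝕏) where
  toFun t := subMeasure (μ t) (ν t)
  continuous_toFun := by
    refine continuous_induced_rng.2 (continuous_pi fun φ => ?_)
    simp only [Function.comp_def, pairing_subMeasure]
    have h := fun (ξ : C(K, FiniteMeasure 𝕏)) => continuous_iff_continuousAt.2 fun t =>
      (FiniteMeasure.tendsto_iff_forall_integral_tendsto.1 (ξ.continuous.tendsto t)) φ
    exact (h μ).sub (h ν)

/-- The path of normalized measures `t ↦ μ_t / μ_t(1)`. If `μ_t = 0` for some `t`, a constant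
path is used instead. -/
def normalizedPath [Nonempty 𝕏] (μ : C(K, FiniteMeasure 𝕏)) : C(K, ProbabilityMeasure 𝕏) :=
  open Classical in
  if h : ∀ t, μ t ≠ 0 then
    { toFun := fun t => (μ t).normalize
      continuous_toFun := continuous_iff_continuousAt.2 fun t =>
        FiniteMeasure.tendsto_normalize_of_tendsto (μ.continuous.tendsto t) (h t) }
  else ContinuousMap.const K (0 : FiniteMeasure 𝕏).normalize

/-- A path of probability measures, seen as a path of finite measures. -/
def toFinitePath (μ : C(K, ProbabilityMeasure 𝕏)) : C(K, FiniteMeasure 𝕏) where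
  toFun t := (μ t).toFiniteMeasure
  continuous_toFun := ProbabilityMeasure.toFiniteMeasure_continuous.comp μ.continuous

variable [TopologicalSpace 𝕐] [MeasurableSpace 𝕐] [BorelSpace 𝕏] [OpensMeasurableSpace (𝕏 × 𝕐)]

/-- The path of `x`-marginals of a path of finite measures on `𝕏 × 𝕐`. -/
def marginalPath (μ : C(K, FiniteMeasure (𝕏 × 𝕐))) : C(K, FiniteMeasure 𝕏) where
  toFun t := (μ t).map Prod.fst
  continuous_toFun := (FiniteMeasure.continuous_map continuous_fst).comp μ.continuous

end Paths

/-- The restriction of a path from `[0, ∞)` to `[0, T]`. -/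
def restrictPath {𝕄 : Type*} [TopologicalSpace 𝕄] (T : ℝ≥0) (μ : C(ℝ≥0, 𝕄)) : C(Icc 0 T, 𝕄) :=
  μ.restrict (Icc 0 T)

/-! ### Brownian motion and the Itô integral -/

/-- Lebesgue measure on the time axis `[0, ∞)`. -/
def leb : Measure ℝ≥0 := (volume : Measure ℝ).comap (fun t : ℝ≥0 => (t : ℝ))

section Ito

variable {Ω : Type*} {mΩ : MeasurableSpace Ω} {ι : Type*} [Fintype ι]

/-- `β` is a standard Brownian motion with values in `ℝ^ι` relative to the filtration `ℱ`. -/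
structure IsBrownianMotion (ℱ : Filtration ℝ≥0 mΩ) (Q : Measure Ω) (β : ℝ≥0 → Ω → ι → ℝ) :
    Prop where
  adapted : Adapted ℱ β
  zero : ∀ᵐ ω ∂Q, β 0 ω = 0
  continuous_paths : ∀ᵐ ω ∂Q, Continuous fun t => β t ω
  law_increment : ∀ s t : ℝ≥0, s ≤ t →
    Q.map (fun ω => β t ω - β s ω) = Measure.pi fun _ : ι => gaussianReal 0 (t - s)
  indep_increment : ∀ s t : ℝ≥0, s ≤ t →
    Indep (MeasurableSpace.comap (fun ω => β t ω - β s ω) inferInstance) (ℱ s) Q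

/-- A simple process `∑_{k < N} ξ_k 1_{(t_k, t_{k+1}]}` with `ξ_k` bounded and
`ℱ_{t_k}`-measurable. -/
structure SimpleIntegrand (ℱ : Filtration ℝ≥0 mΩ) (ι : Type*) where
  N : ℕ
  time : ℕ → ℝ≥0
  time_mono : Monotone time
  coeff : ℕ → Ω → ι → ℝ
  coeff_measurable : ∀ k, Measurable[ℱ (time k)] (coeff k)
  coeff_bounded : ∃ C : ℝ, ∀ k ω i, |coeff k ω i| ≤ C

/-- The value at time `t` of a simple process. -/
def SimpleIntegrand.value {ℱ : Filtration ℝ≥0 mΩ} (S : SimpleIntegrand ℱ ι)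
    (t : ℝ≥0) (ω : Ω) (i : ι) : ℝ :=
  ∑ k ∈ Finset.range S.N, (Ioc (S.time k) (S.time (k + 1))).indicator (fun _ => S.coeff k ω i) t

/-- The elementary integral `∫_0^t ⟨S, dβ⟩` of a simple process. -/
def SimpleIntegrand.integral {ℱ : Filtration ℝ≥0 mΩ} (S : SimpleIntegrand ℱ ι)
    (β : ℝ≥0 → Ω → ι → ℝ) (t : ℝ≥0) (ω : Ω) : ℝ :=
  ∑ k ∈ Finset.range S.N, ∑ i,
    S.coeff k ω i * (β (min (S.time (k + 1)) t) ω i - β (min (S.time k) t) ω i)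

/-- `I` is (a version of) the Itô integral `t ↦ ∫_0^t ⟨H_s, dβ_s⟩` on `[0, T]`: the integrand `H` is
progressively measurable, and there are simple processes `S_n` with
`∫_0^T |S_n - H|² ds → 0` in probability and
`sup_{t ≤ T} |∫_0^t ⟨S_n, dβ⟩ - I_t| → 0` in probability. -/
structure IsItoIntegral (ℱ : Filtration ℝ≥0 mΩ) (Q : Measure Ω) (T : ℝ≥0)
    (β : ℝ≥0 → Ω → ι → ℝ) (H : ℝ≥0 → Ω → ι → ℝ) (I : ℝ≥0 → Ω → ℝ) : Prop where
  progressive : IsStronglyProgressive ℱ H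
  approx : ∃ S : ℕ → SimpleIntegrand ℱ ι,
    (∀ δ : ℝ≥0∞, 0 < δ → Tendsto
      (fun n => Q {ω | δ ≤ ∫⁻ s in Iic T,
        ∑ i, ENNReal.ofReal (((S n).value s ω i - H s ω i) ^ 2) ∂leb}) atTop (𝓝 0)) ∧
    (∀ δ : ℝ, 0 < δ → Tendsto
      (fun n => Q {ω | ∃ t ≤ T, δ ≤ |(S n).integral β t ω - I t ω|}) atTop (𝓝 0))

/-- `I` is (a version of) `t ↦ ∫_0^t ⟨H_s, dY_s⟩` on `[0, T]`, where `dY = η dt + dβ`. -/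
def IsIntegralAgainst (ℱ : Filtration ℝ≥0 mΩ) (Q : Measure Ω) (T : ℝ≥0)
    (η : ℝ≥0 → Ω → ι → ℝ) (β : ℝ≥0 → Ω → ι → ℝ)
    (H : ℝ≥0 → Ω → ι → ℝ) (I : ℝ≥0 → Ω → ℝ) : Prop :=
  (∀ᵐ ω ∂Q, IntegrableOn (fun s => ∑ i, H s ω i * η s ω i) (Iic T) leb) ∧
  IsItoIntegral ℱ Q T β H fun t ω => I t ω - ∫ s in Iic t, ∑ i, H s ω i * η s ω i ∂leb

/-- `X` is a continuous adapted process with `dX_t = μ_t dt + Λ_t dβ_t` on `[0, T]`. -/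
structure HasItoDifferential {k : ℕ} (ℱ : Filtration ℝ≥0 mΩ) (Q : Measure Ω) (T : ℝ≥0)
    (β : ℝ≥0 → Ω → ι → ℝ) (μ : ℝ≥0 → Ω → EuclideanSpace ℝ (Fin k))
    (Λ : ℝ≥0 → Ω → Matrix (Fin k) ι ℝ) (X : ℝ≥0 → Ω → EuclideanSpace ℝ (Fin k)) : Prop where
  adapted : Adapted ℱ X
  continuous_paths : ∀ ω, Continuous fun t => X t ω
  integrable : ∀ i, ∀ᵐ ω ∂Q, IntegrableOn (fun s => μ s ω i) (Iic T) leb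
  equation : ∀ i, IsItoIntegral ℱ Q T β (fun s ω => Λ s ω i)
    fun t ω => X t ω i - X 0 ω i - ∫ s in Iic t, μ s ω i ∂leb

end Ito

/-! ### Test functions and second order operators -/

/-- `φ ∈ C²_b`: `φ` is twice continuously differentiable and bounded together with its derivatives
of order at most two. -/
def IsC2b {V : Type*} [NormedAddCommGroup V] [NormedSpace ℝ V] (φ : V → ℝ) : Prop :=
  ContDiff ℝ 2 φ ∧ ∃ C : ℝ, ∀ k ≤ 2, ∀ p, ‖iteratedFDeriv ℝ k φ p‖ ≤ C

/-- The partial derivative `∂ψ/∂x_i` at `x`. -/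
def partialD {k : ℕ} (i : Fin k) (ψ : EuclideanSpace ℝ (Fin k) → ℝ)
    (x : EuclideanSpace ℝ (Fin k)) : ℝ :=
  fderiv ℝ ψ x (EuclideanSpace.single i 1)

/-- `∑ b_i ∂_i ψ(x) + (1/2) ∑ a_ij ∂_i ∂_j ψ(x)`. -/
def secondOrder {k : ℕ} (b : Fin k → ℝ) (a : Matrix (Fin k) (Fin k) ℝ)
    (ψ : EuclideanSpace ℝ (Fin k) → ℝ) (x : EuclideanSpace ℝ (Fin k)) : ℝ :=
  ∑ i, b i * partialD i ψ x + (1 / 2) * ∑ i, ∑ j, a i j * partialD i (partialD j ψ) x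

/-! ### The multiscale system -/

/-- The coefficients of the multiscale signal and observation system. The sensor function and the
observation noise are normalized so that `α α* + γ γ* = 1`. -/
structure Coefficients (m n d w v u : ℕ) where
  b : EuclideanSpace ℝ (Fin m) → EuclideanSpace ℝ (Fin n) → EuclideanSpace ℝ (Fin m)
  bI : EuclideanSpace ℝ (Fin m) → EuclideanSpace ℝ (Fin n) → EuclideanSpace ℝ (Fin m)
  σ : EuclideanSpace ℝ (Fin m) → EuclideanSpace ℝ (Fin n) → Matrix (Fin m) (Fin w) ℝ
  f : EuclideanSpace ℝ (Fin m) → EuclideanSpace ℝ (Fin n) → EuclideanSpace ℝ (Fin n)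
  g : EuclideanSpace ℝ (Fin m) → EuclideanSpace ℝ (Fin n) → Matrix (Fin n) (Fin v) ℝ
  h : EuclideanSpace ℝ (Fin m) → EuclideanSpace ℝ (Fin n) → EuclideanSpace ℝ (Fin d)
  α : Matrix (Fin d) (Fin w) ℝ
  γ : Matrix (Fin d) (Fin u) ℝ
  measurable_b : Measurable fun p : _ × _ => b p.1 p.2
  measurable_bI : Measurable fun p : _ × _ => bI p.1 p.2
  measurable_σ : ∀ i j, Measurable fun p : _ × _ => σ p.1 p.2 i j
  measurable_f : Measurable fun p : _ × _ => f p.1 p.2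
  measurable_g : ∀ i j, Measurable fun p : _ × _ => g p.1 p.2 i j
  measurable_h : Measurable fun p : _ × _ => h p.1 p.2
  noise_normalized : α * αᵀ + γ * γᵀ = 1
  noise_nondegenerate : (γ * γᵀ).PosDef

namespace Coefficients

variable {m n d w v u : ℕ} (c : Coefficients m n d w v u)

/-- The diffusion matrix `a = σ σ*`. -/
def a (x : EuclideanSpace ℝ (Fin m)) (z : EuclideanSpace ℝ (Fin n)) : Matrix (Fin m) (Fin m) ℝ :=
  c.σ x z * (c.σ x z)ᵀ

/-- The generator `𝒢_F` of the fast process with frozen slow variable `x`. -/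
def genFast (x : EuclideanSpace ℝ (Fin m)) (ψ : EuclideanSpace ℝ (Fin n) → ℝ)
    (z : EuclideanSpace ℝ (Fin n)) : ℝ :=
  secondOrder (c.f x z) (c.g x z * (c.g x z)ᵀ) ψ z

/-- The generator `𝒢^ε = ε⁻² 𝒢_F + ε⁻¹ 𝒢_I + 𝒢_S` of the signal. -/
def genSignal (ε : ℝ) (φ : EuclideanSpace ℝ (Fin m) × EuclideanSpace ℝ (Fin n) → ℝ)
    (p : EuclideanSpace ℝ (Fin m) × EuclideanSpace ℝ (Fin n)) : ℝ :=
  (1 / ε ^ 2) * c.genFast p.1 (fun z => φ (p.1, z)) p.2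
    + (1 / ε) * secondOrder (c.bI p.1 p.2) 0 (fun x => φ (x, p.2)) p.1
    + secondOrder (c.b p.1 p.2) (c.a p.1 p.2) (fun x => φ (x, p.2)) p.1

/-- The observation operator `φ ↦ φ h + α σ* ∇_x φ` of the Zakai equation. -/
def obsSignal (φ : EuclideanSpace ℝ (Fin m) × EuclideanSpace ℝ (Fin n) → ℝ)
    (p : EuclideanSpace ℝ (Fin m) × EuclideanSpace ℝ (Fin n)) (k : Fin d) : ℝ :=
  φ p * c.h p.1 p.2 k
    + ((c.α * (c.σ p.1 p.2)ᵀ) *ᵥ fun i => partialD i (fun x => φ (x, p.2)) p.1) k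

/-! #### Averaged coefficients -/

/-- `ν` is a stationary distribution of `dZ = f(x, Z) dt + g(x, Z) dV`: there is a weak solution
all of whose one-dimensional marginals are `ν`. -/
def IsStationaryDistribution (x : EuclideanSpace ℝ (Fin m))
    (ν : Measure (EuclideanSpace ℝ (Fin n))) : Prop :=
  ∃ (Ω' : Type) (mΩ' : MeasurableSpace Ω') (Q' : Measure Ω') (ℱ' : Filtration ℝ≥0 mΩ')
    (V' : ℝ≥0 → Ω' → Fin v → ℝ) (Z' : ℝ≥0 → Ω' → EuclideanSpace ℝ (Fin n)),
    IsProbabilityMeasure Q' ∧ IsBrownianMotion ℱ' Q' V' ∧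
    (∀ T, HasItoDifferential ℱ' Q' T V' (fun t ω => c.f x (Z' t ω)) (fun t ω => c.g x (Z' t ω)) Z') ∧
    ∀ t, Q'.map (Z' t) = ν

/-- `Φ = 𝒢_F⁻¹(-b_I)`: the bounded centered solution `Φ(x, ·)` of the Poisson equation
`𝒢_F Φ_i = -b_{I,i}`, differentiable in `x`. -/
structure IsPoissonSolution
    (μ : Kernel (EuclideanSpace ℝ (Fin m)) (EuclideanSpace ℝ (Fin n)))
    (Φ : EuclideanSpace ℝ (Fin m) → EuclideanSpace ℝ (Fin n) → EuclideanSpace ℝ (Fin m)) :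
    Prop where
  contDiff_fast : ∀ x i, ContDiff ℝ 2 fun z => Φ x z i
  contDiff_slow : ∀ z i, ContDiff ℝ 1 fun x => Φ x z i
  bounded : ∀ x, ∃ C : ℝ, ∀ z, ‖Φ x z‖ ≤ C
  equation : ∀ x z i, c.genFast x (fun z' => Φ x z' i) z = -c.bI x z i
  centered : ∀ x i, ∫ z, Φ x z i ∂μ x = 0

variable (μ : Kernel (EuclideanSpace ℝ (Fin m)) (EuclideanSpace ℝ (Fin n)))
  (Φ : EuclideanSpace ℝ (Fin m) → EuclideanSpace ℝ (Fin n) → EuclideanSpace ℝ (Fin m))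

/-- The integrals that define the averaged coefficients exist. -/
structure AveragesExist : Prop where
  integrable_b : ∀ x i, Integrable (fun z => c.b x z i) (μ x)
  integrable_σ : ∀ x i j, Integrable (fun z => c.σ x z i j) (μ x)
  integrable_a : ∀ x i j, Integrable (fun z => c.a x z i j) (μ x)
  integrable_h : ∀ x k, Integrable (fun z => c.h x z k) (μ x)
  integrable_drift : ∀ x i,
    Integrable (fun z => ∑ j, partialD j (fun x' => Φ x' z i) x * c.bI x z j) (μ x)
  integrable_diffusion : ∀ x i j, Integrable (fun z => c.bI x z i * Φ x z j) (μ x)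

/-- The averaged sensor function. -/
def hBar (x : EuclideanSpace ℝ (Fin m)) (k : Fin d) : ℝ := ∫ z, c.h x z k ∂μ x

/-- The averaged dispersion. -/
def σBar (x : EuclideanSpace ℝ (Fin m)) : Matrix (Fin m) (Fin w) ℝ :=
  Matrix.of fun i j => ∫ z, c.σ x z i j ∂μ x

/-- The drift of `𝒢^†`: the averaged drift plus the correction `∫ (∇_x Φ) b_I dμ_∞`. -/
def bDagger (x : EuclideanSpace ℝ (Fin m)) (i : Fin m) : ℝ :=
  ∫ z, c.b x z i ∂μ x + ∫ z, ∑ j, partialD j (fun x' => Φ x' z i) x * c.bI x z j ∂μ x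

/-- The diffusion matrix of `𝒢^†`: the averaged `a` plus `∫ (b_I ⊗ Φ + Φ ⊗ b_I) dμ_∞`. -/
def aDagger (x : EuclideanSpace ℝ (Fin m)) : Matrix (Fin m) (Fin m) ℝ :=
  Matrix.of fun i j =>
    ∫ z, c.a x z i j ∂μ x + ∫ z, (c.bI x z i * Φ x z j + Φ x z i * c.bI x z j) ∂μ x

/-- The homogenized generator `𝒢^†`. -/
def genDagger (φ : EuclideanSpace ℝ (Fin m) → ℝ) (x : EuclideanSpace ℝ (Fin m)) : ℝ :=
  secondOrder (c.bDagger μ Φ x) (c.aDagger μ Φ x) φ x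

/-- The averaged observation operator. -/
def obsBar (φ : EuclideanSpace ℝ (Fin m) → ℝ) (x : EuclideanSpace ℝ (Fin m)) (k : Fin d) : ℝ :=
  φ x * c.hBar μ x k + ((c.α * (c.σBar μ x)ᵀ) *ᵥ fun i => partialD i φ x) k

/-! #### Signal, observation and filters -/

section Processes

variable {Ω : Type*} {mΩ : MeasurableSpace Ω} (ℱ : Filtration ℝ≥0 mΩ) (Q : Measure Ω) (T : ℝ≥0)
  (W : ℝ≥0 → Ω → Fin w → ℝ) (V : ℝ≥0 → Ω → Fin v → ℝ) (U : ℝ≥0 → Ω → Fin u → ℝ)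
  (X : ℝ≥0 → Ω → EuclideanSpace ℝ (Fin m)) (Z : ℝ≥0 → Ω → EuclideanSpace ℝ (Fin n))

/-- `(X, Z)` solves the multiscale signal equation with parameter `ε` on `[0, T]`. -/
def IsSignal (ε : ℝ) : Prop :=
  HasItoDifferential ℱ Q T W
    (fun t ω => c.b (X t ω) (Z t ω) + (1 / ε) • c.bI (X t ω) (Z t ω))
    (fun t ω => c.σ (X t ω) (Z t ω)) X ∧
  HasItoDifferential ℱ Q T V
    (fun t ω => (1 / ε ^ 2) • c.f (X t ω) (Z t ω))
    (fun t ω => (1 / ε) • c.g (X t ω) (Z t ω)) Z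

/-- The observation noise `B = α W + γ U`. -/
def obsNoise (t : ℝ≥0) (ω : Ω) : Fin d → ℝ := c.α *ᵥ W t ω + c.γ *ᵥ U t ω

/-- The process `h(X_t, Z_t)`. -/
def sensor (t : ℝ≥0) (ω : Ω) (k : Fin d) : ℝ := c.h (X t ω) (Z t ω) k

/-- The observation `Y_t = ∫_0^t h(X_s, Z_s) ds + B_t`. -/
def observation (t : ℝ≥0) (ω : Ω) (k : Fin d) : ℝ :=
  ∫ s in Iic t, c.sensor X Z s ω k ∂leb + c.obsNoise W U t ω k

/-- The observation `σ`-algebra `𝒴_t`, generated by `Y_s`, `s ≤ t`, and the `Q`-null events. -/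
@[reducible] def observationAlgebra (t : ℝ≥0) : MeasurableSpace Ω :=
  (⨆ s : Iic t, MeasurableSpace.comap (c.observation W U X Z s) inferInstance)
    ⊔ MeasurableSpace.generateFrom {A | MeasurableSet A ∧ Q A = 0}

/-- `π` is the filter, the conditional law of `(X_t, Z_t)` given `𝒴_t`, on `[0, T]`. -/
def IsFilter
    (π : Ω → C(ℝ≥0, ProbabilityMeasure (EuclideanSpace ℝ (Fin m) × EuclideanSpace ℝ (Fin n)))) :
    Prop :=
  ∀ t ≤ T, ∀ φ : EuclideanSpace ℝ (Fin m) × EuclideanSpace ℝ (Fin n) → ℝ, IsC2b φ →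
    (fun ω => ∫ p, φ p ∂(π ω t : Measure _))
      =ᵐ[Q] Q[fun ω => φ (X t ω, Z t ω) | c.observationAlgebra Q W U X Z t]

/-- `D_t = exp(-∫_0^t ⟨h(X, Z), dB⟩ - (1/2) ∫_0^t |h(X, Z)|² ds)`, where `J` stands for
`∫ ⟨h(X, Z), dB⟩`. -/
def girsanovDensity (J : ℝ≥0 → Ω → ℝ) (t : ℝ≥0) (ω : Ω) : ℝ :=
  Real.exp (-J t ω - (1 / 2) * ∫ s in Iic t, ∑ k, c.sensor X Z s ω k ^ 2 ∂leb)

/-- `ρ` is the unnormalized filter on `[0, T]`: with `ℙ` the measure of density `D_T` with respect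
to `Q`, one has `ρ_t(φ) = 𝔼_ℙ[φ(X_t, Z_t) D_t⁻¹ | 𝒴_t]`. -/
def IsUnnormalizedFilter
    (ρ : Ω → C(ℝ≥0, FiniteMeasure (EuclideanSpace ℝ (Fin m) × EuclideanSpace ℝ (Fin n)))) :
    Prop :=
  ∃ J : ℝ≥0 → Ω → ℝ,
    IsItoIntegral ℱ Q T (c.obsNoise W U) (c.sensor X Z) J ∧
    ∀ t ≤ T, ∀ φ : EuclideanSpace ℝ (Fin m) × EuclideanSpace ℝ (Fin n) → ℝ, IsC2b φ →
      (fun ω => ∫ p, φ p ∂(ρ ω t : Measure _))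
        =ᵐ[Q] (Q.withDensity fun ω => ENNReal.ofReal (c.girsanovDensity X Z J T ω))[
          fun ω => φ (X t ω, Z t ω) * (c.girsanovDensity X Z J t ω)⁻¹
            | c.observationAlgebra Q W U X Z t]

/-- `ρ` is a finite-measure-valued adapted process with continuous paths that satisfies, for every
`φ ∈ C²_b` and almost surely for all `t ∈ [0, T]`,
`ρ_t(φ) = ∫ φ dν + ∫_0^t ρ_s(A φ) ds + ∫_0^t ⟨ρ_s(M φ), dY_s⟩` with `dY = h(X, Z) dt + dB`. -/
structure SolvesZakai {𝕏 : Type*} [NormedAddCommGroup 𝕏] [NormedSpace ℝ 𝕏] [MeasurableSpace 𝕏]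
    [OpensMeasurableSpace 𝕏]
    (A : (𝕏 → ℝ) → 𝕏 → ℝ) (M : (𝕏 → ℝ) → 𝕏 → Fin d → ℝ) (ν : Measure 𝕏)
    (ρ : Ω → C(ℝ≥0, FiniteMeasure 𝕏)) : Prop where
  adapted : ∀ t (φ : 𝕏 →ᵇ ℝ), Measurable[ℱ t] fun ω => ∫ p, φ p ∂(ρ ω t : Measure 𝕏)
  initial : ∀ φ, IsC2b φ → ∀ᵐ ω ∂Q, ∫ p, φ p ∂(ρ ω 0 : Measure 𝕏) = ∫ p, φ p ∂ν
  integrable_space : ∀ φ, IsC2b φ → ∀ᵐ ω ∂Q, ∀ᵐ s ∂leb.restrict (Iic T),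
    Integrable (A φ) (ρ ω s : Measure 𝕏) ∧ ∀ k, Integrable (M φ · k) (ρ ω s : Measure 𝕏)
  integrable_time : ∀ φ, IsC2b φ → ∀ᵐ ω ∂Q,
    IntegrableOn (fun s => ∫ p, A φ p ∂(ρ ω s : Measure 𝕏)) (Iic T) leb
  evolution : ∀ φ, IsC2b φ →
    IsIntegralAgainst ℱ Q T (c.sensor X Z) (c.obsNoise W U)
      (fun s ω k => ∫ p, M φ p k ∂(ρ ω s : Measure 𝕏))
      (fun t ω => ∫ p, φ p ∂(ρ ω t : Measure 𝕏) - ∫ p, φ p ∂(ρ ω 0 : Measure 𝕏)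
        - ∫ s in Iic t, ∫ p, A φ p ∂(ρ ω s : Measure 𝕏) ∂leb)

end Processes

end Coefficients

/-- The filter `ε → 0⁺` on the scale parameters `ε ∈ (0, 1)`. -/
def smallScale : Filter (Ioo (0 : ℝ) 1) := comap Subtype.val (𝓝 0)

end

end MultiscaleFilter

open MultiscaleFilter

/-!
Only the total masses stand between the convergence of the unnormalized measures and that of the
normalized ones: `μ_t(φ)/μ_t(1) - ν_t(φ)/ν_t(1)` is in absolute value at most `(|μ_t(φ) - ν_t(φ)|
+ ‖φ‖ |μ_t(1) - ν_t(1)|) / μ_t(1)`, so it suffices to bound `inf_{t ≤ T} ρ^ε_t(1)` from below in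
probability, uniformly in `ε`.

*Lower bound for the mass.* Tested with `φ = 1`, both Zakai equations lose their generator, and
the mass `M` solves `dM = ⟨H, dY⟩` with `M_0 = 1` and `|H_k| ≤ C M`, where `C` bounds the sensor
function. Thus `M` is a stochastic exponential with bounded logarithmic coefficient. As the Itô
integral is given through simple processes, Itô's formula for `log M` is replaced by a discrete
computation: an Euler scheme `m_{k+1} = m_k (1 + ⟨θ_k, ΔY_k⟩)` with `|θ_k| ≤ 2C` stays close to
`M` with high probability (`exists_euler_approximation`), and `1 + x ≥ exp(x - 2x²)` for `|x| ≤
1/2` bounds it below by an exponential, whose exponent is controlled by a maximal inequality for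
`∑ ⟨θ_k, Δβ_k⟩` and by Markov's inequality for `∑ ⟨θ_k, Δβ_k⟩²` (`measure_exists_lt_exp_neg`). The
resulting bound depends on `C`, `T` and `d` only. It gives both `ρ_t ≠ 0`
(`SolvesZakai.ae_ne_zero`) and the uniform lower bound (`SolvesZakai.measure_exists_mass_lt`).

*Convergence in distribution to zero.* The path space `C([0,T]; S(ℝ^m))` need not be metrizable,
but its topology is generated by the uniform distances of the pairings with bounded continuous
functions. Hence convergence in distribution to `0` amounts to uniform convergence to `0` in
probability of every pairing (`tendstoInDistribution_zero` and
`MeasureTheory.TendstoInDistribution.tendsto_measure_le_abs_pairing`). Measurability of the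
difference of two paths of finite measures comes from a countable family of functions that induces
the weak topology on the finite measures (`isInducing_convergenceDetermining`,
`aemeasurable_subPath`). Together these give `tendstoInDistribution_normalizedPath`.

*The filter.* The exponential density `exp(-(J_T - J_t) - ½ ∫_t^T |h|² ds)` has conditional
expectation one given `ℱ_t`: it is an almost sure limit of discrete exponential densities that are
bounded in `L²` (`aemeasurable_and_setLIntegral_exp`). Bayes' formula then yields the
Kallianpur–Striebel formula `ρ_t(φ) = π_t(φ) ρ_t(1)` (`IsUnnormalizedFilter.ae_eq_mul`). Applied
to the functions `cos ⟨x, ξ⟩` and `sin ⟨x, ξ⟩`, with `ξ` and `t` in countable dense sets, it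
identifies the marginals of the filter with the normalized marginals of `ρ`
(`IsUnnormalizedFilter.ae_eq_normalizedPath`).
-/

namespace MultiscaleFilter

noncomputable section

/-! ### Lebesgue measure on the time axis -/

theorem leb_Ioc (a b : ℝ≥0) : leb (Ioc a b) = ENNReal.ofReal ((b : ℝ) - a) := by
  have h : MeasurableEmbedding (fun t : ℝ≥0 => (t : ℝ)) :=
    MeasurableEmbedding.subtype_coe (s := {x : ℝ | 0 ≤ x}) measurableSet_Ici
  rw [leb, h.comap_apply, show (fun t : ℝ≥0 => (t : ℝ)) = NNReal.toReal from rfl,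
    NNReal.image_coe_Ioc, Real.volume_Ioc]

theorem leb_singleton (a : ℝ≥0) : leb {a} = 0 := by
  have h : MeasurableEmbedding (fun t : ℝ≥0 => (t : ℝ)) :=
    MeasurableEmbedding.subtype_coe (s := {x : ℝ | 0 ≤ x}) measurableSet_Ici
  rw [leb, h.comap_apply, image_singleton, Real.volume_singleton]

theorem Iic_ae_eq_Ioc (T : ℝ≥0) : (Iic T : Set ℝ≥0) =ᵐ[leb] Ioc 0 T := by
  have h : Iic T = {0} ∪ Ioc 0 T := by
    ext x
    rcases eq_zero_or_pos x with rfl | hx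
    · simp
    · simp
  rw [h]
  exact union_ae_eq_right_of_ae_eq_empty (ae_eq_empty.2 (leb_singleton 0))

theorem leb_Iic (T : ℝ≥0) : leb (Iic T) = ENNReal.ofReal T := by
  rw [measure_congr (Iic_ae_eq_Ioc T), leb_Ioc]
  simp

instance (T : ℝ≥0) : IsFiniteMeasure (leb.restrict (Iic T)) :=
  ⟨by rw [Measure.restrict_apply_univ, leb_Iic]; exact ENNReal.ofReal_lt_top⟩

/-! ### Gaussian increments -/

section Increments

variable {Ω : Type*} {mΩ : MeasurableSpace Ω} {ι : Type*} [Fintype ι]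

theorem charFun_pi_gaussianReal_map_linear (v : ℝ≥0) (c : ι → ℝ) (t : ℝ) :
    charFun ((Measure.pi fun _ : ι => gaussianReal 0 v).map fun x => ∑ i, c i * x i) t
      = Complex.exp (-(v * (∑ i, (c i : ℂ) ^ 2) * t ^ 2 / 2)) := by
  have hm : Measurable fun x : ι → ℝ => ∑ i, c i * x i := by fun_prop
  rw [charFun_apply_real, integral_map hm.aemeasurable (by fun_prop)]
  have : ∀ x : ι → ℝ, Complex.exp (t * ((∑ i, c i * x i : ℝ) : ℂ) * Complex.I)
      = ∏ i, Complex.exp (((t * c i : ℝ) : ℂ) * (x i : ℂ) * Complex.I) := by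
    intro x
    rw [← Complex.exp_sum]
    congr 1
    push_cast
    rw [Finset.mul_sum, Finset.sum_mul]
    exact Finset.sum_congr rfl fun i _ => by ring
  simp_rw [this]
  rw [integral_fintype_prod_eq_prod
    (fun i (y : ℝ) => Complex.exp (((t * c i : ℝ) : ℂ) * (y : ℂ) * Complex.I))]
  simp_rw [← charFun_apply_real, charFun_gaussianReal]
  rw [← Complex.exp_sum]
  congr 1
  simp only [Complex.ofReal_zero, mul_zero, zero_mul, zero_sub]
  rw [Finset.sum_neg_distrib, Finset.mul_sum, Finset.sum_mul, Finset.sum_div]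
  congr 1
  refine Finset.sum_congr rfl fun i _ => ?_
  push_cast
  ring

theorem pi_gaussianReal_map_linear (v : ℝ≥0) (c : ι → ℝ) :
    (Measure.pi fun _ : ι => gaussianReal 0 v).map (fun x => ∑ i, c i * x i)
      = gaussianReal 0 ((∑ i, c i ^ 2).toNNReal * v) := by
  have hm : Measurable fun x : ι → ℝ => ∑ i, c i * x i := by fun_prop
  have := Measure.isProbabilityMeasure_map (μ := Measure.pi fun _ : ι => gaussianReal 0 v)
    hm.aemeasurable
  refine Measure.ext_of_charFun (funext fun t => ?_)
  rw [charFun_pi_gaussianReal_map_linear, charFun_gaussianReal]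
  congr 1
  have h0 : 0 ≤ ∑ i, c i ^ 2 := Finset.sum_nonneg fun i _ => sq_nonneg _
  have h1 : (((∑ i, c i ^ 2).toNNReal * v : ℝ≥0) : ℂ) = (∑ i, (c i : ℂ) ^ 2) * v := by
    rw [NNReal.coe_mul, Real.coe_toNNReal _ h0]
    push_cast
    rfl
  rw [h1]
  push_cast
  ring

/-- Two probability measures on `ℝ^ι` agree if all linear functionals have the same law
under both. -/
theorem measure_ext_of_map_linear {μ ν : Measure (ι → ℝ)} [IsFiniteMeasure μ] [IsFiniteMeasure ν]
    (h : ∀ c : ι → ℝ, μ.map (fun x => ∑ i, c i * x i) = ν.map (fun x => ∑ i, c i * x i)) :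
    μ = ν := by
  classical
  refine Measure.ext_of_charFunDual (funext fun L => ?_)
  rw [charFunDual_eq_charFun_map_one, charFunDual_eq_charFun_map_one]
  have hL : (⇑L : (ι → ℝ) → ℝ) = fun x => ∑ i, L (Pi.single i 1) * x i := by
    funext x
    conv_lhs => rw [pi_eq_sum_univ' x]
    simp only [map_sum, map_smul, smul_eq_mul]
    refine Finset.sum_congr rfl fun i _ => ?_
    rw [mul_comm]
  rw [hL, h]

variable {ℱ : Filtration ℝ≥0 mΩ} {Q : Measure Ω} {β : ℝ≥0 → Ω → ι → ℝ}

theorem IsBrownianMotion.measurable (hβ : IsBrownianMotion ℱ Q β) (t : ℝ≥0) : Measurable (β t) :=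
  (hβ.adapted t).mono (ℱ.le t) le_rfl

theorem IsBrownianMotion.measurable_increment (hβ : IsBrownianMotion ℱ Q β) (s t : ℝ≥0) :
    Measurable fun ω => β t ω - β s ω :=
  (hβ.measurable t).sub (hβ.measurable s)

/-- A linear image `L β` of a Brownian motion with `L Lᵀ = 1` is a Brownian motion. -/
theorem IsBrownianMotion.mulVec {κ : Type*} [Fintype κ] [DecidableEq κ] [IsProbabilityMeasure Q]
    (hβ : IsBrownianMotion ℱ Q β) (L : Matrix κ ι ℝ) (hL : L * Lᵀ = 1) :
    IsBrownianMotion ℱ Q fun t ω => L *ᵥ β t ω where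
  adapted t := by
    have : Measurable fun x : ι → ℝ => L *ᵥ x := by
      unfold Matrix.mulVec dotProduct
      fun_prop
    exact this.comp (hβ.adapted t)
  zero := by
    filter_upwards [hβ.zero] with ω h
    rw [h, Matrix.mulVec_zero]
  continuous_paths := by
    filter_upwards [hβ.continuous_paths] with ω h
    exact Continuous.matrix_mulVec continuous_const h
  law_increment s t hst := by
    have hLm : Measurable fun x : ι → ℝ => L *ᵥ x := by
      unfold Matrix.mulVec dotProduct
      fun_prop
    have hΔ := hβ.measurable_increment s t
    have e : (fun ω => L *ᵥ β t ω - L *ᵥ β s ω)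
        = (fun x => L *ᵥ x) ∘ fun ω => β t ω - β s ω := by
      funext ω
      simp [Matrix.mulVec_sub]
    rw [e, ← Measure.map_map hLm hΔ, hβ.law_increment s t hst]
    have := Measure.isProbabilityMeasure_map
      (μ := Measure.pi fun _ : ι => gaussianReal 0 (t - s)) hLm.aemeasurable
    refine measure_ext_of_map_linear fun c => ?_
    have hc : Measurable fun x : κ → ℝ => ∑ i, c i * x i := by fun_prop
    rw [Measure.map_map hc hLm, pi_gaussianReal_map_linear]
    have e2 : (fun x : κ → ℝ => ∑ i, c i * x i) ∘ (fun x => L *ᵥ x)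
        = fun x => ∑ j, (c ᵥ* L) j * x j := by
      funext x
      exact Matrix.dotProduct_mulVec c L x
    rw [e2, pi_gaussianReal_map_linear]
    have e3 : ∑ j, (c ᵥ* L) j ^ 2 = ∑ i, c i ^ 2 := by
      have h1 : ∑ j, (c ᵥ* L) j ^ 2 = (c ᵥ* L) ⬝ᵥ (c ᵥ* L) := by
        simp [dotProduct, sq]
      have h2 : ∑ j, c j ^ 2 = c ⬝ᵥ c := by
        simp [dotProduct, sq]
      rw [h1, h2, ← Matrix.dotProduct_mulVec, ← Matrix.mulVec_transpose, Matrix.mulVec_mulVec, hL,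
        Matrix.one_mulVec]
    rw [e3]
  indep_increment s t hst := by
    have hLm : Measurable fun x : ι → ℝ => L *ᵥ x := by
      unfold Matrix.mulVec dotProduct
      fun_prop
    refine indep_of_indep_of_le_left (hβ.indep_increment s t hst) ?_
    have e : (fun ω => L *ᵥ β t ω - L *ᵥ β s ω)
        = (fun x => L *ᵥ x) ∘ fun ω => β t ω - β s ω := by
      funext ω
      simp [Matrix.mulVec_sub]
    rw [e, ← MeasurableSpace.comap_comp]
    exact MeasurableSpace.comap_mono hLm.comap_le

/-- Integration of a function of two independent variables, one variable at a time. The codomain of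
`p` may be `Ω` itself with a smaller `σ`-algebra. -/
theorem lintegral_of_indepFun [IsProbabilityMeasure Q] {Ω' E : Type*} [MeasurableSpace Ω']
    [MeasurableSpace E] {p : Ω → Ω'} {Y : Ω → E} (hp : Measurable p) (hY : Measurable Y)
    (h : IndepFun p Y Q) {f : Ω' × E → ℝ≥0∞} (hf : Measurable f) :
    ∫⁻ ω, f (p ω, Y ω) ∂Q = ∫⁻ ω, ∫⁻ x, f (p ω, x) ∂(Q.map Y) ∂Q := by
  have := Measure.isProbabilityMeasure_map (μ := Q) hY.aemeasurable
  rw [← lintegral_map hf (hp.prodMk hY),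
    (indepFun_iff_map_prod_eq_prod_map_map hp.aemeasurable hY.aemeasurable).1 h,
    lintegral_prod _ hf.aemeasurable, lintegral_map hf.lintegral_prod_right' hp]

/-- Conditioning on the past: the increment of a Brownian motion over `(a, b]` may be integrated
out with the past frozen. -/
theorem IsBrownianMotion.lintegral_increment [IsProbabilityMeasure Q]
    (hβ : IsBrownianMotion ℱ Q β) {a b : ℝ≥0} (hab : a ≤ b)
    {f : Ω × (ι → ℝ) → ℝ≥0∞} (hf : Measurable[(ℱ a).prod MeasurableSpace.pi] f) :
    ∫⁻ ω, f (ω, β b ω - β a ω) ∂Q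
      = ∫⁻ ω, ∫⁻ x, f (ω, x) ∂(Measure.pi fun _ : ι => gaussianReal 0 (b - a)) ∂Q := by
  have hΔ := hβ.measurable_increment a b
  have hind : @IndepFun Ω Ω (ι → ℝ) mΩ (ℱ a) MeasurableSpace.pi id (fun ω => β b ω - β a ω) Q := by
    refine (@IndepFun_iff_Indep Ω Ω (ι → ℝ) mΩ (ℱ a) _ id _ Q).2 ?_
    rw [MeasurableSpace.comap_id]
    exact (hβ.indep_increment a b hab).symm
  rw [← hβ.law_increment a b hab]
  exact @lintegral_of_indepFun Ω mΩ Q _ Ω (ι → ℝ) (ℱ a) _ id _ (measurable_id'' (ℱ.le a)) hΔ hind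
    f hf

theorem lintegral_pi_gaussianReal_linear (v : ℝ≥0) (c : ι → ℝ) {f : ℝ → ℝ≥0∞} (hf : Measurable f) :
    ∫⁻ x, f (∑ i, c i * x i) ∂(Measure.pi fun _ : ι => gaussianReal 0 v)
      = ∫⁻ y, f y ∂gaussianReal 0 ((∑ i, c i ^ 2).toNNReal * v) := by
  rw [← pi_gaussianReal_map_linear, lintegral_map hf (by fun_prop)]

theorem lintegral_sq_gaussianReal (v : ℝ≥0) :
    ∫⁻ y, ENNReal.ofReal (y ^ 2) ∂gaussianReal 0 v = v := by
  have h := variance_fun_id_gaussianReal (μ := 0) (v := v)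
  rw [variance_eq_integral (by fun_prop), integral_id_gaussianReal] at h
  simp only [sub_zero] at h
  rw [← ofReal_integral_eq_lintegral_ofReal, h, ENNReal.ofReal_coe_nnreal]
  · exact (memLp_id_gaussianReal (μ := 0) (v := v) 2).integrable_sq
  · exact ae_of_all _ fun y => sq_nonneg y

theorem lintegral_exp_gaussianReal (v : ℝ≥0) :
    ∫⁻ y, ENNReal.ofReal (Real.exp (y - v / 2)) ∂gaussianReal 0 v = 1 := by
  have h := congrFun (mgf_id_gaussianReal (μ := 0) (v := v)) 1
  simp only [mgf, id, one_mul, zero_add, one_pow, mul_one] at h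
  have hi := integrable_exp_mul_gaussianReal (μ := 0) (v := v) 1
  simp only [one_mul] at hi
  simp_rw [Real.exp_sub]
  rw [← ofReal_integral_eq_lintegral_ofReal (hi.div_const _)
    (ae_of_all _ fun y => by positivity), integral_div, h, div_self (Real.exp_pos _).ne',
    ENNReal.ofReal_one]

/-- The Itô isometry over one increment. -/
theorem IsBrownianMotion.lintegral_mul_sq [IsProbabilityMeasure Q]
    (hβ : IsBrownianMotion ℱ Q β) {a b : ℝ≥0} (hab : a ≤ b)
    {ζ : Ω → ι → ℝ} (hζ : Measurable[ℱ a] ζ) :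
    ∫⁻ ω, ENNReal.ofReal ((∑ i, ζ ω i * (β b ω i - β a ω i)) ^ 2) ∂Q
      = ∫⁻ ω, ENNReal.ofReal ((∑ i, ζ ω i ^ 2) * (b - a)) ∂Q := by
  have hm : Measurable[(ℱ a).prod MeasurableSpace.pi]
      fun p : Ω × (ι → ℝ) => ENNReal.ofReal ((∑ i, ζ p.1 i * p.2 i) ^ 2) := by
    refine ENNReal.measurable_ofReal.comp (Measurable.pow_const ?_ _)
    refine Finset.measurable_sum _ fun i _ => Measurable.mul ?_ ?_
    · exact ((measurable_pi_apply i).comp hζ).comp (@measurable_fst _ _ (ℱ a) _)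
    · exact (measurable_pi_apply i).comp (@measurable_snd _ _ (ℱ a) _)
  refine (hβ.lintegral_increment hab hm).trans ?_
  · refine lintegral_congr fun ω => ?_
    dsimp only
    rw [lintegral_pi_gaussianReal_linear (b - a) (ζ ω)
      (f := fun y => ENNReal.ofReal (y ^ 2)) (by fun_prop), lintegral_sq_gaussianReal]
    have h0 : 0 ≤ ∑ i, ζ ω i ^ 2 := Finset.sum_nonneg fun i _ => sq_nonneg _
    rw [← ENNReal.ofReal_coe_nnreal, NNReal.coe_mul, Real.coe_toNNReal _ h0, NNReal.coe_sub hab]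

/-- The exponential martingale property over one increment. -/
theorem IsBrownianMotion.lintegral_mul_exp [IsProbabilityMeasure Q]
    (hβ : IsBrownianMotion ℱ Q β) {a b : ℝ≥0} (hab : a ≤ b)
    {ζ : Ω → ι → ℝ} (hζ : Measurable[ℱ a] ζ) {G : Ω → ℝ≥0∞} (hG : Measurable[ℱ a] G) :
    ∫⁻ ω, G ω * ENNReal.ofReal (Real.exp (∑ i, ζ ω i * (β b ω i - β a ω i)
        - (∑ i, ζ ω i ^ 2) * (b - a) / 2)) ∂Q
      = ∫⁻ ω, G ω ∂Q := by
  have hm : Measurable[(ℱ a).prod MeasurableSpace.pi]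
      fun p : Ω × (ι → ℝ) => G p.1 * ENNReal.ofReal (Real.exp (∑ i, ζ p.1 i * p.2 i
        - (∑ i, ζ p.1 i ^ 2) * (b - a) / 2)) := by
    have h1 : ∀ i, Measurable[(ℱ a).prod MeasurableSpace.pi] fun p : Ω × (ι → ℝ) => ζ p.1 i :=
      fun i => ((measurable_pi_apply i).comp hζ).comp (@measurable_fst _ _ (ℱ a) _)
    have h2 : ∀ i, Measurable[(ℱ a).prod MeasurableSpace.pi] fun p : Ω × (ι → ℝ) => p.2 i :=
      fun i => (measurable_pi_apply i).comp (@measurable_snd _ _ (ℱ a) _)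
    refine Measurable.mul (hG.comp (@measurable_fst _ _ (ℱ a) _)) ?_
    refine ENNReal.measurable_ofReal.comp (Real.measurable_exp.comp (Measurable.sub ?_ ?_))
    · exact Finset.measurable_sum _ fun i _ => (h1 i).mul (h2 i)
    · exact ((Finset.measurable_sum _ fun i _ => (h1 i).pow_const 2).mul_const _).div_const _
  refine (hβ.lintegral_increment hab hm).trans ?_
  · refine lintegral_congr fun ω => ?_
    dsimp only
    have h0 : 0 ≤ ∑ i, ζ ω i ^ 2 := Finset.sum_nonneg fun i _ => sq_nonneg _
    rw [lintegral_const_mul _ (by fun_prop), lintegral_pi_gaussianReal_linear (b - a) (ζ ω)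
      (f := fun y => ENNReal.ofReal (Real.exp (y - (∑ i, ζ ω i ^ 2) * (b - a) / 2))) (by fun_prop)]
    have h1 := lintegral_exp_gaussianReal ((∑ i, ζ ω i ^ 2).toNNReal * (b - a))
    rw [NNReal.coe_mul, Real.coe_toNNReal _ h0, NNReal.coe_sub hab] at h1
    rw [h1, mul_one]

/-- The increment of a Brownian motion is centred given the past. -/
theorem IsBrownianMotion.integral_mul_increment [IsProbabilityMeasure Q]
    (hβ : IsBrownianMotion ℱ Q β) {a b : ℝ≥0} (hab : a ≤ b)
    {G : Ω → ℝ} (hG : Measurable[ℱ a] G) (i : ι) :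
    ∫ ω, G ω * (β b ω i - β a ω i) ∂Q = 0 := by
  have hΔ := hβ.measurable_increment a b
  have hind : IndepFun G (fun ω => β b ω i - β a ω i) Q := by
    rw [IndepFun_iff_Indep]
    refine indep_of_indep_of_le_left (indep_of_indep_of_le_right
      (hβ.indep_increment a b hab).symm ?_) hG.comap_le
    rw [show (fun ω => β b ω i - β a ω i) = (fun x : ι → ℝ => x i) ∘ fun ω => β b ω - β a ω from rfl,
      ← MeasurableSpace.comap_comp]
    exact MeasurableSpace.comap_mono (measurable_pi_apply i).comap_le
  rw [hind.integral_fun_mul_eq_mul_integral (hG.mono (ℱ.le a) le_rfl).aestronglyMeasurable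
    (((measurable_pi_apply i).comp hΔ)).aestronglyMeasurable]
  have h : ∫ ω, (β b ω i - β a ω i) ∂Q = ∫ x : ι → ℝ, x i ∂(Q.map fun ω => β b ω - β a ω) :=
    (integral_map hΔ.aemeasurable (measurable_pi_apply i).aestronglyMeasurable).symm
  have h' : ∫ x : ι → ℝ, x i ∂(Measure.pi fun _ : ι => gaussianReal 0 (b - a)) = 0 := by
    have := (measurePreserving_eval (fun _ : ι => gaussianReal 0 (b - a)) i)
    have h0 := integral_id_gaussianReal (μ := 0) (v := b - a)
    rwa [← this.map_eq, integral_map this.aemeasurable (by fun_prop)] at h0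
  rw [h, hβ.law_increment a b hab, h', mul_zero]

end Increments

/-- The observation noise `α W + γ U` is a Brownian motion, since `α αᵀ + γ γᵀ = 1`. -/
theorem Coefficients.isBrownianMotion_obsNoise {m n d w v u : ℕ} (c : Coefficients m n d w v u)
    {Ω : Type*} {mΩ : MeasurableSpace Ω} {Q : Measure Ω} [IsProbabilityMeasure Q]
    {ℱ : Filtration ℝ≥0 mΩ} {W : ℝ≥0 → Ω → Fin w → ℝ} {V : ℝ≥0 → Ω → Fin v → ℝ}
    {U : ℝ≥0 → Ω → Fin u → ℝ}
    (hBM : IsBrownianMotion ℱ Q fun t ω => Sum.elim (W t ω) (Sum.elim (V t ω) (U t ω))) :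
    IsBrownianMotion ℱ Q (c.obsNoise W U) := by
  let L : Matrix (Fin d) (Fin w ⊕ (Fin v ⊕ Fin u)) ℝ :=
    Matrix.fromCols c.α (Matrix.fromCols 0 c.γ)
  have h := hBM.mulVec L (by
    simp only [L, Matrix.transpose_fromCols, Matrix.fromCols_mul_fromRows, Matrix.zero_mul,
      zero_add]
    exact c.noise_normalized)
  convert h using 1
  funext t ω
  simp [L, Coefficients.obsNoise, Matrix.fromCols_mulVec]

/-! ### Elementary integrals along a grid -/

section Discrete

variable {Ω : Type*} {mΩ : MeasurableSpace Ω} {ι : Type*} [Fintype ι]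

/-- The sum `∑_{j < k} ⟨ζ_j, β_{s_{j+1}} - β_{s_j}⟩`, the integral of the step process that equals
`ζ_j` on `(s_j, s_{j+1}]`. -/
def incSum (β : ℝ≥0 → Ω → ι → ℝ) (s : ℕ → ℝ≥0) (ζ : ℕ → Ω → ι → ℝ) (k : ℕ) (ω : Ω) : ℝ :=
  ∑ j ∈ Finset.range k, ∑ i, ζ j ω i * (β (s (j + 1)) ω i - β (s j) ω i)

/-- The quadratic variation `∑_{j < k} |ζ_j|² (s_{j+1} - s_j)` of `incSum`. -/
def incVar (s : ℕ → ℝ≥0) (ζ : ℕ → Ω → ι → ℝ) (k : ℕ) (ω : Ω) : ℝ :=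
  ∑ j ∈ Finset.range k, (∑ i, ζ j ω i ^ 2) * ((s (j + 1) : ℝ) - s j)

theorem incSum_succ (β : ℝ≥0 → Ω → ι → ℝ) (s : ℕ → ℝ≥0) (ζ : ℕ → Ω → ι → ℝ) (k : ℕ) (ω : Ω) :
    incSum β s ζ (k + 1) ω
      = incSum β s ζ k ω + ∑ i, ζ k ω i * (β (s (k + 1)) ω i - β (s k) ω i) :=
  Finset.sum_range_succ _ _

theorem incVar_succ (s : ℕ → ℝ≥0) (ζ : ℕ → Ω → ι → ℝ) (k : ℕ) (ω : Ω) :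
    incVar s ζ (k + 1) ω = incVar s ζ k ω + (∑ i, ζ k ω i ^ 2) * ((s (k + 1) : ℝ) - s k) :=
  Finset.sum_range_succ _ _

theorem incSum_sub (β : ℝ≥0 → Ω → ι → ℝ) (s : ℕ → ℝ≥0) (ζ ζ' : ℕ → Ω → ι → ℝ) (k : ℕ) (ω : Ω) :
    incSum β s (fun j ω i => ζ j ω i - ζ' j ω i) k ω
      = incSum β s ζ k ω - incSum β s ζ' k ω := by
  simp only [incSum, ← Finset.sum_sub_distrib, sub_mul]

variable {ℱ : Filtration ℝ≥0 mΩ} {Q : Measure Ω} {β : ℝ≥0 → Ω → ι → ℝ}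
  {s : ℕ → ℝ≥0} {ζ : ℕ → Ω → ι → ℝ}

theorem sub_nonneg_of_monotone (hs : Monotone s) (j : ℕ) : 0 ≤ (s (j + 1) : ℝ) - s j :=
  sub_nonneg.2 (NNReal.coe_le_coe.2 (hs j.le_succ))

theorem sum_sq_mul_nonneg (hs : Monotone s) (j : ℕ) (ω : Ω) :
    0 ≤ (∑ i, ζ j ω i ^ 2) * ((s (j + 1) : ℝ) - s j) :=
  mul_nonneg (Finset.sum_nonneg fun _ _ => sq_nonneg _) (sub_nonneg_of_monotone hs j)

theorem incVar_mono (hs : Monotone s) (ω : Ω) : Monotone fun k => incVar s ζ k ω :=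
  monotone_nat_of_le_succ fun k => by
    rw [incVar_succ]
    exact le_add_of_nonneg_right (sum_sq_mul_nonneg hs k ω)

/-- For a coefficient bounded by `C` in every coordinate the quadratic variation is at most
`|ι| C² (s_k - s_0)`. -/
theorem incVar_le (hs : Monotone s) {C : ℝ} {ω : Ω} (hζ : ∀ k i, |ζ k ω i| ≤ C) (k : ℕ) :
    incVar s ζ k ω ≤ Fintype.card ι * C ^ 2 * ((s k : ℝ) - s 0) := by
  induction k with
  | zero => simp [incVar]
  | succ k ih =>
    rw [incVar_succ]
    have h1 : ∑ i, ζ k ω i ^ 2 ≤ Fintype.card ι * C ^ 2 := by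
      refine (Finset.sum_le_sum fun i _ => sq_le_sq' (abs_le.1 (hζ k i)).1
        (abs_le.1 (hζ k i)).2).trans ?_
      simp
    have := mul_le_mul_of_nonneg_right h1 (sub_nonneg_of_monotone hs k)
    linarith

theorem measurable_incSum (hβ : IsBrownianMotion ℱ Q β) (hs : Monotone s)
    (hζ : ∀ k, Measurable[ℱ (s k)] (ζ k)) (k : ℕ) : Measurable[ℱ (s k)] (incSum β s ζ k) := by
  refine Finset.measurable_sum _ fun j hj => Finset.measurable_sum _ fun i _ => ?_
  have hj := Finset.mem_range.1 hj
  refine Measurable.mul ?_ (Measurable.sub ?_ ?_)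
  · exact (measurable_pi_apply i).comp ((hζ j).mono (ℱ.mono (hs hj.le)) le_rfl)
  · exact (measurable_pi_apply i).comp ((hβ.adapted _).mono (ℱ.mono (hs hj)) le_rfl)
  · exact (measurable_pi_apply i).comp ((hβ.adapted _).mono (ℱ.mono (hs hj.le)) le_rfl)

theorem measurable_incVar (hs : Monotone s) (hζ : ∀ k, Measurable[ℱ (s k)] (ζ k)) (k : ℕ) :
    Measurable[ℱ (s (k - 1))] (incVar s ζ k) := by
  refine Finset.measurable_sum _ fun j hj => Measurable.mul_const
    (Finset.measurable_sum _ fun i _ => Measurable.pow_const ?_ _) _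
  have hj : j ≤ k - 1 := by have := Finset.mem_range.1 hj; omega
  exact (measurable_pi_apply i).comp ((hζ j).mono (ℱ.mono (hs hj)) le_rfl)

theorem measurable_sum_mul_increment (hβ : IsBrownianMotion ℱ Q β)
    (hζ : ∀ k, Measurable[ℱ (s k)] (ζ k)) (k : ℕ) :
    Measurable fun ω => ∑ i, ζ k ω i * (β (s (k + 1)) ω i - β (s k) ω i) := by
  refine Finset.measurable_sum _ fun i _ => Measurable.mul ?_ (Measurable.sub ?_ ?_)
  · exact (measurable_pi_apply i).comp ((hζ k).mono (ℱ.le _) le_rfl)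
  · exact (measurable_pi_apply i).comp (hβ.measurable _)
  · exact (measurable_pi_apply i).comp (hβ.measurable _)

variable [IsProbabilityMeasure Q]

theorem memLp_sum_mul_increment (hβ : IsBrownianMotion ℱ Q β) (hs : Monotone s)
    (hζ : ∀ k, Measurable[ℱ (s k)] (ζ k)) {C : ℝ} (hC : ∀ k ω i, |ζ k ω i| ≤ C) (k : ℕ) :
    MemLp (fun ω => ∑ i, ζ k ω i * (β (s (k + 1)) ω i - β (s k) ω i)) 2 Q := by
  have hm := (measurable_sum_mul_increment hβ hζ k).aestronglyMeasurable (μ := Q)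
  rw [memLp_two_iff_integrable_sq hm]
  refine ⟨hm.pow 2, ?_⟩
  rw [hasFiniteIntegral_iff_ofReal (ae_of_all _ fun ω => sq_nonneg _),
    hβ.lintegral_mul_sq (hs k.le_succ) (hζ k)]
  refine (lintegral_mono (g := fun _ => ENNReal.ofReal
    (Fintype.card ι * C ^ 2 * (s (k + 1) - s k))) fun ω => ENNReal.ofReal_le_ofReal ?_).trans_lt ?_
  · refine mul_le_mul_of_nonneg_right ?_ (sub_nonneg_of_monotone hs k)
    refine (Finset.sum_le_sum fun i _ => sq_le_sq' (abs_le.1 (hC k ω i)).1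
      (abs_le.1 (hC k ω i)).2).trans ?_
    simp
  · simp

theorem memLp_incSum (hβ : IsBrownianMotion ℱ Q β) (hs : Monotone s)
    (hζ : ∀ k, Measurable[ℱ (s k)] (ζ k)) {C : ℝ} (hC : ∀ k ω i, |ζ k ω i| ≤ C) (k : ℕ) :
    MemLp (incSum β s ζ k) 2 Q :=
  memLp_finsetSum _ fun j _ => memLp_sum_mul_increment hβ hs hζ hC j

theorem integrable_incVar (hs : Monotone s)
    (hζ : ∀ k, Measurable[ℱ (s k)] (ζ k)) {C : ℝ} (hC : ∀ k ω i, |ζ k ω i| ≤ C) (k : ℕ) :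
    Integrable (incVar s ζ k) Q := by
  refine Integrable.of_bound
    (((measurable_incVar hs hζ k).mono (ℱ.le _) le_rfl).aestronglyMeasurable)
    (Fintype.card ι * C ^ 2 * ((s k : ℝ) - s 0)) (ae_of_all _ fun ω => ?_)
  rw [Real.norm_of_nonneg]
  · exact incVar_le hs (fun k i => hC k ω i) k
  · simpa [incVar] using incVar_mono hs ω (Nat.zero_le k)

/-- Itô's isometry for step processes. -/
theorem integral_incSum_sq (hβ : IsBrownianMotion ℱ Q β) (hs : Monotone s)
    (hζ : ∀ k, Measurable[ℱ (s k)] (ζ k)) {C : ℝ} (hC : ∀ k ω i, |ζ k ω i| ≤ C) (k : ℕ) :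
    ∫ ω, incSum β s ζ k ω ^ 2 ∂Q = ∫ ω, incVar s ζ k ω ∂Q := by
  induction k with
  | zero => simp [incSum, incVar]
  | succ k ih =>
    set D : Ω → ℝ := fun ω => ∑ i, ζ k ω i * (β (s (k + 1)) ω i - β (s k) ω i) with hD
    have hM := memLp_incSum hβ hs hζ hC k
    have hDm : MemLp D 2 Q := memLp_sum_mul_increment hβ hs hζ hC k
    -- the new increment is centred given the past, so the cross term vanishes
    have hcross : ∫ ω, incSum β s ζ k ω * D ω ∂Q = 0 := by
      have hmul : ∀ i, MemLp (fun ω => β (s (k + 1)) ω i - β (s k) ω i) 2 Q := by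
        classical
        intro i
        have := memLp_sum_mul_increment (ζ := fun _ _ => Pi.single i 1) (C := 1) hβ hs
          (fun _ => measurable_const) (fun _ _ j => by
            rcases eq_or_ne j i with rfl | h
            · simp
            · simp [h]) k
        simpa [Pi.single_apply, ite_mul] using this
      have hζi : ∀ i, Measurable[ℱ (s k)] fun ω => ζ k ω i := fun i =>
        (measurable_pi_apply i).comp (hζ k)
      have e : ∀ ω, incSum β s ζ k ω * D ω
          = ∑ i, (incSum β s ζ k ω * ζ k ω i) * (β (s (k + 1)) ω i - β (s k) ω i) := by
        intro ω
        rw [hD, Finset.mul_sum]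
        exact Finset.sum_congr rfl fun i _ => by ring
      simp_rw [e]
      rw [integral_finsetSum]
      · exact Finset.sum_eq_zero fun i _ => hβ.integral_mul_increment (hs k.le_succ)
          ((measurable_incSum hβ hs hζ k).mul (hζi i)) i
      · intro i _
        have h1 : MemLp (fun ω => incSum β s ζ k ω * ζ k ω i) 2 Q := by
          refine (hM.const_mul C).mono
            (hM.1.mul ((hζi i).mono (ℱ.le _) le_rfl).aestronglyMeasurable)
            (ae_of_all _ fun ω => ?_)
          rw [norm_mul, norm_mul, mul_comm]
          refine mul_le_mul_of_nonneg_right ?_ (norm_nonneg _)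
          exact (hC k ω i).trans (le_abs_self C)
        exact h1.integrable_mul (hmul i)
    have hDsq : ∫ ω, D ω ^ 2 ∂Q = ∫ ω, (∑ i, ζ k ω i ^ 2) * ((s (k + 1) : ℝ) - s k) ∂Q := by
      rw [integral_eq_lintegral_of_nonneg_ae (ae_of_all _ fun ω => sq_nonneg _)
        (hDm.1.pow 2), integral_eq_lintegral_of_nonneg_ae
        (ae_of_all _ fun ω => sum_sq_mul_nonneg hs k ω),
        hβ.lintegral_mul_sq (hs k.le_succ) (hζ k)]
      refine (Measurable.mul_const (Finset.measurable_sum _ fun i _ => Measurable.pow_const ?_ _)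
        _).aestronglyMeasurable
      exact (measurable_pi_apply i).comp ((hζ k).mono (ℱ.le _) le_rfl)
    have e : ∀ ω, incSum β s ζ (k + 1) ω ^ 2
        = incSum β s ζ k ω ^ 2 + 2 * (incSum β s ζ k ω * D ω) + D ω ^ 2 := by
      intro ω
      rw [incSum_succ]
      ring
    have hV := integrable_incVar (Q := Q) hs hζ hC
    have e2 : ∀ ω, (∑ i, ζ k ω i ^ 2) * ((s (k + 1) : ℝ) - s k)
        = incVar s ζ (k + 1) ω - incVar s ζ k ω := by
      intro ω
      rw [incVar_succ]
      ring
    simp_rw [e2] at hDsq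
    rw [integral_sub (hV _) (hV _)] at hDsq
    simp_rw [e]
    have hMD : Integrable (fun ω => incSum β s ζ k ω * D ω) Q := hM.integrable_mul hDm
    rw [integral_add (f := fun ω => incSum β s ζ k ω ^ 2 + 2 * (incSum β s ζ k ω * D ω))
      (hM.integrable_sq.add (hMD.const_mul 2)) hDm.integrable_sq,
      integral_add (f := fun ω => incSum β s ζ k ω ^ 2) hM.integrable_sq (hMD.const_mul 2),
      integral_const_mul, hcross, ih, hDsq]
    ring

/-- A maximal inequality of Lenglart type for step processes: the process is stopped before it
exceeds `δ` or its quadratic variation exceeds `η`. -/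
theorem measure_exists_le_abs_incSum (hβ : IsBrownianMotion ℱ Q β) (hs : Monotone s)
    (hζ : ∀ k, Measurable[ℱ (s k)] (ζ k)) {C : ℝ} (hC : ∀ k ω i, |ζ k ω i| ≤ C) (N : ℕ)
    {δ η : ℝ} (hδ : 0 < δ) (hη : 0 ≤ η) :
    Q {ω | ∃ k ≤ N, δ ≤ |incSum β s ζ k ω|}
      ≤ Q {ω | η < incVar s ζ N ω} + ENNReal.ofReal (η / δ ^ 2) := by
  classical
  -- on `A j` neither bound has been violated by the `j`-th step; this is known at time `s j` because
  -- the quadratic variation is predictable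
  let A : ℕ → Set Ω := fun j =>
    {ω | (∀ i ∈ Finset.range (j + 1), |incSum β s ζ i ω| < δ) ∧ incVar s ζ (j + 1) ω ≤ η}
  have hA : ∀ j, MeasurableSet[ℱ (s j)] (A j) := by
    intro j
    refine MeasurableSet.inter ?_ ?_
    · have : {ω | ∀ i ∈ Finset.range (j + 1), |incSum β s ζ i ω| < δ}
          = ⋂ i ∈ Finset.range (j + 1), {ω | |incSum β s ζ i ω| < δ} := by
        ext ω
        simp
      change MeasurableSet[ℱ (s j)] {ω | ∀ i ∈ Finset.range (j + 1), |incSum β s ζ i ω| < δ}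
      rw [this]
      refine Finset.measurableSet_biInter _ fun i hi => ?_
      have hi : i ≤ j := by have := Finset.mem_range.1 hi; omega
      have hm : Measurable[ℱ (s j)] fun ω => |incSum β s ζ i ω| :=
        measurable_norm.comp ((measurable_incSum hβ hs hζ i).mono (ℱ.mono (hs hi)) le_rfl)
      exact hm measurableSet_Iio
    · have hm : Measurable[ℱ (s j)] (incVar s ζ (j + 1)) := measurable_incVar hs hζ (j + 1)
      exact hm measurableSet_Iic
  let ζ' : ℕ → Ω → ι → ℝ := fun j => (A j).indicator (ζ j)
  have hζ' : ∀ k, Measurable[ℱ (s k)] (ζ' k) := fun k => (hζ k).indicator (hA k)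
  have hζ'1 : ∀ {j ω}, ω ∈ A j → ζ' j ω = ζ j ω := fun h => indicator_of_mem h _
  have hζ'0 : ∀ {j ω}, ω ∉ A j → ζ' j ω = 0 := fun h => indicator_of_notMem h _
  have hC' : ∀ k ω i, |ζ' k ω i| ≤ |C| := by
    intro k ω i
    by_cases h : ω ∈ A k
    · rw [hζ'1 h]
      exact (hC k ω i).trans (le_abs_self C)
    · rw [hζ'0 h]
      simp
  have hvar : ∀ N ω, incVar s ζ' N ω ≤ η := by
    intro N ω
    induction N with
    | zero => simpa [incVar] using hη
    | succ N ih =>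
      by_cases h : ω ∈ A N
      · refine le_trans (Finset.sum_le_sum fun j _ => ?_) h.2
        by_cases h' : ω ∈ A j
        · rw [hζ'1 h']
        · rw [hζ'0 h']
          simpa using sum_sq_mul_nonneg hs j ω
      · rw [incVar_succ, hζ'0 h]
        simpa using ih
  have hint : ∫ ω, incSum β s ζ' N ω ^ 2 ∂Q ≤ η := by
    rw [integral_incSum_sq hβ hs hζ' hC']
    refine (integral_mono (integrable_incVar hs hζ' hC' N) (integrable_const η)
      fun ω => hvar N ω).trans ?_
    simp
  have hsub : {ω | ∃ k ≤ N, δ ≤ |incSum β s ζ k ω|}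
      ⊆ {ω | η < incVar s ζ N ω} ∪ {ω | δ ^ 2 ≤ incSum β s ζ' N ω ^ 2} := by
    intro ω hω
    by_cases hv : η < incVar s ζ N ω
    · exact Or.inl hv
    right
    have hex : ∃ k, k ≤ N ∧ δ ≤ |incSum β s ζ k ω| := hω
    -- at the first passage `k` the stopped process agrees with the original one and stays frozen
    obtain ⟨hk, hk'⟩ := Nat.find_spec hex
    set k := Nat.find hex with hkdef
    have hmin : ∀ j < k, |incSum β s ζ j ω| < δ := fun j hj => by
      by_contra hcon
      exact Nat.find_min hex hj ⟨hj.le.trans hk, not_lt.1 hcon⟩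
    have hin : ∀ j < k, ω ∈ A j := fun j hj =>
      ⟨fun i hi => hmin i (by have := Finset.mem_range.1 hi; omega),
        (incVar_mono hs ω (by omega : j + 1 ≤ N)).trans (not_lt.1 hv)⟩
    have hout : ∀ j, k ≤ j → ω ∉ A j := fun j hj hmem =>
      absurd (hmem.1 k (Finset.mem_range.2 (by omega))) (not_lt.2 hk')
    have heq : incSum β s ζ' N ω = incSum β s ζ k ω := by
      unfold incSum
      rw [← Finset.sum_range_add_sum_Ico _ hk, Finset.sum_congr rfl fun j hj => by
        rw [hζ'1 (hin j (Finset.mem_range.1 hj))]]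
      rw [add_eq_left]
      refine Finset.sum_eq_zero fun j hj => ?_
      rw [hζ'0 (hout j (Finset.mem_Ico.1 hj).1)]
      simp
    change δ ^ 2 ≤ incSum β s ζ' N ω ^ 2
    rw [heq, ← sq_abs (incSum β s ζ k ω)]
    exact pow_le_pow_left₀ hδ.le hk' 2
  refine (measure_mono hsub).trans ((measure_union_le _ _).trans (add_le_add le_rfl ?_))
  have hcheb := mul_meas_ge_le_integral_of_nonneg (μ := Q)
    (ae_of_all _ fun ω => sq_nonneg (incSum β s ζ' N ω))
    (memLp_incSum hβ hs hζ' hC' N).integrable_sq (δ ^ 2)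
  rw [← ofReal_measureReal]
  refine ENNReal.ofReal_le_ofReal ?_
  rw [le_div_iff₀ (by positivity), mul_comm]
  exact hcheb.trans hint

/-- The exponential martingale of a step process. -/
theorem lintegral_mul_exp_incSum (hβ : IsBrownianMotion ℱ Q β) (hs : Monotone s)
    (hζ : ∀ k, Measurable[ℱ (s k)] (ζ k)) {k N : ℕ} (hkN : k ≤ N)
    {G : Ω → ℝ≥0∞} (hG : Measurable[ℱ (s k)] G) :
    ∫⁻ ω, G ω * ENNReal.ofReal (Real.exp ((incSum β s ζ N ω - incSum β s ζ k ω)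
        - (incVar s ζ N ω - incVar s ζ k ω) / 2)) ∂Q
      = ∫⁻ ω, G ω ∂Q := by
  induction N, hkN using Nat.le_induction with
  | base => simp
  | succ N hkN ih =>
    rw [← ih]
    have hG' : Measurable[ℱ (s N)] fun ω => G ω *
        ENNReal.ofReal (Real.exp ((incSum β s ζ N ω - incSum β s ζ k ω)
          - (incVar s ζ N ω - incVar s ζ k ω) / 2)) := by
      have hV : ∀ j ≤ N, Measurable[ℱ (s N)] (incVar s ζ j) := fun j hj =>
        (measurable_incVar hs hζ j).mono (ℱ.mono (hs (by omega))) le_rfl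
      have hS : ∀ j ≤ N, Measurable[ℱ (s N)] (incSum β s ζ j) := fun j hj =>
        (measurable_incSum hβ hs hζ j).mono (ℱ.mono (hs hj)) le_rfl
      refine (hG.mono (ℱ.mono (hs hkN)) le_rfl).mul
        (ENNReal.measurable_ofReal.comp (Real.measurable_exp.comp ?_))
      exact ((hS N le_rfl).sub (hS k hkN)).sub (((hV N le_rfl).sub (hV k hkN)).div_const 2)
    rw [← hβ.lintegral_mul_exp (hs N.le_succ) (hζ N) hG']
    refine lintegral_congr fun ω => ?_
    rw [mul_assoc, ← ENNReal.ofReal_mul (Real.exp_pos _).le, ← Real.exp_add, incSum_succ,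
      incVar_succ]
    congr 3
    ring

end Discrete

/-! ### Refining grids -/

/-- A finite grid of `[0, T]` of mesh at most `δ` such that no point of `A` lies strictly between
two neighbours. -/
theorem exists_grid (A : Finset ℝ≥0) (T : ℝ≥0) {δ : ℝ≥0} (hδ : 0 < δ) :
    ∃ (s : ℕ → ℝ≥0) (N : ℕ), Monotone s ∧ s 0 = 0 ∧ s N = T ∧ (∀ k, s k ≤ T) ∧
      (∀ k, s (k + 1) ≤ s k + δ) ∧ ∀ a ∈ A, ∀ k, a ≤ s k ∨ s (k + 1) ≤ a := by
  classical
  -- the multiples of `δ` up to `T` are added to `A`, together with the end points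
  let M := ⌈T / δ⌉₊
  let A' := A ∪ (Finset.range (M + 1)).image fun j : ℕ => (j : ℝ≥0) * δ
  let B := insert 0 (insert T (A'.filter (· ≤ T)))
  have hB0 : 0 ∈ B := by simp [B]
  have hBT : T ∈ B := by simp [B]
  have hBle : ∀ b ∈ B, b ≤ T := by
    intro b hb
    simp only [B, Finset.mem_insert, Finset.mem_filter] at hb
    rcases hb with rfl | rfl | hb
    · exact zero_le
    · exact le_rfl
    · exact hb.2
  obtain ⟨N, hN⟩ : ∃ N, B.card = N + 1 :=
    Nat.exists_eq_add_one.2 (Finset.card_pos.2 ⟨0, hB0⟩)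
  let e := B.orderEmbOfFin hN
  have he : ∀ b ∈ B, ∃ i, e i = b := fun b hb => by
    have : b ∈ Set.range e := by rw [Finset.range_orderEmbOfFin]; exact hb
    exact this
  let s : ℕ → ℝ≥0 := fun k => e ⟨min k N, by omega⟩
  have hs : Monotone s := fun a b hab => e.monotone (by
    rw [Fin.le_def]
    exact min_le_min_right N hab)
  have hsT : ∀ k, s k ≤ T := fun k => hBle _ (Finset.orderEmbOfFin_mem _ _ _)
  have hA' : ∀ a ∈ A', ∀ k, a ≤ s k ∨ s (k + 1) ≤ a := by
    intro a ha k
    rcases le_or_gt a T with haT | haT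
    · obtain ⟨i, hi⟩ := he a (by simp [B, ha, haT])
      rcases le_or_gt (i : ℕ) k with hik | hik
      · left
        rw [← hi]
        refine e.monotone ?_
        rw [Fin.le_def]
        exact le_min hik (by omega)
      · right
        rw [← hi]
        refine e.monotone ?_
        rw [Fin.le_def]
        exact (min_le_left _ _).trans hik
    · exact Or.inr ((hsT _).trans haT.le)
  refine ⟨s, N, hs, ?_, ?_, hsT, ?_, fun a ha => hA' a (Finset.mem_union_left _ ha)⟩
  · obtain ⟨i, hi⟩ := he 0 hB0
    refine le_antisymm ?_ (zero_le)
    rw [← hi]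
    exact e.monotone (by rw [Fin.le_def]; simp)
  · obtain ⟨i, hi⟩ := he T hBT
    refine le_antisymm (hsT N) ?_
    rw [← hi]
    exact e.monotone (by rw [Fin.le_def]; simp only [min_self]; omega)
  · intro k
    let j := ⌊s k / δ⌋₊ + 1
    have h1 : s k < j * δ := by
      rw [← div_lt_iff₀ hδ]
      exact_mod_cast Nat.lt_floor_add_one (s k / δ)
    have h2 : j * δ ≤ s k + δ := by
      have := Nat.floor_le (zero_le (a := s k / δ))
      rw [le_div_iff₀ hδ] at this
      simp only [j]
      push_cast
      rw [add_mul, one_mul]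
      exact add_le_add_left this δ
    rcases le_or_gt j M with hj | hj
    · have hmem : (j : ℝ≥0) * δ ∈ A' := Finset.mem_union_right _
        (Finset.mem_image.2 ⟨j, Finset.mem_range.2 (Nat.lt_succ_of_le hj), rfl⟩)
      rcases hA' _ hmem k with h | h
      · exact absurd h (not_le.2 h1)
      · exact h.trans h2
    · refine (hsT _).trans (le_trans ?_ h2)
      rw [← div_le_iff₀ hδ]
      exact (Nat.le_ceil _).trans (by exact_mod_cast hj.le)

/-- A point of `[0, T]` that does not lie strictly between neighbours of a grid belongs to it. -/
theorem exists_eq_of_grid {s : ℕ → ℝ≥0} {N : ℕ} {a : ℝ≥0} (h0 : s 0 = 0)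
    (ha : a ≤ s N) (h : ∀ k, a ≤ s k ∨ s (k + 1) ≤ a) : ∃ k ≤ N, s k = a := by
  classical
  have hex : ∃ k, a ≤ s k := ⟨N, ha⟩
  refine ⟨Nat.find hex, Nat.find_le ha, le_antisymm ?_ (Nat.find_spec hex)⟩
  rcases Nat.eq_zero_or_pos (Nat.find hex) with hz | hz
  · rw [hz, h0]
    exact zero_le
  · have h1 := Nat.find_min hex (Nat.sub_lt hz one_pos)
    have h2 := (h (Nat.find hex - 1)).resolve_left h1
    rwa [Nat.sub_add_cancel (n := Nat.find hex) (m := 1) hz] at h2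

/-- Every point of `(0, T]` lies in a cell of a grid of `[0, T]`. -/
theorem exists_mem_cell {s : ℕ → ℝ≥0} {N : ℕ} {r : ℝ≥0} (h0 : s 0 = 0) (hr0 : 0 < r)
    (hr : r ≤ s N) : ∃ k < N, r ∈ Ioc (s k) (s (k + 1)) := by
  classical
  have hex : ∃ k, r ≤ s k := ⟨N, hr⟩
  have hz : 0 < Nat.find hex := by
    rw [Nat.pos_iff_ne_zero]
    intro hz
    have := Nat.find_spec hex
    rw [hz, h0] at this
    exact absurd hr0 (not_lt.2 this)
  have hle : Nat.find hex ≤ N := Nat.find_le hr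
  refine ⟨Nat.find hex - 1, by omega, not_le.1 (Nat.find_min hex (Nat.sub_lt hz one_pos)), ?_⟩
  rw [Nat.sub_add_cancel (n := Nat.find hex) (m := 1) hz]
  exact Nat.find_spec hex

section Simple

variable {Ω : Type*} {mΩ : MeasurableSpace Ω} {ι : Type*} {ℱ : Filtration ℝ≥0 mΩ}

namespace SimpleIntegrand

variable (S : SimpleIntegrand ℱ ι) {s : ℕ → ℝ≥0}

/-- The times of a simple process. -/
def times : Finset ℝ≥0 := (Finset.range (S.N + 1)).image S.time

theorem time_le_or (hA : ∀ a ∈ S.times, ∀ k, a ≤ s k ∨ s (k + 1) ≤ a) {l : ℕ} (hl : l ≤ S.N)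
    (k : ℕ) : S.time l ≤ s k ∨ s (k + 1) ≤ S.time l :=
  hA _ (Finset.mem_image.2 ⟨l, Finset.mem_range.2 (by omega), rfl⟩) k

/-- A simple process is constant on the cells of a grid that refines its times. -/
theorem value_eq_of_mem_cell (hA : ∀ a ∈ S.times, ∀ k, a ≤ s k ∨ s (k + 1) ≤ a) {k : ℕ} {r : ℝ≥0}
    (hr : r ∈ Ioc (s k) (s (k + 1))) (ω : Ω) : S.value r ω = S.value (s (k + 1)) ω := by
  classical
  funext i
  refine Finset.sum_congr rfl fun l hl => ?_
  have hl := Finset.mem_range.1 hl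
  have hlt : ∀ l' ≤ S.N, S.time l' < r ↔ S.time l' < s (k + 1) := fun l' hl' => by
    rcases S.time_le_or hA hl' k with h | h
    · exact ⟨fun _ => h.trans_lt (hr.1.trans_le hr.2), fun _ => h.trans_lt hr.1⟩
    · exact ⟨fun h' => h'.trans_le hr.2, fun h' => absurd h (not_le.2 h')⟩
  have hiff : r ∈ Ioc (S.time l) (S.time (l + 1)) ↔
      s (k + 1) ∈ Ioc (S.time l) (S.time (l + 1)) := by
    rw [mem_Ioc, mem_Ioc, ← not_lt, ← not_lt (b := s (k + 1)), hlt l hl.le, hlt (l + 1) hl]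
  simp only [indicator_apply, hiff]

theorem measurable_value (hA : ∀ a ∈ S.times, ∀ k, a ≤ s k ∨ s (k + 1) ≤ a) (k : ℕ) :
    Measurable[ℱ (s k)] (S.value (s (k + 1))) := by
  classical
  refine @measurable_pi_lambda _ _ _ (ℱ (s k)) _ _ fun i => Finset.measurable_sum _ fun l hl => ?_
  have hl := Finset.mem_range.1 hl
  by_cases h : s (k + 1) ∈ Ioc (S.time l) (S.time (l + 1))
  · simp only [indicator_of_mem h]
    have h1 := (S.time_le_or hA hl.le k).resolve_right (not_le.2 h.1)
    exact (measurable_pi_apply i).comp ((S.coeff_measurable l).mono (ℱ.mono h1) le_rfl)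
  · simp only [indicator_of_notMem h]
    exact measurable_const

theorem measurable_value_path (ω : Ω) (i : ι) : Measurable fun r => S.value r ω i := by
  classical
  exact Finset.measurable_sum _ fun l _ => measurable_const.indicator measurableSet_Ioc

theorem exists_abs_value_le : ∃ C : ℝ, ∀ r ω i, |S.value r ω i| ≤ C := by
  classical
  obtain ⟨C, hC⟩ := S.coeff_bounded
  refine ⟨S.N * |C|, fun r ω i => (Finset.abs_sum_le_sum_abs _ _).trans ?_⟩
  refine (Finset.sum_le_card_nsmul _ _ |C| fun l _ => ?_).trans (by simp)
  by_cases h : r ∈ Ioc (S.time l) (S.time (l + 1))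
  · rw [indicator_of_mem h]
    exact (hC l ω i).trans (le_abs_self C)
  · rw [indicator_of_notMem h]
    simp

/-- Along a grid that refines the times of a simple process, its elementary integral is a sum over
the cells of the grid. -/
theorem integral_eq_incSum [Fintype ι] (hs : Monotone s) (h0 : s 0 = 0)
    (hA : ∀ a ∈ S.times, ∀ k, a ≤ s k ∨ s (k + 1) ≤ a) (β : ℝ≥0 → Ω → ι → ℝ) (k : ℕ) (ω : Ω) :
    S.integral β (s k) ω = incSum β s (fun j => S.value (s (j + 1))) k ω := by
  classical
  induction k with
  | zero =>
    simp [SimpleIntegrand.integral, incSum, h0]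
  | succ k ih =>
    rw [incSum_succ, ← ih]
    simp only [SimpleIntegrand.integral, SimpleIntegrand.value, Finset.sum_mul]
    rw [Finset.sum_comm (s := Finset.univ) (t := Finset.range S.N), ← Finset.sum_add_distrib]
    refine Finset.sum_congr rfl fun l hl => ?_
    have hl := Finset.mem_range.1 hl
    rw [← Finset.sum_add_distrib]
    refine Finset.sum_congr rfl fun i _ => ?_
    have hsk := hs k.le_succ
    have ht := S.time_mono l.le_succ
    rcases S.time_le_or hA hl.le k with h1 | h1
    · rcases S.time_le_or hA (l := l + 1) hl k with h2 | h2
      · have hn : s (k + 1) ∈ Ioc (S.time l) (S.time (l + 1)) → s (k + 1) = s k :=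
          fun h => le_antisymm (h.2.trans h2) hsk
        rw [min_eq_left h2, min_eq_left h1, min_eq_left (h2.trans hsk), min_eq_left (h1.trans hsk)]
        by_cases h : s (k + 1) ∈ Ioc (S.time l) (S.time (l + 1))
        · rw [hn h]
          simp
        · rw [indicator_of_notMem h]
          simp
      · rw [min_eq_right h2, min_eq_left h1, min_eq_right (hsk.trans h2),
          min_eq_left (h1.trans hsk)]
        by_cases h : s (k + 1) ∈ Ioc (S.time l) (S.time (l + 1))
        · rw [indicator_of_mem h]
          ring
        · rw [indicator_of_notMem h]
          have h3 : s (k + 1) = s k := le_antisymm (by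
            by_contra hcon
            exact h ⟨h1.trans_lt (not_le.1 hcon), h2⟩) hsk
          rw [h3]
          simp
    · have h : s (k + 1) ∉ Ioc (S.time l) (S.time (l + 1)) := fun h => absurd h.1 (not_lt.2 h1)
      rw [indicator_of_notMem h, min_eq_right (h1.trans ht), min_eq_right h1,
        min_eq_right (hsk.trans (h1.trans ht)), min_eq_right (hsk.trans h1)]
      simp

end SimpleIntegrand

end Simple

/-! ### The modulus of continuity in probability -/

/-- The modulus of continuity on `[0, T]` of a process with continuous paths tends to zero in
probability. -/
theorem tendsto_measure_oscillation {Ω E : Type*} {mΩ : MeasurableSpace Ω} {Q : Measure Ω}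
    [IsFiniteMeasure Q] [PseudoMetricSpace E] [SecondCountableTopology E] [MeasurableSpace E]
    [OpensMeasurableSpace E]
    {f : ℝ≥0 → Ω → E} (hf : ∀ t, Measurable (f t)) (hc : ∀ᵐ ω ∂Q, Continuous fun t => f t ω)
    (T : ℝ≥0) {e : ℝ} (he : 0 < e) :
    Tendsto (fun n : ℕ => Q {ω | ∃ r t, r ≤ T ∧ t ≤ T ∧ dist r t < 1 / ((n : ℝ) + 1) ∧
      e < dist (f r ω) (f t ω)}) atTop (𝓝 0) := by
  -- by continuity the oscillation may be taken over a countable dense set of times, which makes the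
  -- events `B n` measurable; they decrease to a null event by uniform continuity on `[0, T]`
  let q := TopologicalSpace.denseSeq ℝ≥0
  let g : ℝ≥0 → Ω → E := fun t ω => f (min t T) ω
  let B : ℕ → Set Ω := fun n => ⋃ (a : ℕ) (b : ℕ) (_ : dist (q a) (q b) < 1 / ((n : ℝ) + 1)),
    {ω | e < dist (g (q a) ω) (g (q b) ω)}
  have hBm : ∀ n, MeasurableSet (B n) := fun n =>
    MeasurableSet.iUnion fun a => MeasurableSet.iUnion fun b => MeasurableSet.iUnion fun _ =>
      measurableSet_lt measurable_const ((hf _).dist (hf _))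
  have hBanti : Antitone B := by
    intro m n hmn ω hω
    simp only [B, mem_iUnion] at hω ⊢
    obtain ⟨a, b, hab, h⟩ := hω
    exact ⟨a, b, hab.trans_le (one_div_le_one_div_of_le (by positivity) (by gcongr)), h⟩
  have hlim := tendsto_measure_iInter_atTop (μ := Q) (fun n => (hBm n).nullMeasurableSet) hBanti
    ⟨0, measure_ne_top _ _⟩
  have hzero : Q (⋂ n, B n) = 0 := by
    refine measure_mono_null (t := {ω | ¬ Continuous fun t => f t ω}) (fun ω hω hcω => ?_) hc
    have hgu : UniformContinuousOn (fun t => f t ω) (Icc 0 T) :=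
      isCompact_Icc.uniformContinuousOn_of_continuous hcω.continuousOn
    obtain ⟨δ, hδ, hδ'⟩ := Metric.uniformContinuousOn_iff.1 hgu e he
    obtain ⟨n, hn⟩ := exists_nat_one_div_lt hδ
    have := mem_iInter.1 hω n
    simp only [B, mem_iUnion] at this
    obtain ⟨a, b, hab, h⟩ := this
    refine absurd (hδ' (min (q a) T) ⟨zero_le, min_le_right _ _⟩ (min (q b) T)
      ⟨zero_le, min_le_right _ _⟩ ?_) (not_lt.2 (le_of_lt h))
    refine lt_of_le_of_lt ?_ (hab.trans hn)
    rw [NNReal.dist_eq, NNReal.dist_eq, NNReal.coe_min, NNReal.coe_min]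
    exact abs_min_sub_min_le_max _ _ _ _ |>.trans (by simp)
  rw [hzero] at hlim
  refine tendsto_of_tendsto_of_tendsto_of_le_of_le tendsto_const_nhds hlim (fun _ => zero_le)
    fun n => ?_
  have hnull : Q {ω | ¬ Continuous fun t => f t ω} = 0 := hc
  refine (measure_mono (t := B n ∪ {ω | ¬ Continuous fun t => f t ω}) ?_).trans
    ((measure_union_le _ _).trans (by rw [hnull, add_zero]; exact le_rfl))
  rintro ω ⟨r, t, hr, ht, hrt, h⟩
  by_cases hcω : Continuous fun t => f t ω
  · left
    have hgc : Continuous fun t => g t ω := hcω.comp (continuous_id.min continuous_const)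
    have hopen : IsOpen {p : ℝ≥0 × ℝ≥0 | dist p.1 p.2 < 1 / ((n : ℝ) + 1) ∧
        e < dist (g p.1 ω) (g p.2 ω)} :=
      (isOpen_lt (continuous_fst.dist continuous_snd) continuous_const).inter (isOpen_lt
        continuous_const ((hgc.comp continuous_fst).dist (hgc.comp continuous_snd)))
    have hd : DenseRange (Prod.map q q) :=
      (TopologicalSpace.denseRange_denseSeq ℝ≥0).prodMap (TopologicalSpace.denseRange_denseSeq ℝ≥0)
    obtain ⟨⟨a, b⟩, hab⟩ := hd.exists_mem_open hopen ⟨(r, t), hrt, by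
      simpa only [g, min_eq_left hr, min_eq_left ht] using h⟩
    simp only [B, mem_iUnion]
    exact ⟨a, b, hab.1, hab.2⟩
  · exact Or.inr hcω

/-! ### Progressive processes -/

section Progressive

theorem measurable_min_prod {Ω : Type*} [MeasurableSpace Ω] (t : ℝ≥0) :
    Measurable fun p : ℝ≥0 × Ω => ((⟨min p.1 t, mem_Iic.2 (min_le_right _ _)⟩ : Iic t), p.2) :=
  ((measurable_fst.min measurable_const).subtype_mk).prodMk measurable_snd

variable {Ω E : Type*} {mΩ : MeasurableSpace Ω} {ℱ : Filtration ℝ≥0 mΩ} [TopologicalSpace E]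

/-- Stopping a progressive process at a fixed time `t` makes it measurable on the whole time axis,
with respect to `ℱ t` in the second variable. -/
theorem stronglyMeasurable_stopped {u : ℝ≥0 → Ω → E} (hu : IsStronglyProgressive ℱ u) (t : ℝ≥0) :
    StronglyMeasurable[(inferInstance : MeasurableSpace ℝ≥0).prod (ℱ t)]
      fun p : ℝ≥0 × Ω => u (min p.1 t) p.2 := by
  exact (hu t).comp_measurable (@measurable_min_prod Ω (ℱ t) t)

theorem measurable_path [TopologicalSpace.PseudoMetrizableSpace E] [MeasurableSpace E]
    [BorelSpace E] {u : ℝ≥0 → Ω → E}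
    (hu : IsStronglyProgressive ℱ u) (ω : Ω) : Measurable fun r => u r ω := by
  refine measurable_of_tendsto_metrizable (f := fun (n : ℕ) r => u (min r n) ω) (fun n => ?_)
    (tendsto_pi_nhds.2 fun r => ?_)
  · have h := (stronglyMeasurable_stopped hu (n : ℝ≥0)).measurable
    exact h.comp (@measurable_prodMk_right _ _ _ (ℱ n) ω)
  · refine tendsto_const_nhds.congr' ?_
    filter_upwards [eventually_ge_atTop ⌈r⌉₊] with n hn
    rw [min_eq_left ((Nat.le_ceil r).trans (by exact_mod_cast hn))]

/-- The time integral over `[0, t]` of a progressive process is known at time `t`. -/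
theorem measurable_setIntegral_Iic {u : ℝ≥0 → Ω → ℝ} (hu : IsStronglyProgressive ℱ u) (t : ℝ≥0) :
    Measurable[ℱ t] fun ω => ∫ r in Iic t, u r ω ∂leb := by
  have h : (fun ω => ∫ r in Iic t, u r ω ∂leb) = fun ω => ∫ r in Iic t, u (min r t) ω ∂leb := by
    funext ω
    exact setIntegral_congr_fun measurableSet_Iic fun r hr => by
      simp only [min_eq_left (mem_Iic.1 hr)]
  rw [h]
  exact (@StronglyMeasurable.integral_prod_left ℝ≥0 Ω ℝ _ (ℱ t) (leb.restrict (Iic t)) _ _ _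
    (fun r ω => u (min r t) ω) (stronglyMeasurable_stopped hu t)).measurable

theorem isStronglyProgressive_eval {ι : Type*} {u : ℝ≥0 → Ω → ι → ℝ}
    (hu : IsStronglyProgressive ℱ u) (i : ι) : IsStronglyProgressive ℱ fun r ω => u r ω i :=
  fun t => (continuous_apply i).comp_stronglyMeasurable (hu t)

end Progressive

/-! ### Lower bounds for products -/

theorem exp_sub_two_mul_sq_le {x : ℝ} (hx : |x| ≤ 1 / 2) : Real.exp (x - 2 * x ^ 2) ≤ 1 + x := by
  have h1 : 1 / 2 ≤ 1 + x := by linarith [(abs_le.1 hx).1]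
  have h0 : 0 < 1 + x := by linarith
  have h2 : (1 + x)⁻¹ ≤ Real.exp ((1 + x)⁻¹ - 1) := by
    simpa using Real.add_one_le_exp ((1 + x)⁻¹ - 1)
  have h3 : Real.exp (-((1 + x)⁻¹ - 1)) ≤ 1 + x := by
    rw [Real.exp_neg]
    exact inv_le_of_inv_le₀ h0 h2
  refine (Real.exp_le_exp.2 ?_).trans h3
  have h4 : -((1 + x)⁻¹ - 1) = x - x ^ 2 * (1 + x)⁻¹ := by
    field_simp
    ring
  have h5 : (1 + x)⁻¹ ≤ 2 := by
    rw [inv_le_comm₀ h0 two_pos]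
    linarith
  rw [h4]
  nlinarith [mul_le_mul_of_nonneg_left h5 (sq_nonneg x)]

/-- A recursion `m_{k+1} = m_k (1 + x_k)` that is known to hold only as long as `m_k ≥ κ` does not
reach the level `κ` if the logarithms of its factors add up to at least `log κ`. -/
theorem exp_neg_le_of_recursion {N : ℕ} {m x : ℕ → ℝ} {κ K : ℝ} (h0 : m 0 = 1)
    (hstep : ∀ k < N, κ ≤ m k → m (k + 1) = m k * (1 + x k)) (hx : ∀ k < N, |x k| ≤ 1 / 2)
    (hsum : ∀ k ≤ N, -K ≤ ∑ j ∈ Finset.range k, (x j - 2 * x j ^ 2)) (hκ : κ ≤ Real.exp (-K)) :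
    ∀ k ≤ N, Real.exp (-K) ≤ m k := by
  have key : ∀ k ≤ N, Real.exp (∑ j ∈ Finset.range k, (x j - 2 * x j ^ 2)) ≤ m k := by
    intro k
    induction k with
    | zero => intro _; simp [h0]
    | succ k ih =>
      intro hk
      have ih := ih (by omega)
      have h1 : κ ≤ m k := hκ.trans ((Real.exp_le_exp.2 (hsum k (by omega))).trans ih)
      rw [hstep k (by omega) h1, Finset.sum_range_succ, Real.exp_add]
      exact mul_le_mul ih (exp_sub_two_mul_sq_le (hx k (by omega))) (Real.exp_pos _).le
        ((Real.exp_pos _).le.trans ih)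
  exact fun k hk => (Real.exp_le_exp.2 (hsum k hk)).trans (key k hk)

/-! ### Approximation of a stochastic integral along a grid -/

/-- The projection of `x` to `[-a, a]`. -/
def clamp (a x : ℝ) : ℝ := max (-a) (min a x)

theorem abs_clamp_le {a : ℝ} (ha : 0 ≤ a) (x : ℝ) : |clamp a x| ≤ a :=
  abs_le.2 ⟨le_max_left _ _, max_le (by linarith) (min_le_left _ _)⟩

theorem abs_clamp_le_abs {a : ℝ} (ha : 0 ≤ a) (x : ℝ) : |clamp a x| ≤ |x| := by
  unfold clamp
  rcases le_total a x with h | h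
  · rw [min_eq_left h, max_eq_right (by linarith)]
    rw [abs_of_nonneg ha]
    exact h.trans (le_abs_self x)
  · rw [min_eq_right h]
    rcases le_total (-a) x with h' | h'
    · rw [max_eq_right h']
    · rw [max_eq_left h', abs_neg, abs_of_nonneg ha]
      exact (by linarith : a ≤ -x).trans (neg_le_abs x)

/-- Projecting to `[-a, a]` moves `x` closer to every point that is within `b` of `[-a, a]`,
up to `b`. -/
theorem abs_clamp_sub_le {a b y : ℝ} (ha : 0 ≤ a) (hb : 0 ≤ b) (hy : |y| ≤ a + b) (x : ℝ) :
    |clamp a x - y| ≤ |x - y| + b := by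
  obtain ⟨h1, h2⟩ := abs_le.1 hy
  unfold clamp
  rcases le_total a x with h | h
  · rw [min_eq_left h, max_eq_right (by linarith)]
    refine abs_le.2 ⟨?_, ?_⟩ <;> linarith [le_abs_self (x - y), abs_nonneg (x - y)]
  · rw [min_eq_right h]
    rcases le_total (-a) x with h' | h'
    · rw [max_eq_right h']
      linarith
    · rw [max_eq_left h']
      refine abs_le.2 ⟨?_, ?_⟩ <;> linarith [neg_le_abs (x - y), abs_nonneg (x - y)]

/-- Projecting `x` to `[-a, a]` moves it by at most its distance to any point of `[-a, a]`. -/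
theorem abs_sub_clamp_le {a y : ℝ} (hy : |y| ≤ a) (x : ℝ) : |x - clamp a x| ≤ |x - y| := by
  obtain ⟨h1, h2⟩ := abs_le.1 hy
  unfold clamp
  rcases le_total a x with h | h
  · rw [min_eq_left h, max_eq_right (by linarith), abs_of_nonneg (by linarith)]
    exact (by linarith : x - a ≤ x - y).trans (le_abs_self _)
  · rw [min_eq_right h]
    rcases le_total (-a) x with h' | h'
    · rw [max_eq_right h', sub_self, abs_zero]
      exact abs_nonneg _
    · rw [max_eq_left h', abs_of_nonpos (by linarith)]
      exact (by linarith : -(x - -a) ≤ -(x - y)).trans (neg_le_abs _)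

theorem measurable_clamp : Measurable fun p : ℝ × ℝ => clamp p.1 p.2 :=
  (measurable_fst.neg).max (measurable_fst.min measurable_snd)

section Step

variable {ι : Type*} [Fintype ι]

theorem setIntegral_Iic_succ {s : ℕ → ℝ≥0} (hs : Monotone s) {T : ℝ≥0} (hT : ∀ k, s k ≤ T)
    {f : ℝ≥0 → ℝ} (hf : IntegrableOn f (Iic T) leb) (k : ℕ) :
    ∫ r in Iic (s (k + 1)), f r ∂leb
      = ∫ r in Iic (s k), f r ∂leb + ∫ r in Ioc (s k) (s (k + 1)), f r ∂leb := by
  rw [← Iic_union_Ioc_eq_Iic (hs k.le_succ)]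
  refine setIntegral_union ?_ measurableSet_Ioc (hf.mono_set (Iic_subset_Iic.2 (hT k)))
    (hf.mono_set fun r hr => hr.2.trans (hT _))
  exact Set.disjoint_left.2 fun r hr hr' => absurd hr'.1 (not_lt.2 hr)

/-- The quadratic variation of a step process, bounded cell by cell. -/
theorem incVar_le_setIntegral {Ω : Type*} {s : ℕ → ℝ≥0} (hs : Monotone s) {T : ℝ≥0}
    (hT : ∀ k, s k ≤ T) {ζ : ℕ → Ω → ι → ℝ} {ω : Ω} {f : ℝ≥0 → ℝ}
    (hf : IntegrableOn f (Iic T) leb) (hf0 : ∀ r, 0 ≤ f r) {N : ℕ}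
    (h : ∀ k < N, ∀ r ∈ Ioc (s k) (s (k + 1)), ∑ i, ζ k ω i ^ 2 ≤ f r) {k : ℕ} (hk : k ≤ N) :
    incVar s ζ k ω ≤ ∫ r in Iic (s k), f r ∂leb := by
  induction k with
  | zero => simpa [incVar] using integral_nonneg hf0
  | succ k ih =>
    rw [incVar_succ, setIntegral_Iic_succ hs hT hf]
    refine add_le_add (ih (by omega)) ?_
    have h1 : (∑ i, ζ k ω i ^ 2) * ((s (k + 1) : ℝ) - s k)
        = ∫ _ in Ioc (s k) (s (k + 1)), (∑ i, ζ k ω i ^ 2) ∂leb := by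
      rw [setIntegral_const, measureReal_def, leb_Ioc,
        ENNReal.toReal_ofReal (sub_nonneg_of_monotone hs k), smul_eq_mul, mul_comm]
    rw [h1]
    refine setIntegral_mono_on ?_ (hf.mono_set fun r hr => hr.2.trans (hT _)) measurableSet_Ioc
      fun r hr => h k (by omega) r hr
    refine integrableOn_const ?_
    rw [leb_Ioc]
    exact ENNReal.ofReal_ne_top

/-- Comparison of `∑ ⟨ξ_j, ∫ η⟩` with `∫ ⟨H, η⟩`. -/
theorem abs_sum_sub_setIntegral_le {s : ℕ → ℝ≥0} (hs : Monotone s) (h0 : s 0 = 0) {T : ℝ≥0}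
    (hT : ∀ k, s k ≤ T) {ξ : ℕ → ι → ℝ} {H η : ℝ≥0 → ι → ℝ} {f : ℝ≥0 → ℝ}
    (hη : ∀ i, IntegrableOn (fun r => η r i) (Iic T) leb)
    (hHη : IntegrableOn (fun r => ∑ i, H r i * η r i) (Iic T) leb)
    (hf : IntegrableOn f (Iic T) leb) {N : ℕ}
    (h : ∀ k < N, ∀ r ∈ Ioc (s k) (s (k + 1)), |∑ i, (ξ k i - H r i) * η r i| ≤ f r)
    {k : ℕ} (hk : k ≤ N) :
    |∑ j ∈ Finset.range k, ∑ i, ξ j i * (∫ r in Iic (s (j + 1)), η r i ∂leb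
        - ∫ r in Iic (s j), η r i ∂leb) - ∫ r in Iic (s k), ∑ i, H r i * η r i ∂leb|
      ≤ ∫ r in Ioc 0 (s k), f r ∂leb := by
  induction k with
  | zero =>
    have : leb.restrict (Iic (0 : ℝ≥0)) = 0 := by
      rw [Measure.restrict_eq_zero, leb_Iic]
      simp
    simp [h0, this]
  | succ k ih =>
    have ih := ih (by omega)
    have hcell : ∀ {g : ℝ≥0 → ℝ}, IntegrableOn g (Iic T) leb →
        IntegrableOn g (Ioc (s k) (s (k + 1))) leb :=
      fun hg => hg.mono_set fun r hr => hr.2.trans (hT _)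
    have e1 : ∑ i, ξ k i * (∫ r in Iic (s (k + 1)), η r i ∂leb - ∫ r in Iic (s k), η r i ∂leb)
        - ∫ r in Ioc (s k) (s (k + 1)), ∑ i, H r i * η r i ∂leb
        = ∫ r in Ioc (s k) (s (k + 1)), ∑ i, (ξ k i - H r i) * η r i ∂leb := by
      have e2 : ∀ i, ∫ r in Iic (s (k + 1)), η r i ∂leb - ∫ r in Iic (s k), η r i ∂leb
          = ∫ r in Ioc (s k) (s (k + 1)), η r i ∂leb := fun i => by
        rw [setIntegral_Iic_succ hs hT (hη i), add_sub_cancel_left]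
      simp_rw [e2, ← integral_const_mul]
      rw [← integral_finsetSum _ fun i _ => (hcell (hη i)).const_mul _, ← integral_sub
        (integrable_finsetSum _ fun i _ => (hcell (hη i)).const_mul _) (hcell hHη)]
      refine integral_congr_ae (ae_of_all _ fun r => ?_)
      simp only [sub_mul, Finset.sum_sub_distrib]
    rw [Finset.sum_range_succ, setIntegral_Iic_succ hs hT hHη]
    have e3 : ∫ r in Ioc 0 (s (k + 1)), f r ∂leb
        = ∫ r in Ioc 0 (s k), f r ∂leb + ∫ r in Ioc (s k) (s (k + 1)), f r ∂leb := by
      rw [← Ioc_union_Ioc_eq_Ioc zero_le (hs k.le_succ)]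
      exact setIntegral_union (Ioc_disjoint_Ioc_of_le le_rfl) measurableSet_Ioc
        (hf.mono_set fun r hr => hr.2.trans (hT _)) (hcell hf)
    have e4 : |∫ r in Ioc (s k) (s (k + 1)), ∑ i, (ξ k i - H r i) * η r i ∂leb|
        ≤ ∫ r in Ioc (s k) (s (k + 1)), f r ∂leb := by
      rw [← Real.norm_eq_abs]
      exact norm_integral_le_of_norm_le (hcell hf)
        ((ae_restrict_mem measurableSet_Ioc).mono fun r hr => h k (by omega) r hr)
    rw [e3, add_sub_add_comm, e1]
    exact (abs_add_le _ _).trans (add_le_add ih e4)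

end Step

section LowerTail

variable {Ω : Type*} {mΩ : MeasurableSpace Ω} {ι : Type*} [Fintype ι]
  {ℱ : Filtration ℝ≥0 mΩ} {Q : Measure Ω} {β : ℝ≥0 → Ω → ι → ℝ}

/-- The semimartingale `∫_0^t η ds + β_t`. -/
def driftedPath (η β : ℝ≥0 → Ω → ι → ℝ) (t : ℝ≥0) (ω : Ω) (i : ι) : ℝ :=
  ∫ r in Iic t, η r ω i ∂leb + β t ω i

theorem incSum_driftedPath (η : ℝ≥0 → Ω → ι → ℝ) (s : ℕ → ℝ≥0) (ζ : ℕ → Ω → ι → ℝ) (k : ℕ)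
    (ω : Ω) :
    incSum (driftedPath η β) s ζ k ω = ∑ j ∈ Finset.range k, ∑ i, ζ j ω i *
      (∫ r in Iic (s (j + 1)), η r ω i ∂leb - ∫ r in Iic (s j), η r ω i ∂leb)
      + incSum β s ζ k ω := by
  unfold incSum driftedPath
  simp only [← Finset.sum_add_distrib]
  refine Finset.sum_congr rfl fun j _ => Finset.sum_congr rfl fun i _ => ?_
  ring

theorem integrableOn_of_bounded {f : ℝ≥0 → ℝ} (hf : Measurable f) {C : ℝ} (hC : ∀ r, |f r| ≤ C)
    (T : ℝ≥0) : IntegrableOn f (Iic T) leb :=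
  Integrable.of_bound hf.aestronglyMeasurable C (ae_of_all _ hC)

theorem integrableOn_and_setIntegral_le {T : ℝ≥0} {x y : ℝ≥0 → ι → ℝ}
    (hm : Measurable fun r => ∑ i, (x r i - y r i) ^ 2) {e : ℝ} (he : 0 ≤ e)
    (h : ¬ ENNReal.ofReal e ≤ ∫⁻ r in Iic T, ∑ i, ENNReal.ofReal ((x r i - y r i) ^ 2) ∂leb) :
    IntegrableOn (fun r => ∑ i, (x r i - y r i) ^ 2) (Iic T) leb ∧
      ∫ r in Iic T, ∑ i, (x r i - y r i) ^ 2 ∂leb ≤ e := by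
  have h0 : ∀ r, 0 ≤ ∑ i, (x r i - y r i) ^ 2 := fun r => Finset.sum_nonneg fun i _ => sq_nonneg _
  simp only [← ENNReal.ofReal_sum_of_nonneg fun i _ => sq_nonneg _] at h
  have h1 := not_le.1 h
  refine ⟨⟨hm.aestronglyMeasurable, ?_⟩, ?_⟩
  · rw [hasFiniteIntegral_iff_ofReal (ae_of_all _ h0)]
    exact h1.trans ENNReal.ofReal_lt_top
  · rw [integral_eq_lintegral_of_nonneg_ae (ae_of_all _ h0) hm.aestronglyMeasurable]
    exact ENNReal.toReal_le_of_le_ofReal he h1.le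

theorem exists_pos_le_mul_le {c a e : ℝ} (hc : 0 ≤ c) (ha : 0 < a) (he : 0 < e) :
    ∃ x, 0 < x ∧ x ≤ e ∧ c * x ≤ a := by
  refine ⟨min e (a / (c + 1)), lt_min he (by positivity), min_le_left _ _, ?_⟩
  calc c * min e (a / (c + 1)) ≤ c * (a / (c + 1)) :=
        mul_le_mul_of_nonneg_left (min_le_right _ _) hc
    _ ≤ (c + 1) * (a / (c + 1)) := by gcongr; linarith
    _ = a := by field_simp

theorem abs_le_add_sq_div {y l : ℝ} (hl : 0 < l) : |y| ≤ l + y ^ 2 / l := by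
  have h : l + y ^ 2 / l - |y| = ((l - |y| / 2) ^ 2 + 3 / 4 * y ^ 2) / l := by
    rw [sub_sq, div_pow, sq_abs]
    field_simp
    ring
  have : 0 ≤ l + y ^ 2 / l - |y| := by
    rw [h]
    positivity
  linarith

/-- Pathwise estimates behind the Euler approximation: a step process with values clamped to the
growth bound of the integrand is close to the integrand. -/
theorem clamped_estimates {C e' : ℝ} (hC : 0 ≤ C) (he' : 0 ≤ e')
    {x y : ι → ℝ} {M0 M1 : ℝ} (hM0 : 0 ≤ M0) (hy : ∀ i, |y i| ≤ C * M1)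
    (hM : dist M1 M0 ≤ e') :
    (∀ i, |clamp (C * M0) (x i) - y i| ≤ |x i - y i| + C * e') ∧
    ∑ i, (x i - clamp (C * M0) (x i)) ^ 2
      ≤ 8 * ∑ i, (x i - y i) ^ 2 + 2 * C ^ 2 * e' ^ 2 * Fintype.card ι := by
  have hMle : M1 ≤ M0 + e' := by linarith [le_abs_self (M1 - M0), Real.dist_eq M1 M0]
  have h1 : ∀ i, |clamp (C * M0) (x i) - y i| ≤ |x i - y i| + C * e' := fun i =>
    abs_clamp_sub_le (mul_nonneg hC hM0) (mul_nonneg hC he')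
      ((hy i).trans (by nlinarith)) (x i)
  refine ⟨h1, ?_⟩
  have h2 : ∀ i, (x i - clamp (C * M0) (x i)) ^ 2
      ≤ 8 * (x i - y i) ^ 2 + 2 * C ^ 2 * e' ^ 2 := by
    intro i
    have h3 : |x i - clamp (C * M0) (x i)| ≤ 2 * |x i - y i| + C * e' := by
      have := abs_sub_le (x i) (y i) (clamp (C * M0) (x i))
      rw [abs_sub_comm (y i)] at this
      linarith [h1 i]
    rw [← sq_abs (x i - clamp _ _), ← sq_abs (x i - y i)]
    have h4 := pow_le_pow_left₀ (abs_nonneg _) h3 2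
    nlinarith [sq_nonneg (2 * |x i - y i| - C * e')]
  refine (Finset.sum_le_sum fun i _ => h2 i).trans ?_
  rw [Finset.sum_add_distrib, ← Finset.mul_sum]
  simp only [Finset.sum_const, Finset.card_univ, nsmul_eq_mul]
  linarith

variable [IsProbabilityMeasure Q]

/-- A nonnegative process `M` with `M_0 = 1`, `dM = ⟨H, dY⟩`, `dY = η dt + dβ` and `|H| ≤ C M` is
approximated along a grid by an Euler scheme whose coefficients obey the same growth bound. -/
theorem exists_euler_approximation (hβ : IsBrownianMotion ℱ Q β) {T : ℝ≥0} {C : ℝ} (hC : 0 ≤ C)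
    {η H : ℝ≥0 → Ω → ι → ℝ} {M : ℝ≥0 → Ω → ℝ} (hη : IsStronglyProgressive ℱ η)
    (hηC : ∀ r ω i, |η r ω i| ≤ C) (hM : ∀ t, Measurable[ℱ t] (M t))
    (hMc : ∀ ω, Continuous fun t => M t ω) (hM0 : ∀ t ω, 0 ≤ M t ω) (hM1 : ∀ᵐ ω ∂Q, M 0 ω = 1)
    (hH : ∀ r ω i, |H r ω i| ≤ C * M r ω)
    (hI : IsIntegralAgainst ℱ Q T η β H fun t ω => M t ω - M 0 ω)
    {κ e q : ℝ} (hκ : 0 < κ) (he : 0 < e) (hq : 0 < q) :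
    ∃ (s : ℕ → ℝ≥0) (N : ℕ) (ξ : ℕ → Ω → ι → ℝ), Monotone s ∧ s 0 = 0 ∧ s N = T ∧
      (∀ k, s k ≤ T) ∧ (∀ k, (s (k + 1) : ℝ) - s k ≤ e) ∧ (∀ k, Measurable[ℱ (s k)] (ξ k)) ∧
      (∃ C' : ℝ, ∀ k ω i, |ξ k ω i| ≤ C') ∧ (∀ k ω i, |ξ k ω i| ≤ C * M (s k) ω) ∧
      Q {ω | ¬ ((∀ k ≤ N, |1 + incSum (driftedPath η β) s ξ k ω - M (s k) ω| ≤ κ) ∧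
        ∀ k, ∀ r ∈ Icc (s k) (s (k + 1)), dist (M r ω) (M (s k) ω) ≤ e ∧
          dist (β r ω) (β (s k) ω) ≤ e)} ≤ ENNReal.ofReal q := by
  obtain ⟨hHη, hIto⟩ := hI
  obtain ⟨S, hS1, hS2⟩ := hIto.approx
  set p : ℝ := (Fintype.card ι : ℝ) with hp
  have hp0 : 0 ≤ p := by positivity
  -- the tolerances: `l` balances the Cauchy-Schwarz inequality, `e'` bounds the oscillation and
  -- `e1` the squared distance of the simple process from the integrand
  obtain ⟨l, hl, -, hl1⟩ := exists_pos_le_mul_le (c := C * p * T) (a := κ / 9) (e := 1)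
    (by positivity) (by positivity) one_pos
  obtain ⟨e', he', he'1, he'2⟩ := exists_pos_le_mul_le (c := 2 * C ^ 2 * p * T)
    (a := min (κ / 9) (q * κ ^ 2 / 144)) (e := min e 1)
    (by positivity) (by positivity) (by positivity)
  obtain ⟨e1, he1, he1a, he1b⟩ := exists_pos_le_mul_le (c := C / l) (a := κ / 9)
    (e := q * κ ^ 2 / 1152) (by positivity) (by positivity) (by positivity)
  have hq8 : 0 < ENNReal.ofReal (q / 8) := by simpa using hq
  obtain ⟨n, hn1, hn2⟩ := ((hS1 (ENNReal.ofReal e1) (by simpa using he1)).eventually_le_const hq8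
    |>.and ((hS2 (κ / 3) (by positivity)).eventually_le_const hq8)).exists
  obtain ⟨n', hn3, hn4⟩ := (((tendsto_measure_oscillation (Q := Q)
    (fun t => (hM t).mono (ℱ.le t) le_rfl) (ae_of_all _ hMc) T he').eventually_le_const hq8).and
    ((tendsto_measure_oscillation (Q := Q) hβ.measurable hβ.continuous_paths T
      he).eventually_le_const hq8)).exists
  let δ : ℝ≥0 := min e.toNNReal (1 / ((n' : ℝ≥0) + 2))
  have hδ : 0 < δ := lt_min (Real.toNNReal_pos.2 he) (by positivity)
  obtain ⟨s, N, hs, h0, hN, hT, hmesh, hA⟩ := exists_grid (S n).times T hδ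
  have hmesh' : ∀ k, (s (k + 1) : ℝ) - s k ≤ δ := fun k => by
    have := NNReal.coe_le_coe.2 (hmesh k)
    push_cast at this
    linarith
  have hδe : (δ : ℝ) ≤ e := by
    have := NNReal.coe_le_coe.2 (min_le_left e.toNNReal (1 / ((n' : ℝ≥0) + 2)))
    rwa [Real.coe_toNNReal _ he.le] at this
  have hδn : (δ : ℝ) < 1 / ((n' : ℝ) + 1) := by
    have := NNReal.coe_le_coe.2 (min_le_right e.toNNReal (1 / ((n' : ℝ≥0) + 2)))
    push_cast at this
    exact this.trans_lt (one_div_lt_one_div_of_lt (by positivity) (by linarith))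
  have hdist : ∀ k, ∀ r ∈ Icc (s k) (s (k + 1)), dist r (s k) < 1 / ((n' : ℝ) + 1) := by
    intro k r hr
    refine lt_of_le_of_lt ?_ hδn
    rw [NNReal.dist_eq, abs_of_nonneg (sub_nonneg.2 (NNReal.coe_le_coe.2 hr.1))]
    have := NNReal.coe_le_coe.2 hr.2
    linarith [hmesh' k]
  let ζ : ℕ → Ω → ι → ℝ := fun k => (S n).value (s (k + 1))
  -- clamping enforces the growth bound `|ξ| ≤ C M` and costs only the oscillation of `M`
  let ξ : ℕ → Ω → ι → ℝ := fun k ω i => clamp (C * M (s k) ω) (ζ k ω i)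
  have hζm : ∀ k, Measurable[ℱ (s k)] (ζ k) := (S n).measurable_value hA
  have hξm : ∀ k, Measurable[ℱ (s k)] (ξ k) := fun k =>
    @measurable_pi_lambda _ _ _ (ℱ (s k)) _ _ fun i => measurable_clamp.comp
      (((hM (s k)).const_mul C).prodMk ((measurable_pi_apply i).comp (hζm k)))
  obtain ⟨Cζ, hCζ⟩ := (S n).exists_abs_value_le
  have hCM : ∀ k ω, 0 ≤ C * M (s k) ω := fun k ω => mul_nonneg hC (hM0 _ _)
  have hCξ : ∀ k ω i, |ξ k ω i| ≤ Cζ := fun k ω i =>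
    (abs_clamp_le_abs (hCM k ω) _).trans (hCζ _ _ _)
  refine ⟨s, N, ξ, hs, h0, hN, hT, fun k => (hmesh' k).trans hδe, hξm, ⟨Cζ, hCξ⟩,
    fun k ω i => abs_clamp_le (hCM k ω) _, ?_⟩
  -- the exceptional events
  set B1 : Set Ω := {ω | ENNReal.ofReal e1 ≤ ∫⁻ r in Iic T,
    ∑ i, ENNReal.ofReal (((S n).value r ω i - H r ω i) ^ 2) ∂leb}
  set B2 : Set Ω := {ω | ∃ t ≤ T, κ / 3 ≤ |(S n).integral β t ω - (M t ω - M 0 ω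
    - ∫ r in Iic t, ∑ i, H r ω i * η r ω i ∂leb)|}
  set B3 : Set Ω := {ω | ∃ r t, r ≤ T ∧ t ≤ T ∧ dist r t < 1 / ((n' : ℝ) + 1) ∧
      e' < dist (M r ω) (M t ω)}
  set B4 : Set Ω := {ω | ∃ r t, r ≤ T ∧ t ≤ T ∧ dist r t < 1 / ((n' : ℝ) + 1) ∧
      e < dist (β r ω) (β t ω)}
  set B5 : Set Ω := {ω | ∃ k ≤ N, κ / 3 ≤ |incSum β s (fun j ω i => ζ j ω i - ξ j ω i) k ω|}
  set Nul : Set Ω := {ω | ¬ (M 0 ω = 1 ∧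
    IntegrableOn (fun r => ∑ i, H r ω i * η r ω i) (Iic T) leb)}
  have hNul : Q Nul = 0 := by
    filter_upwards [hM1, hHη] with ω h1 h2 using ⟨h1, h2⟩
  have hoscM : ∀ ω, ω ∉ B3 → ∀ k, ∀ r ∈ Icc (s k) (s (k + 1)), dist (M r ω) (M (s k) ω) ≤ e' :=
    fun ω hω k r hr => not_lt.1 fun h =>
      hω ⟨r, s k, hr.2.trans (hT _), hT k, hdist k r hr, h⟩
  let F : Ω → ℝ≥0 → ℝ := fun ω r => ∑ i, ((S n).value r ω i - H r ω i) ^ 2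
  have hF0 : ∀ ω r, 0 ≤ F ω r := fun ω r => Finset.sum_nonneg fun i _ => sq_nonneg _
  have hHm : ∀ ω i, Measurable fun r => H r ω i := fun ω i =>
    measurable_path (u := fun r ω => H r ω i) (isStronglyProgressive_eval hIto.progressive i) ω
  have hFm : ∀ ω, Measurable (F ω) := fun ω => Finset.measurable_sum _ fun i _ =>
    (((S n).measurable_value_path ω i).sub (hHm ω i)).pow_const 2
  have hF : ∀ ω, ω ∉ B1 → IntegrableOn (F ω) (Iic T) leb ∧ ∫ r in Iic T, F ω r ∂leb ≤ e1 :=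
    fun ω hω => integrableOn_and_setIntegral_le (hFm ω) he1.le hω
  have hconst : ∀ c : ℝ, IntegrableOn (fun _ : ℝ≥0 => c) (Iic T) leb := fun c =>
    integrableOn_of_bounded measurable_const (C := |c|) (fun _ => le_rfl) T
  have hcomb : ∀ ω, IntegrableOn (F ω) (Iic T) leb → ∀ a c : ℝ,
      IntegrableOn (fun r => a * F ω r + c) (Iic T) leb :=
    fun ω h a c => (h.const_mul a).add (hconst c)
  have hintc : ∀ c : ℝ, ∫ _ in Iic T, c ∂leb = T * c := fun c => by
    rw [setIntegral_const, measureReal_def, leb_Iic, ENNReal.toReal_ofReal T.coe_nonneg, smul_eq_mul]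
  have hcell : ∀ ω, ω ∉ B3 → ∀ k, ∀ r ∈ Ioc (s k) (s (k + 1)),
      (∀ i, |ξ k ω i - H r ω i| ≤ |(S n).value r ω i - H r ω i| + C * e') ∧
      ∑ i, (ζ k ω i - ξ k ω i) ^ 2 ≤ 8 * F ω r + 2 * C ^ 2 * e' ^ 2 * p := by
    intro ω hω k r hr
    have h := clamped_estimates hC he'.le (x := ζ k ω) (y := H r ω) (hM0 (s k) ω)
      (hH r ω) (hoscM ω hω k r ⟨hr.1.le, hr.2⟩)
    have hv : (S n).value r ω = ζ k ω := (S n).value_eq_of_mem_cell hA hr ω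
    simpa only [F, hv] using h
  set V : ℝ := 8 * e1 + T * (2 * C ^ 2 * e' ^ 2 * p)
  have hV0 : 0 ≤ V := by positivity
  have hVq : V / (κ / 3) ^ 2 ≤ q / 8 := by
    rw [div_le_iff₀ (by positivity)]
    have h1 : T * (2 * C ^ 2 * e' ^ 2 * p) ≤ (2 * C ^ 2 * p * T) * e' := by
      have : e' ^ 2 ≤ e' := by
        have := he'1.trans (min_le_right _ _)
        nlinarith
      calc T * (2 * C ^ 2 * e' ^ 2 * p) = (2 * C ^ 2 * p * T) * e' ^ 2 := by ring
        _ ≤ _ := mul_le_mul_of_nonneg_left this (by positivity)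
    have h2 := he'2.trans (min_le_right _ _)
    simp only [V]
    nlinarith
  have hvar : {ω | V < incVar s (fun j ω i => ζ j ω i - ξ j ω i) N ω} ⊆ B1 ∪ B3 := by
    intro ω hω
    by_contra hcon
    rw [mem_union, not_or] at hcon
    obtain ⟨hFi, hFe⟩ := hF ω hcon.1
    have h1 := incVar_le_setIntegral hs hT (ζ := fun j ω i => ζ j ω i - ξ j ω i) (ω := ω)
      (f := fun r => 8 * F ω r + 2 * C ^ 2 * e' ^ 2 * p) (hcomb ω hFi _ _)
      (fun r => by have := hF0 ω r; positivity) (N := N)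
      (fun k _ r hr => (hcell ω hcon.2 k r hr).2) le_rfl
    rw [hN, integral_add (hFi.const_mul 8) (hconst _), integral_const_mul, hintc] at h1
    have : V < incVar s (fun j ω i => ζ j ω i - ξ j ω i) N ω := hω
    simp only [V] at this
    linarith
  -- clamping changes the stochastic integral little, by the maximal inequality
  have hB5 : Q B5 ≤ Q B1 + Q B3 + ENNReal.ofReal (q / 8) := by
    refine (measure_exists_le_abs_incSum hβ hs (ζ := fun j ω i => ζ j ω i - ξ j ω i)
      (C := Cζ + Cζ) (fun k => (hζm k).sub (hξm k)) (fun k ω i => ?_) N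
      (by positivity) hV0).trans ?_
    · exact (abs_sub _ _).trans (add_le_add (hCζ _ _ _) (hCξ _ _ _))
    · exact add_le_add ((measure_mono hvar).trans (measure_union_le _ _))
        (ENNReal.ofReal_le_ofReal hVq)
  have hsub : {ω | ¬ ((∀ k ≤ N, |1 + incSum (driftedPath η β) s ξ k ω - M (s k) ω| ≤ κ) ∧
        ∀ k, ∀ r ∈ Icc (s k) (s (k + 1)), dist (M r ω) (M (s k) ω) ≤ e ∧
          dist (β r ω) (β (s k) ω) ≤ e)} ⊆ B1 ∪ B2 ∪ B3 ∪ B4 ∪ B5 ∪ Nul := by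
    intro ω hω
    by_contra hcon
    simp only [mem_union, not_or] at hcon
    obtain ⟨⟨⟨⟨⟨hb1, hb2⟩, hb3⟩, hb4⟩, hb5⟩, hnul⟩ := hcon
    obtain ⟨hM1ω, hHηω⟩ := not_not.1 hnul
    refine hω ⟨fun k hk => ?_, fun k r hr => ⟨(hoscM ω hb3 k r hr).trans
      (he'1.trans (min_le_left _ _)), not_lt.1 fun h =>
        hb4 ⟨r, s k, hr.2.trans (hT _), hT k, hdist k r hr, h⟩⟩⟩
    obtain ⟨hFi, hFe⟩ := hF ω hb1
    have hη' : ∀ i, IntegrableOn (fun r => η r ω i) (Iic T) leb := fun i =>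
      integrableOn_of_bounded (measurable_path (u := fun r ω => η r ω i)
        (isStronglyProgressive_eval hη i) ω) (fun r => hηC r ω i) T
    have h5 : |incSum β s ζ k ω - incSum β s ξ k ω| < κ / 3 := by
      rw [← incSum_sub]
      exact not_le.1 fun h => hb5 ⟨k, hk, h⟩
    have h2 : |incSum β s ζ k ω - (M (s k) ω - M 0 ω
        - ∫ r in Iic (s k), ∑ i, H r ω i * η r ω i ∂leb)| < κ / 3 := by
      rw [← (S n).integral_eq_incSum hs h0 hA]
      exact not_le.1 fun h => hb2 ⟨s k, hT k, h⟩
    have h3 := abs_sum_sub_setIntegral_le hs h0 hT (ξ := fun j => ξ j ω) (H := fun r => H r ω)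
      (η := fun r => η r ω) (f := fun r => C / l * F ω r + (C * p * l + C ^ 2 * p * e'))
      hη' hHηω (hcomb ω hFi _ _) (N := N) (fun j _ r hr => by
        have hc := (hcell ω hb3 j r hr).1
        calc |∑ i, (ξ j ω i - H r ω i) * η r ω i|
            ≤ ∑ i, |(ξ j ω i - H r ω i) * η r ω i| := Finset.abs_sum_le_sum_abs _ _
          _ ≤ ∑ i, C * (l + ((S n).value r ω i - H r ω i) ^ 2 / l + C * e') := by
              refine Finset.sum_le_sum fun i _ => ?_
              rw [abs_mul, mul_comm]
              refine mul_le_mul (hηC r ω i) ((hc i).trans ?_) (abs_nonneg _) hC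
              linarith [abs_le_add_sq_div (y := (S n).value r ω i - H r ω i) hl]
          _ = C / l * F ω r + (C * p * l + C ^ 2 * p * e') := by
              rw [← Finset.mul_sum, Finset.sum_add_distrib, Finset.sum_add_distrib,
                ← Finset.sum_div]
              simp only [Finset.sum_const, Finset.card_univ, nsmul_eq_mul, F, p]
              field_simp
              ring) hk
    have h4 : ∫ r in Ioc 0 (s k), (C / l * F ω r + (C * p * l + C ^ 2 * p * e')) ∂leb
        ≤ κ / 3 := by
      have hi : IntegrableOn (fun r => C / l * F ω r + (C * p * l + C ^ 2 * p * e')) (Iic T) leb :=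
        hcomb ω hFi _ _
      refine (setIntegral_mono_set hi (ae_of_all _ fun r => ?_)
        (LE.le.eventuallyLE fun r hr => (mem_Ioc.1 hr).2.trans (hT k))).trans ?_
      · have := hF0 ω r
        simp only [Pi.zero_apply]
        positivity
      · rw [integral_add (hFi.const_mul _) (hconst _), integral_const_mul, hintc]
        have g1 : C / l * ∫ r in Iic T, F ω r ∂leb ≤ κ / 9 :=
          (mul_le_mul_of_nonneg_left hFe (by positivity)).trans he1b
        have g2 := he'2.trans (min_le_left _ _)
        have g3 : 0 ≤ C ^ 2 * p * T * e' := by positivity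
        nlinarith
    rw [incSum_driftedPath]
    have h6 := h3.trans h4
    rw [hM1ω] at h2
    rw [abs_lt] at h5 h2
    rw [abs_le] at h6 ⊢
    constructor <;> linarith [h5.1, h5.2, h2.1, h2.2, h6.1, h6.2]
  calc Q _ ≤ Q B1 + Q B2 + Q B3 + Q B4 + Q B5 + Q Nul := by
        refine (measure_mono hsub).trans ?_
        refine (measure_union_le _ _).trans (add_le_add ?_ le_rfl)
        refine (measure_union_le _ _).trans (add_le_add ?_ le_rfl)
        refine (measure_union_le _ _).trans (add_le_add ?_ le_rfl)
        refine (measure_union_le _ _).trans (add_le_add ?_ le_rfl)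
        exact measure_union_le _ _
    _ ≤ ENNReal.ofReal (q / 8) + ENNReal.ofReal (q / 8) + ENNReal.ofReal (q / 8)
        + ENNReal.ofReal (q / 8) + (ENNReal.ofReal (q / 8) + ENNReal.ofReal (q / 8)
          + ENNReal.ofReal (q / 8)) + 0 := by
        rw [hNul]
        gcongr
        exact hB5.trans (by gcongr)
    _ ≤ ENNReal.ofReal q := by
        have h8 : 0 ≤ q / 8 := by positivity
        rw [add_zero]
        repeat rw [← ENNReal.ofReal_add (by positivity) (by positivity)]
        exact ENNReal.ofReal_le_ofReal (by linarith)

end LowerTail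

/-! ### The lower tail of a stochastic exponential -/

section LowerTail

variable {Ω : Type*} {mΩ : MeasurableSpace Ω} {ι : Type*} [Fintype ι]
  {ℱ : Filtration ℝ≥0 mΩ} {Q : Measure Ω} {β : ℝ≥0 → Ω → ι → ℝ}

theorem measurable_driftedPath (hβ : IsBrownianMotion ℱ Q β) {η : ℝ≥0 → Ω → ι → ℝ}
    (hη : IsStronglyProgressive ℱ η) (t : ℝ≥0) : Measurable[ℱ t] (driftedPath η β t) :=
  @measurable_pi_lambda _ _ _ (ℱ t) _ _ fun i =>
    (measurable_setIntegral_Iic (isStronglyProgressive_eval hη i) t).add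
      ((measurable_pi_apply i).comp (hβ.adapted t))

theorem abs_setIntegral_Iic_sub_le {s : ℕ → ℝ≥0} (hs : Monotone s) {T : ℝ≥0} (hT : ∀ k, s k ≤ T)
    {f : ℝ≥0 → ℝ} (hf : Measurable f) {C : ℝ} (hC : ∀ r, |f r| ≤ C) (k : ℕ) :
    |∫ r in Iic (s (k + 1)), f r ∂leb - ∫ r in Iic (s k), f r ∂leb|
      ≤ C * ((s (k + 1) : ℝ) - s k) := by
  rw [setIntegral_Iic_succ hs hT (integrableOn_of_bounded hf hC T), add_sub_cancel_left,
    ← Real.norm_eq_abs]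
  refine (norm_setIntegral_le_of_norm_le_const ?_ fun r _ => hC r).trans_eq ?_
  · rw [leb_Ioc]
    exact ENNReal.ofReal_lt_top
  · rw [measureReal_def, leb_Ioc, ENNReal.toReal_ofReal (sub_nonneg_of_monotone hs k)]

variable [IsProbabilityMeasure Q]

/-- Markov's inequality for the sum of the squared increments of an elementary integral. -/
theorem measure_le_sum_sq_increment (hβ : IsBrownianMotion ℱ Q β) {s : ℕ → ℝ≥0} (hs : Monotone s)
    {ζ : ℕ → Ω → ι → ℝ} (hζ : ∀ k, Measurable[ℱ (s k)] (ζ k)) {C : ℝ}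
    (hC : ∀ k ω i, |ζ k ω i| ≤ C) (N : ℕ) {R : ℝ} (hR : 0 < R) :
    Q {ω | R ≤ ∑ j ∈ Finset.range N,
        (∑ i, ζ j ω i * (β (s (j + 1)) ω i - β (s j) ω i)) ^ 2}
      ≤ ENNReal.ofReal (Fintype.card ι * C ^ 2 * ((s N : ℝ) - s 0) / R) := by
  have hm := measurable_sum_mul_increment (Q := Q) hβ hζ
  have h1 := mul_meas_ge_le_lintegral₀ (μ := Q) (f := fun ω => ∑ j ∈ Finset.range N,
      ENNReal.ofReal ((∑ i, ζ j ω i * (β (s (j + 1)) ω i - β (s j) ω i)) ^ 2))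
    (Finset.measurable_sum _ fun j _ => ((hm j).pow_const 2).ennreal_ofReal).aemeasurable
    (ENNReal.ofReal R)
  have h2 : ∫⁻ ω, ∑ j ∈ Finset.range N,
      ENNReal.ofReal ((∑ i, ζ j ω i * (β (s (j + 1)) ω i - β (s j) ω i)) ^ 2) ∂Q
      ≤ ENNReal.ofReal (Fintype.card ι * C ^ 2 * ((s N : ℝ) - s 0)) := by
    rw [lintegral_finsetSum _ fun j _ => ((hm j).pow_const 2).ennreal_ofReal]
    simp_rw [fun j => hβ.lintegral_mul_sq (hs j.le_succ) (hζ j)]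
    rw [← lintegral_finsetSum]
    · refine (lintegral_mono (g := fun _ => ENNReal.ofReal
        (Fintype.card ι * C ^ 2 * ((s N : ℝ) - s 0))) fun ω => ?_).trans (by simp)
      rw [← ENNReal.ofReal_sum_of_nonneg fun j _ => sum_sq_mul_nonneg hs j ω]
      exact ENNReal.ofReal_le_ofReal (incVar_le hs (fun k i => hC k ω i) N)
    · intro j _
      refine ENNReal.measurable_ofReal.comp (Measurable.mul_const
        (Finset.measurable_sum _ fun i _ => Measurable.pow_const ?_ _) _)
      exact (measurable_pi_apply i).comp ((hζ j).mono (ℱ.le _) le_rfl)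
  rw [ENNReal.ofReal_div_of_pos hR, ENNReal.le_div_iff_mul_le (by simp [hR]) (by simp), mul_comm]
  refine le_trans (mul_le_mul_right (measure_mono fun ω hω => ?_) _) (h1.trans h2)
  change ENNReal.ofReal R ≤ _
  rw [← ENNReal.ofReal_sum_of_nonneg fun j _ => sq_nonneg _]
  exact ENNReal.ofReal_le_ofReal hω

/-- Let `M ≥ 0`, `M_0 = 1`, solve `dM = ⟨H, dY⟩` with `dY = η dt + dβ`, `|η| ≤ C` and `|H| ≤ C M`.
Then the probability that `M` drops below `exp(-K)/4` on `[0, T]` tends to zero as `K → ∞`, at a rate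
that depends only on `C`, `T` and the dimension. The Euler scheme of `M` is a product of factors
`1 + ⟨θ_k, ΔY_k⟩` with `|θ_k| ≤ 2C`, whose logarithms are controlled by a maximal inequality for
`∑ ⟨θ_k, Δβ_k⟩` and by Markov's inequality for `∑ ⟨θ_k, Δβ_k⟩²`. -/
theorem measure_exists_lt_exp_neg (hβ : IsBrownianMotion ℱ Q β) {T : ℝ≥0} {C : ℝ} (hC : 0 ≤ C)
    {η H : ℝ≥0 → Ω → ι → ℝ} {M : ℝ≥0 → Ω → ℝ} (hη : IsStronglyProgressive ℱ η)
    (hηC : ∀ r ω i, |η r ω i| ≤ C) (hM : ∀ t, Measurable[ℱ t] (M t))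
    (hMc : ∀ ω, Continuous fun t => M t ω) (hM0 : ∀ t ω, 0 ≤ M t ω) (hM1 : ∀ᵐ ω ∂Q, M 0 ω = 1)
    (hH : ∀ r ω i, |H r ω i| ≤ C * M r ω)
    (hI : IsIntegralAgainst ℱ Q T η β H fun t ω => M t ω - M 0 ω) {R : ℝ} (hR : 0 < R) :
    Q {ω | ∃ t ≤ T, M t ω < Real.exp (-(10 * Fintype.card ι * C ^ 2 * T + 5 * R)) / 4}
      ≤ ENNReal.ofReal (4 * Fintype.card ι * C ^ 2 * T / R ^ 2)
        + ENNReal.ofReal (4 * Fintype.card ι * C ^ 2 * T / R) := by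
  classical
  set p : ℝ := (Fintype.card ι : ℝ) with hp
  have hp0 : 0 ≤ p := by positivity
  set K : ℝ := 10 * p * C ^ 2 * T + 5 * R with hK
  refine ENNReal.le_of_forall_pos_le_add fun q hq _ => ?_
  set κ : ℝ := Real.exp (-K) / 2 with hκdef
  have hκ : 0 < κ := by positivity
  obtain ⟨e, he, heκ, hec⟩ := exists_pos_le_mul_le (c := 2 * C ^ 2 * p + 2 * C * p) (a := 1 / 4)
    (e := κ / 2) (by positivity) (by norm_num) (by positivity)
  obtain ⟨s, N, ξ, hs, h0, hN, hT, hmesh, hξm, ⟨C', hC'⟩, hξM, hbad⟩ :=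
    exists_euler_approximation hβ hC hη hηC hM hMc hM0 hM1 hH hI hκ he (q := q) hq
  set Y := driftedPath η β with hY
  -- the Euler scheme of `M`
  let m : ℕ → Ω → ℝ := fun k ω => 1 + incSum Y s ξ k ω
  have hmm : ∀ k, Measurable[ℱ (s k)] (m k) := fun k => by
    refine Measurable.add measurable_const (Finset.measurable_sum _ fun j hj =>
      Finset.measurable_sum _ fun i _ => ?_)
    have hj := Finset.mem_range.1 hj
    refine Measurable.mul ?_ (Measurable.sub ?_ ?_)
    · exact (measurable_pi_apply i).comp ((hξm j).mono (ℱ.mono (hs hj.le)) le_rfl)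
    · exact (measurable_pi_apply i).comp
        ((measurable_driftedPath hβ hη _).mono (ℱ.mono (hs hj)) le_rfl)
    · exact (measurable_pi_apply i).comp
        ((measurable_driftedPath hβ hη _).mono (ℱ.mono (hs hj.le)) le_rfl)
  -- the logarithmic coefficient `ξ / m` is used only on `A k`, where `M ≤ 2 m` makes it at most `2C`
  let A : ℕ → Set Ω := fun k => {ω | κ ≤ m k ω ∧ |m k ω - M (s k) ω| ≤ κ}
  have hA : ∀ k, MeasurableSet[ℱ (s k)] (A k) := fun k => by
    have h1 : Measurable[ℱ (s k)] fun ω => |m k ω - M (s k) ω| :=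
      measurable_norm.comp ((hmm k).sub (hM (s k)))
    exact MeasurableSet.inter (hmm k measurableSet_Ici) (h1 measurableSet_Iic)
  let θ : ℕ → Ω → ι → ℝ := fun k => (A k).indicator fun ω i => ξ k ω i / m k ω
  have hθ1 : ∀ {k ω}, ω ∈ A k → θ k ω = fun i => ξ k ω i / m k ω := fun h =>
    indicator_of_mem h _
  have hθ0 : ∀ {k ω}, ω ∉ A k → θ k ω = 0 := fun h => indicator_of_notMem h _
  have hθm : ∀ k, Measurable[ℱ (s k)] (θ k) := fun k => by
    refine Measurable.indicator (@measurable_pi_lambda _ _ _ (ℱ (s k)) _ _ fun i => ?_) (hA k)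
    exact ((measurable_pi_apply i).comp (hξm k)).div (hmm k)
  have hθC : ∀ k ω i, |θ k ω i| ≤ 2 * C := fun k ω i => by
    by_cases h : ω ∈ A k
    · have hpos : 0 < m k ω := hκ.trans_le h.1
      rw [hθ1 h, abs_div, abs_of_pos hpos, div_le_iff₀ hpos]
      refine (hξM k ω i).trans ?_
      have h1 : M (s k) ω ≤ 2 * m k ω := by linarith [(abs_le.1 h.2).1, h.1]
      nlinarith
    · rw [hθ0 h]
      simpa using hC
  let b : ℕ → Ω → ℝ := fun j ω => ∑ i, θ j ω i * (β (s (j + 1)) ω i - β (s j) ω i)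
  have hsN : (s N : ℝ) - s 0 = T := by rw [hN, h0]; simp
  have hvarθ : ∀ k ω, incVar s θ k ω ≤ 4 * p * C ^ 2 * ((s k : ℝ) - s 0) := fun k ω =>
    (incVar_le hs (fun k i => hθC k ω i) k).trans_eq (by rw [← hp]; ring)
  -- the two exceptional events of the exponential
  have hB1 : Q {ω | ∃ k ≤ N, R ≤ |incSum β s θ k ω|}
      ≤ ENNReal.ofReal (4 * p * C ^ 2 * T / R ^ 2) := by
    refine (measure_exists_le_abs_incSum hβ hs hθm hθC N hR
      (η := 4 * p * C ^ 2 * T) (by positivity)).trans_eq ?_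
    have : {ω | 4 * p * C ^ 2 * T < incVar s θ N ω} = ∅ :=
      eq_empty_of_forall_notMem fun ω hω => absurd (hvarθ N ω) (not_le.2 (by rw [hsN]; exact hω))
    rw [this, measure_empty, zero_add]
  have hB2 : Q {ω | R ≤ ∑ j ∈ Finset.range N, b j ω ^ 2}
      ≤ ENNReal.ofReal (4 * p * C ^ 2 * T / R) := by
    refine (measure_le_sum_sq_increment hβ hs hθm hθC N hR).trans_eq ?_
    rw [hsN, ← hp]
    ring_nf
  have hsub : {ω | ∃ t ≤ T, M t ω < Real.exp (-K) / 4}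
      ⊆ {ω | ∃ k ≤ N, R ≤ |incSum β s θ k ω|} ∪ {ω | R ≤ ∑ j ∈ Finset.range N, b j ω ^ 2} ∪
        {ω | ¬ ((∀ k ≤ N, |1 + incSum Y s ξ k ω - M (s k) ω| ≤ κ) ∧
          ∀ k, ∀ r ∈ Icc (s k) (s (k + 1)), dist (M r ω) (M (s k) ω) ≤ e ∧
            dist (β r ω) (β (s k) ω) ≤ e)} := by
    rintro ω ⟨t, ht, hMt⟩
    by_contra hcon
    simp only [mem_union, not_or] at hcon
    obtain ⟨⟨hb1, hb2⟩, hb3⟩ := hcon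
    obtain ⟨hm, hosc⟩ := not_not.1 hb3
    have hb1 : ∀ k ≤ N, |incSum β s θ k ω| < R := fun k hk => not_le.1 fun h => hb1 ⟨k, hk, h⟩
    have hb2 : ∑ j ∈ Finset.range N, b j ω ^ 2 < R := not_le.1 hb2
    -- the relative increments `x` split into the drift part `a` and the martingale part `b`
    let a : ℕ → ℝ := fun j => ∑ i, θ j ω i *
      (∫ r in Iic (s (j + 1)), η r ω i ∂leb - ∫ r in Iic (s j), η r ω i ∂leb)
    let x : ℕ → ℝ := fun j => ∑ i, θ j ω i * (Y (s (j + 1)) ω i - Y (s j) ω i)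
    have hx : ∀ j, x j = a j + b j ω := fun j => by
      simp only [x, a, b, hY, driftedPath, ← Finset.sum_add_distrib]
      exact Finset.sum_congr rfl fun i _ => by ring
    have ha : ∀ j, |a j| ≤ 2 * C ^ 2 * p * ((s (j + 1) : ℝ) - s j) := fun j => by
      refine (Finset.abs_sum_le_sum_abs _ _).trans
        ((Finset.sum_le_card_nsmul _ _ (2 * C * (C * ((s (j + 1) : ℝ) - s j)))
          fun i _ => ?_).trans_eq ?_)
      · rw [abs_mul]
        exact mul_le_mul (hθC j ω i) (abs_setIntegral_Iic_sub_le hs hT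
          (measurable_path (u := fun r ω => η r ω i) (isStronglyProgressive_eval hη i) ω)
          (fun r => hηC r ω i) j) (abs_nonneg _) (by positivity)
      · rw [nsmul_eq_mul, Finset.card_univ, ← hp]
        ring
    have ha4 : ∀ j, |a j| ≤ 1 / 4 := fun j => by
      refine (ha j).trans ?_
      have h1 : 2 * C ^ 2 * p * ((s (j + 1) : ℝ) - s j) ≤ 2 * C ^ 2 * p * e :=
        mul_le_mul_of_nonneg_left (hmesh j) (by positivity)
      have h2 : 0 ≤ 2 * C * p * e := by positivity
      linarith
    have hb4 : ∀ j, |b j ω| ≤ 1 / 4 := fun j => by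
      have h0 : |b j ω| ≤ 2 * C * p * e := by
        refine (Finset.abs_sum_le_sum_abs _ _).trans
          ((Finset.sum_le_card_nsmul _ _ (2 * C * e) fun i _ => ?_).trans_eq ?_)
        · rw [abs_mul]
          refine mul_le_mul (hθC j ω i) ?_ (abs_nonneg _) (by positivity)
          rw [← Real.dist_eq]
          exact (dist_le_pi_dist _ _ i).trans (hosc j (s (j + 1)) ⟨hs j.le_succ, le_rfl⟩).2
        · rw [nsmul_eq_mul, Finset.card_univ, ← hp]
          ring
      have h2 : 0 ≤ 2 * C ^ 2 * p * e := by positivity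
      linarith
    have hsuma : ∀ k, ∑ j ∈ Finset.range k, |a j| ≤ 2 * C ^ 2 * p * T := fun k => by
      have h1 : ∑ j ∈ Finset.range k, ((s (j + 1) : ℝ) - s j) ≤ T := by
        rw [Finset.sum_range_sub (fun j => (s j : ℝ)), h0]
        simpa using NNReal.coe_le_coe.2 (hT k)
      refine (Finset.sum_le_sum fun j _ => ha j).trans ?_
      rw [← Finset.mul_sum]
      exact mul_le_mul_of_nonneg_left h1 (by positivity)
    -- `m_{k+1} = m_k (1 + x_k)` with `x_k` small and `∑ (x_k - 2 x_k²) ≥ -K`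
    have hlow := exp_neg_le_of_recursion (N := N) (m := fun k => m k ω) (x := x) (κ := κ) (K := K)
      (by simp [m, incSum])
      (fun k hk hκk => by
        have hmem : ω ∈ A k := ⟨hκk, hm k hk.le⟩
        have hne : m k ω ≠ 0 := (hκ.trans_le hκk).ne'
        simp only [m, x, incSum_succ, hθ1 hmem] at hne ⊢
        rw [mul_add, mul_one, Finset.mul_sum, ← add_assoc]
        congr 1
        exact Finset.sum_congr rfl fun i _ => by field_simp)
      (fun k _ => by
        rw [hx]
        exact (abs_add_le _ _).trans (by linarith [ha4 k, hb4 k]))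
      (fun k hk => by
        have h1 : ∀ j, a j - 4 * |a j| + b j ω - 4 * b j ω ^ 2 ≤ x j - 2 * x j ^ 2 := fun j => by
          rw [hx]
          have h2 : a j ^ 2 ≤ |a j| := by
            rw [← sq_abs]
            nlinarith [abs_nonneg (a j), ha4 j]
          nlinarith [sq_nonneg (a j - b j ω)]
        refine le_trans ?_ (Finset.sum_le_sum fun j _ => h1 j)
        have h3 : ∑ j ∈ Finset.range k, b j ω = incSum β s θ k ω := rfl
        have h4 : ∑ j ∈ Finset.range k, b j ω ^ 2 ≤ ∑ j ∈ Finset.range N, b j ω ^ 2 :=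
          Finset.sum_le_sum_of_subset_of_nonneg (Finset.range_mono hk) fun j _ _ => sq_nonneg _
        have h5 : -∑ j ∈ Finset.range k, |a j| ≤ ∑ j ∈ Finset.range k, a j := by
          rw [← Finset.sum_neg_distrib]
          exact Finset.sum_le_sum fun j _ => neg_abs_le _
        rw [Finset.sum_sub_distrib, Finset.sum_add_distrib, Finset.sum_sub_distrib,
          ← Finset.mul_sum, ← Finset.mul_sum, h3]
        linarith [hsuma k, (abs_lt.1 (hb1 k hk)).1])
      (by rw [hκdef]; linarith [Real.exp_pos (-K)])
    -- `m ≥ 2κ` on the grid, `|m - M| ≤ κ` there, and `M` oscillates by at most `κ / 2` on the cells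
    have hMk : ∀ k ≤ N, κ ≤ M (s k) ω := fun k hk => by
      have h1 := hlow k hk
      have h2 := (abs_le.1 (hm k hk)).2
      simp only [m] at h1
      linarith
    have hκ4 : Real.exp (-K) / 4 = κ / 2 := by rw [hκdef]; ring
    rw [hκ4] at hMt
    rcases eq_zero_or_pos t with rfl | ht0
    · have := hMk 0 (Nat.zero_le _)
      rw [h0] at this
      linarith
    · obtain ⟨k, hk, hkt⟩ := exists_mem_cell h0 ht0 (ht.trans_eq hN.symm)
      have h1 := (hosc k t ⟨hkt.1.le, hkt.2⟩).1
      rw [Real.dist_eq] at h1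
      linarith [hMk k hk.le, (abs_le.1 h1).1]
  refine (measure_mono hsub).trans ((measure_union_le _ _).trans (add_le_add
    ((measure_union_le _ _).trans (add_le_add hB1 hB2)) (hbad.trans_eq ?_)))
  exact ENNReal.ofReal_coe_nnreal

end LowerTail

/-! ### Paths of measures: weak topology and measurability -/

section Inducing

/-- If the topology of `Y` is induced by the real functions `g i`, then, on a compact space, a
filter of paths in `Y` converges as soon as its images under all the `g i` converge. -/
theorem tendsto_continuousMap_iff_of_isInducing {K Y ι α : Type*} [TopologicalSpace K]
    [CompactSpace K] [TopologicalSpace Y] {g : ι → C(Y, ℝ)} (hg : IsInducing fun y i => g i y)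
    {l : Filter α} {F : α → C(K, Y)} {f : C(K, Y)} :
    Tendsto F l (𝓝 f) ↔ ∀ i, Tendsto (fun a => (g i).comp (F a)) l (𝓝 ((g i).comp f)) := by
  have h1 := ContinuousMap.isInducing_postcomp (X := K)
    (⟨fun y i => g i y, continuous_pi fun i => (g i).continuous⟩ : C(Y, ι → ℝ)) hg
  rw [h1.tendsto_nhds_iff, ContinuousMap.tendsto_iff_tendstoUniformly, tendstoUniformly_iff_tendsto,
    Pi.uniformity, tendsto_iInf]
  refine forall_congr' fun i => ?_
  rw [tendsto_comap_iff, ContinuousMap.tendsto_iff_tendstoUniformly, tendstoUniformly_iff_tendsto]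
  rfl

/-- The paths in a space whose topology is induced by real functions have the topology induced by the
real paths obtained from these functions. -/
theorem isInducing_postcomp_pi {K Y ι : Type*} [TopologicalSpace K]
    [CompactSpace K] [TopologicalSpace Y] {g : ι → C(Y, ℝ)} (hg : IsInducing fun y i => g i y) :
    IsInducing fun (F : C(K, Y)) i => (g i).comp F := by
  refine isInducing_iff_nhds.2 fun F => le_antisymm ?_ ?_
  · refine (Continuous.tendsto ?_ F).le_comap
    exact continuous_pi fun i => ContinuousMap.continuous_postcomp (g i)
  · have h := (tendsto_continuousMap_iff_of_isInducing (K := K) hg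
      (l := comap (fun (F : C(K, Y)) i => (g i).comp F) (𝓝 fun i => (g i).comp F))
      (F := fun G => G) (f := F)).2 fun i =>
        ((continuous_apply i).tendsto fun i => (g i).comp F).comp tendsto_comap
    exact h

end Inducing

section FiniteMeasure

variable {𝕏 : Type*} [TopologicalSpace 𝕏] [MeasurableSpace 𝕏] [OpensMeasurableSpace 𝕏]

/-- Integration of a bounded continuous function, as a continuous function on the space of finite
measures. -/
def integralMap (φ : 𝕏 →ᵇ ℝ) : C(FiniteMeasure 𝕏, ℝ) where
  toFun μ := ∫ x, φ x ∂(μ : Measure 𝕏)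
  continuous_toFun := FiniteMeasure.continuous_integral_boundedContinuousFunction φ

/-- A nonnegative bounded continuous function, as a real-valued one. -/
def toRealBCF (φ : 𝕏 →ᵇ ℝ≥0) : 𝕏 →ᵇ ℝ :=
  φ.comp (fun x : ℝ≥0 => (x : ℝ)) (isometry_subtype_coe (s := {r : ℝ | 0 ≤ r})).lipschitz

theorem integral_normalize [Nonempty 𝕏] {ν : FiniteMeasure 𝕏} (hν : ν ≠ 0) (φ : 𝕏 → ℝ) :
    ∫ x, φ x ∂(ν.normalize : Measure 𝕏)
      = (∫ x, φ x ∂(ν : Measure 𝕏)) / ∫ _, (1 : ℝ) ∂(ν : Measure 𝕏) := by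
  rw [ν.toMeasure_normalize_eq_of_nonzero hν, integral_smul_nnreal_measure, NNReal.smul_def,
    smul_eq_mul, NNReal.coe_inv, integral_const, smul_eq_mul, mul_one, div_eq_inv_mul]
  rfl

variable [SecondCountableTopology 𝕏] [HasOuterApproxClosed 𝕏]

variable (𝕏) in
/-- The constant `1` and the functions that approximate from above the complements of the finite
unions of sets of a countable basis: countably many functions that determine weak convergence. -/
def convergenceDetermining : Set (𝕏 →ᵇ ℝ) :=
  insert 1 (⋃ t : Finset (TopologicalSpace.countableBasis 𝕏), range fun n =>
    toRealBCF ((isOpen_biUnion (s := (t : Set (TopologicalSpace.countableBasis 𝕏)))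
      (f := fun B => (B : Set 𝕏)) fun B _ =>
        TopologicalSpace.isOpen_of_mem_countableBasis B.2).isClosed_compl.apprSeq n))

theorem countable_convergenceDetermining : (convergenceDetermining 𝕏).Countable :=
  (countable_iUnion fun _ => countable_range _).insert _

/-- Inner approximation of an open set by a finite union of sets of the countable basis. -/
theorem exists_lt_biUnion_of_isOpen (P : ProbabilityMeasure 𝕏) {G : Set 𝕏} (hG : IsOpen G)
    {r : ℝ≥0} (hr : r < P G) :
    ∃ t : Finset (TopologicalSpace.countableBasis 𝕏),
      r < P (⋃ B ∈ (t : Set (TopologicalSpace.countableBasis 𝕏)), (B : Set 𝕏)) ∧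
      (⋃ B ∈ (t : Set (TopologicalSpace.countableBasis 𝕏)), (B : Set 𝕏)) ⊆ G := by
  classical
  obtain ⟨T, hT, hrT, hTG⟩ := P.exists_lt_measure_biUnion_of_isOpen
    (S := TopologicalSpace.countableBasis 𝕏)
    (fun u hu x hx => by
      obtain ⟨v, hv, hxv, hvu⟩ :=
        (TopologicalSpace.isBasis_countableBasis 𝕏).exists_subset_of_mem_open hx hu
      exact ⟨v, hv, (TopologicalSpace.isOpen_of_mem_countableBasis hv).mem_nhds hxv, hvu⟩) hG hr
  have : (⋃ B ∈ ((T.subtype fun B => B ∈ TopologicalSpace.countableBasis 𝕏 :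
      Finset (TopologicalSpace.countableBasis 𝕏)) : Set (TopologicalSpace.countableBasis 𝕏)),
      (B : Set 𝕏)) = ⋃ B ∈ T, B := by
    ext x
    simp only [Finset.mem_coe, Finset.mem_subtype, mem_iUnion, exists_prop]
    exact ⟨fun ⟨B, hB, hx⟩ => ⟨B, hB, hx⟩, fun ⟨B, hB, hx⟩ => ⟨⟨B, hT B hB⟩, hB, hx⟩⟩
  exact ⟨_, by rwa [this], by rwa [this]⟩

/-- By the portmanteau theorem, convergence of the integrals over the countable family gives weak
convergence: an open set is approximated from inside by a finite union `B` of basis sets, and the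
indicator of `Bᶜ` from above by functions of the family. -/
theorem tendsto_probabilityMeasure_of_convergenceDetermining {P : ProbabilityMeasure 𝕏}
    {Pn : ℕ → ProbabilityMeasure 𝕏}
    (h : ∀ φ ∈ convergenceDetermining 𝕏, Tendsto (fun n => ∫ x, φ x ∂(Pn n : Measure 𝕏)) atTop
      (𝓝 (∫ x, φ x ∂(P : Measure 𝕏)))) : Tendsto Pn atTop (𝓝 P) := by
  refine tendsto_of_forall_isOpen_le_liminf' fun G hG => le_of_forall_lt fun r hr => ?_
  lift r to ℝ≥0 using (hr.trans (measure_lt_top _ _)).ne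
  obtain ⟨r', hrr', hr'⟩ := ENNReal.lt_iff_exists_nnreal_btwn.1 hr
  rw [← ProbabilityMeasure.ennreal_coeFn_eq_coeFn_toMeasure, ENNReal.coe_lt_coe] at hr'
  obtain ⟨t, hrt, htG⟩ := exists_lt_biUnion_of_isOpen P hG hr'
  set B := ⋃ B ∈ (t : Set (TopologicalSpace.countableBasis 𝕏)), (B : Set 𝕏) with hBdef
  have hB : IsOpen B := isOpen_biUnion fun B _ =>
    TopologicalSpace.isOpen_of_mem_countableBasis B.2
  have hB' := hB.isClosed_compl
  have hint : ∀ (P' : ProbabilityMeasure 𝕏) n, ∫ x, toRealBCF (hB'.apprSeq n) x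
      ∂(P' : Measure 𝕏) = (∫⁻ x, hB'.apprSeq n x ∂(P' : Measure 𝕏)).toReal :=
    fun P' n => (BoundedContinuousFunction.toReal_lintegral_coe_eq_integral _ _).symm
  have hlt : ∀ (P' : ProbabilityMeasure 𝕏) n, ∫⁻ x, hB'.apprSeq n x ∂(P' : Measure 𝕏) ≠ ∞ :=
    fun P' n => (BoundedContinuousFunction.lintegral_lt_top_of_nnreal _ _).ne
  have hle : ∀ (P' : ProbabilityMeasure 𝕏) n,
      1 - ∫ x, toRealBCF (hB'.apprSeq n) x ∂(P' : Measure 𝕏) ≤ (P' : Measure 𝕏).real B :=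
    fun P' n => by
      have h1 : (P' : Measure 𝕏).real Bᶜ ≤ _ := ENNReal.toReal_mono (hlt P' n)
        (HasOuterApproxClosed.measure_le_lintegral hB' (P' : Measure 𝕏) n)
      rw [hint]
      rw [probReal_compl_eq_one_sub hB.measurableSet] at h1
      linarith
  have h1 : Tendsto (fun n => 1 - ∫ x, toRealBCF (hB'.apprSeq n) x ∂(P : Measure 𝕏)) atTop
      (𝓝 ((P : Measure 𝕏).real B)) := by
    have h2 : (P : Measure 𝕏).real B = 1 - ((P : Measure 𝕏) Bᶜ).toReal := by
      have := probReal_compl_eq_one_sub (μ := (P : Measure 𝕏)) hB.measurableSet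
      rw [Measure.real] at this
      rw [this]
      ring
    simp only [hint, h2]
    exact tendsto_const_nhds.sub ((ENNReal.tendsto_toReal (measure_ne_top _ _)).comp
      (HasOuterApproxClosed.tendsto_lintegral_apprSeq hB' (P : Measure 𝕏)))
  have hrB : (r' : ℝ) < (P : Measure 𝕏).real B := by exact_mod_cast hrt
  obtain ⟨N, hN⟩ := (h1.eventually_const_lt hrB).exists
  have h3 := (tendsto_const_nhds (x := (1 : ℝ))).sub (h _ (Or.inr (mem_iUnion.2 ⟨t, N, rfl⟩)))
  have h4 : ∀ᶠ k in atTop, (r' : ℝ≥0∞) ≤ (Pn k : Measure 𝕏) G := by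
    filter_upwards [h3.eventually_const_lt hN] with k hk
    refine le_trans ?_ (measure_mono htG)
    rw [← ENNReal.ofReal_coe_nnreal, ENNReal.ofReal_le_iff_le_toReal (measure_ne_top _ _)]
    exact hk.le.trans (hle (Pn k) N)
  exact hrr'.trans_le (le_liminf_of_le (by isBoundedDefault) h4)

/-- As the family contains the constant `1`, the masses converge as well, and the statement for
probability measures applies to the normalized measures. -/
theorem tendsto_finiteMeasure_of_convergenceDetermining {μ : FiniteMeasure 𝕏}
    {ν : ℕ → FiniteMeasure 𝕏}
    (h : ∀ φ ∈ convergenceDetermining 𝕏, Tendsto (fun n => ∫ x, φ x ∂(ν n : Measure 𝕏)) atTop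
      (𝓝 (∫ x, φ x ∂(μ : Measure 𝕏)))) : Tendsto ν atTop (𝓝 μ) := by
  have hone : ∀ ν : FiniteMeasure 𝕏, ∫ x, (1 : 𝕏 →ᵇ ℝ) x ∂(ν : Measure 𝕏) = ν.mass := fun ν => by
    simp only [BoundedContinuousFunction.coe_one, Pi.one_apply, integral_const, smul_eq_mul,
      mul_one]
    rfl
  have hmass : Tendsto (fun n => (ν n).mass) atTop (𝓝 μ.mass) := by
    have := h 1 (Or.inl rfl)
    simp only [hone] at this
    exact_mod_cast this
  by_cases hμ : μ = 0
  · rw [hμ] at hmass ⊢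
    exact FiniteMeasure.tendsto_zero_of_tendsto_zero_mass hmass
  · have : Nonempty 𝕏 := by
      by_contra hne
      rw [not_nonempty_iff] at hne
      exact hμ (Subtype.ext (Subsingleton.elim _ _))
    have hμ' : μ.mass ≠ 0 := μ.mass_nonzero_iff.2 hμ
    refine FiniteMeasure.tendsto_of_tendsto_normalize_testAgainstNN_of_tendsto_mass
      (tendsto_probabilityMeasure_of_convergenceDetermining fun φ hφ => ?_) hmass
    have hev : ∀ᶠ n in atTop, ν n ≠ 0 := (hmass.eventually_ne hμ').mono fun n hn =>
      (ν n).mass_nonzero_iff.1 hn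
    rw [integral_normalize hμ]
    refine ((h φ hφ).div (h 1 (Or.inl rfl)) ?_).congr' (hev.mono fun n hn =>
      (integral_normalize hn φ).symm)
    rw [hone]
    exact_mod_cast hμ'

/-- The weak topology on the finite measures is induced by countably many integrals. -/
theorem isInducing_convergenceDetermining :
    IsInducing fun (μ : FiniteMeasure 𝕏) (φ : convergenceDetermining 𝕏) =>
      integralMap (φ : 𝕏 →ᵇ ℝ) μ := by
  have : Countable (convergenceDetermining 𝕏) := countable_convergenceDetermining.to_subtype
  refine isInducing_iff_nhds.2 fun μ => le_antisymm ?_ ?_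
  · refine (Continuous.tendsto ?_ μ).le_comap
    exact continuous_pi fun φ => (integralMap (φ : 𝕏 →ᵇ ℝ)).continuous
  · suffices h : Tendsto (fun ν : FiniteMeasure 𝕏 => ν)
        (comap (fun (μ : FiniteMeasure 𝕏) (φ : convergenceDetermining 𝕏) =>
          integralMap (φ : 𝕏 →ᵇ ℝ) μ) (𝓝 fun φ => integralMap (φ : 𝕏 →ᵇ ℝ) μ)) (𝓝 μ) from h
    refine tendsto_of_seq_tendsto fun ν hν => ?_
    refine tendsto_finiteMeasure_of_convergenceDetermining fun φ hφ => ?_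
    exact ((continuous_apply (⟨φ, hφ⟩ : convergenceDetermining 𝕏)).tendsto _).comp
      (tendsto_comap.comp hν)

end FiniteMeasure

section Measurability

variable {Ω K : Type*} {mΩ : MeasurableSpace Ω} {Q : Measure Ω} [TopologicalSpace K]
  [CompactSpace K]

/-- A random path is almost everywhere measurable if its values are: preimages of closed balls are
countable intersections of conditions on values, and open sets are countable unions of closed
balls. -/
theorem aemeasurable_continuousMap [TopologicalSpace.SeparableSpace K]
    [SecondCountableTopology C(K, ℝ)] [MeasurableSpace C(K, ℝ)] [BorelSpace C(K, ℝ)]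
    {F : Ω → C(K, ℝ)} (hF : ∀ t, AEMeasurable (fun ω => F ω t) Q) : AEMeasurable F Q := by
  refine NullMeasurable.aemeasurable ?_
  suffices h : Measurable (α := NullMeasurableSpace Ω Q) F from fun s hs => h hs
  have hball : ∀ (g : C(K, ℝ)) (r : ℝ), 0 ≤ r →
      NullMeasurableSet (F ⁻¹' Metric.closedBall g r) Q := by
    intro g r hr
    obtain ⟨D, hDc, hD⟩ := TopologicalSpace.exists_countable_dense K
    have : F ⁻¹' Metric.closedBall g r = ⋂ t ∈ D, {ω | dist (F ω t) (g t) ≤ r} := by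
      ext ω
      simp only [mem_preimage, Metric.mem_closedBall, ContinuousMap.dist_le hr, mem_iInter,
        mem_ofPred_eq]
      refine ⟨fun h t _ => h t, fun h t => ?_⟩
      have hcl : IsClosed {t | dist (F ω t) (g t) ≤ r} :=
        isClosed_le ((F ω).continuous.dist g.continuous) continuous_const
      exact hcl.closure_subset_iff.2 h (hD t)
    rw [this]
    exact NullMeasurableSet.biInter hDc fun t _ =>
      nullMeasurableSet_le ((hF t).dist aemeasurable_const) aemeasurable_const
  refine measurable_of_isOpen fun O hO => ?_
  change NullMeasurableSet (F ⁻¹' O) Q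
  have hr : ∀ g ∈ O, ∃ r > 0, Metric.closedBall g r ⊆ O := fun g hg =>
    Metric.nhds_basis_closedBall.mem_iff.1 (hO.mem_nhds hg)
  choose! r hr0 hrO using hr
  obtain ⟨D, hDO, hDc, hD⟩ := TopologicalSpace.isOpen_biUnion_countable O
    (fun g => Metric.ball g (r g)) fun g _ => Metric.isOpen_ball
  have : O = ⋃ g ∈ D, Metric.closedBall g (r g) := by
    refine subset_antisymm (fun g hg => ?_) (iUnion₂_subset fun g hg => hrO g (hDO hg))
    have h1 : g ∈ ⋃ g ∈ D, Metric.ball g (r g) := by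
      rw [hD]
      exact mem_biUnion hg (Metric.mem_ball_self (hr0 g hg))
    exact (iUnion₂_mono fun g _ => Metric.ball_subset_closedBall) h1
  rw [this, preimage_iUnion₂]
  exact NullMeasurableSet.biUnion hDc fun g hg => hball g _ (hr0 g (hDO hg)).le

/-- If `Θ` is inducing into a space with a countably generated Borel `σ`-algebra, then
measurability of `Θ ∘ p` passes to `G ∘ p` for every continuous `G`. -/
theorem _root_.AEMeasurable.comp_of_isInducing {E A B : Type*} [TopologicalSpace E]
    [TopologicalSpace A] [MeasurableSpace A] [BorelSpace A] [MeasurableSpace.CountablyGenerated A]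
    [TopologicalSpace B] [MeasurableSpace B] [BorelSpace B] {Θ : E → A} (hΘ : IsInducing Θ)
    {G : E → B} (hG : Continuous G) {p : Ω → E} (h : AEMeasurable (fun ω => Θ (p ω)) Q) :
    AEMeasurable (fun ω => G (p ω)) Q := by
  borelize E
  have hborel : borel E = MeasurableSpace.comap Θ inferInstance := by
    rw [hΘ.eq_induced, borel_comap, ← BorelSpace.measurable_eq]
  have hcg : MeasurableSpace.CountablyGenerated E := by
    have := MeasurableSpace.CountablyGenerated.comap Θ
    rwa [← hborel] at this
  have hp : AEMeasurable p Q := by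
    refine NullMeasurable.aemeasurable fun s hs => ?_
    change MeasurableSet[borel _] s at hs
    rw [hborel] at hs
    obtain ⟨s', hs', rfl⟩ := hs
    exact h.nullMeasurable hs'
  exact hG.measurable.comp_aemeasurable hp

variable {𝕏 : Type*} [TopologicalSpace 𝕏] [MeasurableSpace 𝕏] [OpensMeasurableSpace 𝕏]

/-- `μ ↦ μ(φ)`, as a continuous function on the space of signed measures. -/
def pairingMap (φ : 𝕏 →ᵇ ℝ) : C(WeakSignedMeasure 𝕏, ℝ) where
  toFun μ := μ.pairing φ
  continuous_toFun := by
    have h : IsInducing fun (μ : WeakSignedMeasure 𝕏) (φ : 𝕏 →ᵇ ℝ) => μ.pairing φ := ⟨rfl⟩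
    exact (continuous_apply φ).comp h.continuous

theorem pairingMap_apply (φ : 𝕏 →ᵇ ℝ) (μ : WeakSignedMeasure 𝕏) :
    pairingMap φ μ = μ.pairing φ := rfl

theorem isInducing_pairingMap :
    IsInducing fun (μ : WeakSignedMeasure 𝕏) (φ : 𝕏 →ᵇ ℝ) => pairingMap φ μ := by
  simp only [pairingMap_apply]
  exact ⟨rfl⟩

theorem pairingMap_zero (φ : 𝕏 →ᵇ ℝ) : pairingMap φ (0 : WeakSignedMeasure 𝕏) = 0 := by
  have h := pairing_subMeasure (0 : FiniteMeasure 𝕏) 0 φ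
  have h0 : subMeasure (0 : FiniteMeasure 𝕏) 0 = 0 := sub_self _
  rw [h0] at h
  simpa [pairingMap_apply] using h

theorem continuous_subPath :
    Continuous fun p : C(K, FiniteMeasure 𝕏) × C(K, FiniteMeasure 𝕏) => subPath p.1 p.2 := by
  refine (isInducing_postcomp_pi (K := K) isInducing_pairingMap).continuous_iff.2
    (continuous_pi fun φ => ?_)
  have h1 := ContinuousMap.continuous_postcomp (X := K) (integralMap φ)
  have h2 := (h1.comp (continuous_fst (Y := C(K, FiniteMeasure 𝕏)))).sub
    (h1.comp (continuous_snd (X := C(K, FiniteMeasure 𝕏))))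
  refine h2.congr fun p => ContinuousMap.ext fun t => Eq.symm ?_
  exact pairing_subMeasure (p.1 t) (p.2 t) φ

/-- The Borel `σ`-algebra of the paths of signed measures is not countably generated in general, so
measurability is obtained on the space of pairs of paths of finite measures, where countably many
real paths induce the topology. -/
theorem aemeasurable_subPath [LocallyCompactSpace K] [SecondCountableTopology K]
    [SecondCountableTopology 𝕏] [HasOuterApproxClosed 𝕏] {μ ν : Ω → C(K, FiniteMeasure 𝕏)}
    (hμ : ∀ t (φ : 𝕏 →ᵇ ℝ), AEMeasurable (fun ω => ∫ x, φ x ∂(μ ω t : Measure 𝕏)) Q)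
    (hν : ∀ t (φ : 𝕏 →ᵇ ℝ), AEMeasurable (fun ω => ∫ x, φ x ∂(ν ω t : Measure 𝕏)) Q) :
    AEMeasurable (fun ω => subPath (μ ω) (ν ω)) Q := by
  borelize C(K, ℝ)
  have hc : Countable (convergenceDetermining 𝕏) := countable_convergenceDetermining.to_subtype
  have hI := isInducing_postcomp_pi (K := K) (isInducing_convergenceDetermining (𝕏 := 𝕏))
  refine AEMeasurable.comp_of_isInducing (hI.prodMap hI) continuous_subPath
    (p := fun ω => (μ ω, ν ω)) (AEMeasurable.prodMk ?_ ?_)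
  · exact aemeasurable_pi_lambda _ fun φ => aemeasurable_continuousMap fun t => hμ t φ
  · exact aemeasurable_pi_lambda _ fun φ => aemeasurable_continuousMap fun t => hν t φ

section Convergence

variable [IsProbabilityMeasure Q] {ι : Type*} {l : Filter ι}
  {x : ι → Ω → C(K, WeakSignedMeasure 𝕏)}

/-- A family of paths of signed measures converges to `0` in distribution if each of its pairings
converges to `0` in probability, uniformly in time. -/
theorem tendstoInDistribution_zero [l.IsCountablyGenerated] (hx : ∀ i, AEMeasurable (x i) Q)
    (h : ∀ (φ : 𝕏 →ᵇ ℝ) (r : ℝ), 0 < r →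
      Tendsto (fun i => Q {ω | ∃ t, r ≤ |(x i ω t).pairing φ|}) l (𝓝 0)) :
    TendstoInDistribution x l (fun _ : Ω => 0) (fun _ => Q) Q := by
  refine ⟨hx, aemeasurable_const, ProbabilityMeasure.tendsto_iff_forall_integral_tendsto.2
    fun F => ?_⟩
  -- the sets that contain `x i` with probability tending to one form a filter
  let 𝓕 : Filter C(K, WeakSignedMeasure 𝕏) :=
    { sets := {V | Tendsto (fun i => Q {ω | x i ω ∉ V}) l (𝓝 0)}
      univ_sets := by
        simp only [mem_ofPred_eq, mem_univ, not_true_eq_false, ofPred_false, measure_empty]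
        exact tendsto_const_nhds
      sets_of_superset := fun {V V'} hV hVV' => tendsto_of_tendsto_of_tendsto_of_le_of_le
        tendsto_const_nhds hV (fun _ => zero_le) fun i => measure_mono fun ω hω hV => hω (hVV' hV)
      inter_sets := fun {V V'} hV hV' => by
        have h1 := Tendsto.add hV hV'
        rw [add_zero] at h1
        refine tendsto_of_tendsto_of_tendsto_of_le_of_le tendsto_const_nhds h1
          (fun _ => zero_le) fun i => (measure_mono fun ω hω => ?_).trans (measure_union_le _ _)
        exact not_and_or.1 hω }
  have h𝓕 : Tendsto (fun y => y) 𝓕 (𝓝 (0 : C(K, WeakSignedMeasure 𝕏))) := by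
    refine (tendsto_continuousMap_iff_of_isInducing isInducing_pairingMap).2 fun φ => ?_
    refine Metric.tendsto_nhds.2 fun r hr => ?_
    refine tendsto_of_tendsto_of_tendsto_of_le_of_le tendsto_const_nhds (h φ r hr)
      (fun _ => zero_le) fun i => measure_mono fun ω hω => ?_
    by_contra hc
    refine hω ((ContinuousMap.dist_lt_iff hr).2 fun t => ?_)
    have h1 : ¬ r ≤ ‖((pairingMap φ).comp (x i ω)) t‖ := fun h2 => hc ⟨t, h2⟩
    have h2 : ((pairingMap φ).comp (0 : C(K, WeakSignedMeasure 𝕏))) t = 0 := pairingMap_zero φ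
    rw [h2, dist_zero_right]
    exact not_le.1 h1
  have hm : ∀ i, AEMeasurable (fun ω => F (x i ω)) Q := fun i =>
    F.continuous.measurable.comp_aemeasurable (hx i)
  have h1 : TendstoInMeasure Q (fun i ω => F (x i ω)) l fun _ => F 0 := by
    rw [tendstoInMeasure_iff_dist]
    intro δ hδ
    have h2 := ((F.continuous.tendsto 0).comp h𝓕) (Metric.ball_mem_nhds _ hδ)
    refine Tendsto.congr (fun i => congrArg Q ?_) h2
    ext ω
    exact not_lt (a := dist (F (x i ω)) (F 0))
  have h2 := ProbabilityMeasure.tendsto_iff_forall_integral_tendsto.1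
    (h1.tendstoInDistribution_of_aemeasurable hm aemeasurable_const).tendsto
  -- convergence in law of `F (x i)` is tested with the truncation `G`, which is the identity on the
  -- range of `F`
  let G : ℝ →ᵇ ℝ := BoundedContinuousFunction.ofNormedAddCommGroup
    (fun y => max (-‖F‖) (min y ‖F‖)) (by fun_prop) ‖F‖ fun y => by
      rw [Real.norm_eq_abs, abs_le]
      exact ⟨le_max_left _ _, max_le (by linarith [norm_nonneg F]) (min_le_right _ _)⟩
  have hG : ∀ y, G (F y) = F y := fun y => by
    have := abs_le.1 (F.norm_coe_le_norm y)
    change max (-‖F‖) (min (F y) ‖F‖) = F y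
    rw [min_eq_left this.2, max_eq_right this.1]
  have h3 := h2 G
  simp only [ProbabilityMeasure.coe_mk] at h3 ⊢
  rw [integral_map aemeasurable_const G.continuous.measurable.aestronglyMeasurable] at h3
  rw [integral_map aemeasurable_const F.continuous.measurable.aestronglyMeasurable]
  simp only [hG] at h3
  refine h3.congr fun i => ?_
  rw [integral_map (hm i) G.continuous.measurable.aestronglyMeasurable,
    integral_map (hx i) F.continuous.measurable.aestronglyMeasurable]
  simp only [hG]

/-- Convergence in distribution to `0` of paths of signed measures makes each pairing converge to `0`
in probability, uniformly in time. -/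
theorem _root_.MeasureTheory.TendstoInDistribution.tendsto_measure_le_abs_pairing
    (h : TendstoInDistribution x l (fun _ : Ω => 0) (fun _ => Q) Q) (φ : 𝕏 →ᵇ ℝ) {r : ℝ}
    (hr : 0 < r) : Tendsto (fun i => Q {ω | ∃ t, r ≤ |(x i ω t).pairing φ|}) l (𝓝 0) := by
  have hc : Continuous fun y : C(K, WeakSignedMeasure 𝕏) => ‖(pairingMap φ).comp y‖ :=
    continuous_norm.comp (ContinuousMap.continuous_postcomp (pairingMap φ))
  have h1 := h.continuous_comp hc
  have h0 : (pairingMap φ).comp (0 : C(K, WeakSignedMeasure 𝕏)) = 0 := by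
    ext t
    exact pairingMap_zero φ
  have h2 := ProbabilityMeasure.tendsto_measure_of_null_frontier_of_tendsto' h1.tendsto
    (E := Ici r) (by
      rw [frontier_Ici]
      simp only [ProbabilityMeasure.coe_mk, Function.comp_def, h0, norm_zero]
      rw [Measure.map_const]
      simp [hr.ne])
  simp only [ProbabilityMeasure.coe_mk, Function.comp_def, h0, norm_zero] at h2
  rw [Measure.map_const] at h2
  have h3 : (Q univ • Measure.dirac (0 : ℝ)) (Ici r) = 0 := by simp [hr]
  rw [h3] at h2
  refine tendsto_of_tendsto_of_tendsto_of_le_of_le tendsto_const_nhds h2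
    (fun _ => zero_le) fun i => ?_
  have h4 := Measure.map_apply_of_aemeasurable (h1.forall_aemeasurable i)
    (measurableSet_Ici (a := r))
  simp only [Function.comp_def] at h4
  rw [h4]
  refine measure_mono fun ω ⟨t, ht⟩ => ?_
  exact ht.trans (((pairingMap φ).comp (x i ω)).norm_coe_le_norm t)

end Convergence

end Measurability

/-! ### Convergence of normalized paths -/

section Normalization

variable {Ω K 𝕏 : Type*} {mΩ : MeasurableSpace Ω} {Q : Measure Ω} [TopologicalSpace K]
  [TopologicalSpace 𝕏] [MeasurableSpace 𝕏] [OpensMeasurableSpace 𝕏]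

theorem integral_toFinitePath_normalizedPath [Nonempty 𝕏] {μ : C(K, FiniteMeasure 𝕏)}
    (hμ : ∀ t, μ t ≠ 0) (t : K) (φ : 𝕏 → ℝ) :
    ∫ x, φ x ∂(toFinitePath (normalizedPath μ) t : Measure 𝕏)
      = (∫ x, φ x ∂(μ t : Measure 𝕏)) / ∫ _, (1 : ℝ) ∂(μ t : Measure 𝕏) := by
  rw [← integral_normalize (hμ t), normalizedPath, dif_pos hμ]
  rfl

theorem abs_integral_le_norm_mul (ν : FiniteMeasure 𝕏) (φ : 𝕏 →ᵇ ℝ) :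
    |∫ x, φ x ∂(ν : Measure 𝕏)| ≤ ‖φ‖ * ∫ _, (1 : ℝ) ∂(ν : Measure 𝕏) := by
  refine (φ.norm_integral_le_mul_norm (ν : Measure 𝕏)).trans_eq ?_
  rw [integral_const, smul_eq_mul, mul_one, mul_comm]

theorem integral_one_pos {ν : FiniteMeasure 𝕏} (hν : ν ≠ 0) :
    0 < ∫ _, (1 : ℝ) ∂(ν : Measure 𝕏) := by
  rw [integral_const, smul_eq_mul, mul_one]
  refine ENNReal.toReal_pos (fun h => hν (Subtype.ext ?_)) (measure_ne_top _ _)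
  exact Measure.measure_univ_eq_zero.1 h

/-- The difference of two quotients, controlled by the differences of the numerators and of the
denominators and by one denominator only. -/
theorem abs_div_sub_div_le {a b m n s : ℝ} (hm : 0 < m) (hn : 0 < n) (hb : |b| ≤ s * n) :
    |a / m - b / n| ≤ (|a - b| + s * |m - n|) / m := by
  have h1 : a / m - b / n = ((a - b) - b / n * (m - n)) / m := by
    field_simp
    ring
  have h2 : |b / n| ≤ s := by
    rw [abs_div, abs_of_pos hn, div_le_iff₀ hn]
    exact hb
  rw [h1, abs_div, abs_of_pos hm]
  gcongr
  refine (abs_sub _ _).trans ?_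
  rw [abs_mul]
  gcongr

variable [CompactSpace K] [LocallyCompactSpace K] [SecondCountableTopology K]
  [SecondCountableTopology 𝕏] [HasOuterApproxClosed 𝕏] [IsProbabilityMeasure Q]

theorem aemeasurable_integral_normalizedPath [Nonempty 𝕏] {μ : Ω → C(K, FiniteMeasure 𝕏)}
    (hμ : ∀ t (φ : 𝕏 →ᵇ ℝ), AEMeasurable (fun ω => ∫ x, φ x ∂(μ ω t : Measure 𝕏)) Q)
    (hμ0 : ∀ᵐ ω ∂Q, ∀ t, μ ω t ≠ 0) (t : K) (φ : 𝕏 →ᵇ ℝ) :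
    AEMeasurable (fun ω => ∫ x, φ x ∂(toFinitePath (normalizedPath (μ ω)) t : Measure 𝕏)) Q :=
  ((hμ t φ).div (hμ t 1)).congr (hμ0.mono fun _ hω =>
    (integral_toFinitePath_normalizedPath hω t φ).symm)

/-- Convergence of the difference of two families of paths of measures passes to the normalized
paths if the masses of one of the families are bounded below in probability. -/
theorem tendstoInDistribution_normalizedPath [Nonempty 𝕏] {ι : Type*} {l : Filter ι}
    [l.IsCountablyGenerated] {μ ν : ι → Ω → C(K, FiniteMeasure 𝕏)}
    (hμ : ∀ i t (φ : 𝕏 →ᵇ ℝ), AEMeasurable (fun ω => ∫ x, φ x ∂(μ i ω t : Measure 𝕏)) Q)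
    (hν : ∀ i t (φ : 𝕏 →ᵇ ℝ), AEMeasurable (fun ω => ∫ x, φ x ∂(ν i ω t : Measure 𝕏)) Q)
    (hμ0 : ∀ i, ∀ᵐ ω ∂Q, ∀ t, μ i ω t ≠ 0) (hν0 : ∀ i, ∀ᵐ ω ∂Q, ∀ t, ν i ω t ≠ 0)
    (hlow : ∀ q : ℝ≥0∞, 0 < q → ∃ κ : ℝ, 0 < κ ∧ ∀ i,
      Q {ω | ∃ t, ∫ _, (1 : ℝ) ∂(μ i ω t : Measure 𝕏) < κ} ≤ q)
    (h : TendstoInDistribution (fun i ω => subPath (μ i ω) (ν i ω)) l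
      (fun _ : Ω => 0) (fun _ => Q) Q) :
    TendstoInDistribution (fun i ω => subPath (toFinitePath (normalizedPath (μ i ω)))
      (toFinitePath (normalizedPath (ν i ω)))) l (fun _ : Ω => 0) (fun _ => Q) Q := by
  refine tendstoInDistribution_zero (fun i => aemeasurable_subPath
    (aemeasurable_integral_normalizedPath (hμ i) (hμ0 i))
    (aemeasurable_integral_normalizedPath (hν i) (hν0 i))) fun φ r hr => ?_
  refine ENNReal.tendsto_nhds_zero.2 fun q hq => ?_
  have hq3 : 0 < q / 3 := ENNReal.div_pos hq.ne' (by simp)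
  obtain ⟨κ, hκ, hlow⟩ := hlow _ hq3
  have hs : 0 < ‖φ‖ + 1 := by positivity
  have h1 := h.tendsto_measure_le_abs_pairing φ (r := r * κ / 2) (by positivity)
  have h2 := h.tendsto_measure_le_abs_pairing 1 (r := r * κ / (2 * (‖φ‖ + 1))) (by positivity)
  filter_upwards [ENNReal.tendsto_nhds_zero.1 h1 _ hq3, ENNReal.tendsto_nhds_zero.1 h2 _ hq3]
    with i hi1 hi2
  calc Q {ω | ∃ t, r ≤ |((subPath (toFinitePath (normalizedPath (μ i ω)))
          (toFinitePath (normalizedPath (ν i ω)))) t).pairing φ|}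
      ≤ Q ({ω | ∃ t, ∫ _, (1 : ℝ) ∂(μ i ω t : Measure 𝕏) < κ} ∪
          {ω | ∃ t, r * κ / 2 ≤ |((subPath (μ i ω) (ν i ω)) t).pairing φ|} ∪
          {ω | ∃ t, r * κ / (2 * (‖φ‖ + 1))
            ≤ |((subPath (μ i ω) (ν i ω)) t).pairing (1 : 𝕏 →ᵇ ℝ)|}) := by
        refine measure_mono_ae ?_
        filter_upwards [hμ0 i, hν0 i] with ω hω1 hω2
        rintro ⟨t, ht⟩
        by_contra hc
        have hc' := not_or.1 hc
        have hc'' := not_or.1 hc'.1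
        have h3 : κ ≤ ∫ _, (1 : ℝ) ∂(μ i ω t : Measure 𝕏) :=
          not_lt.1 fun h => hc''.1 ⟨t, h⟩
        have h4 : |((subPath (μ i ω) (ν i ω)) t).pairing φ| < r * κ / 2 :=
          not_le.1 fun h => hc''.2 ⟨t, h⟩
        have h5 : |((subPath (μ i ω) (ν i ω)) t).pairing (1 : 𝕏 →ᵇ ℝ)|
            < r * κ / (2 * (‖φ‖ + 1)) := not_le.1 fun h => hc'.2 ⟨t, h⟩
        rw [show (subPath (μ i ω) (ν i ω)) t = subMeasure (μ i ω t) (ν i ω t) from rfl,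
          pairing_subMeasure] at h4 h5
        simp only [BoundedContinuousFunction.coe_one, Pi.one_apply] at h5
        change r ≤ |(subMeasure (toFinitePath (normalizedPath (μ i ω)) t)
          (toFinitePath (normalizedPath (ν i ω)) t)).pairing φ| at ht
        rw [pairing_subMeasure, integral_toFinitePath_normalizedPath hω1,
          integral_toFinitePath_normalizedPath hω2] at ht
        have h6 := abs_div_sub_div_le (a := ∫ x, φ x ∂(μ i ω t : Measure 𝕏))
          (integral_one_pos (hω1 t)) (integral_one_pos (hω2 t))
          (abs_integral_le_norm_mul (ν i ω t) φ)
        have h7 := ht.trans h6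
        rw [le_div_iff₀ (integral_one_pos (hω1 t))] at h7
        rw [lt_div_iff₀ (by positivity)] at h5
        nlinarith [mul_le_mul_of_nonneg_left h3 hr.le, abs_nonneg
          (∫ _, (1 : ℝ) ∂(μ i ω t : Measure 𝕏) - ∫ _, (1 : ℝ) ∂(ν i ω t : Measure 𝕏))]
    _ ≤ q / 3 + q / 3 + q / 3 := (measure_union_le _ _).trans
        (add_le_add ((measure_union_le _ _).trans (add_le_add (hlow i) hi1)) hi2)
    _ = q := ENNReal.add_thirds q

end Normalization

/-! ### The mass of a solution of the Zakai equation -/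

section Zakai

theorem isC2b_one {V : Type*} [NormedAddCommGroup V] [NormedSpace ℝ V] :
    IsC2b (1 : V → ℝ) := by
  refine ⟨contDiff_const, 1, fun k _ p => ?_⟩
  rcases Nat.eq_zero_or_pos k with rfl | hk
  · simp
  · have : iteratedFDeriv ℝ k (1 : V → ℝ) = 0 := iteratedFDeriv_const_of_ne hk.ne' (1 : ℝ)
    simp [this]

theorem partialD_const {k : ℕ} (i : Fin k) (a : ℝ) : partialD i (fun _ => a) = 0 := by
  ext x
  simp [partialD]

theorem secondOrder_const {k : ℕ} (b : Fin k → ℝ) (A : Matrix (Fin k) (Fin k) ℝ) (a : ℝ) :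
    secondOrder b A (fun _ => a) = 0 := by
  ext x
  simp only [secondOrder, partialD_const]
  simp [show (0 : EuclideanSpace ℝ (Fin k) → ℝ) = fun _ => 0 from rfl, partialD_const]

namespace Coefficients

variable {m n d w v u : ℕ} (c : Coefficients m n d w v u)

theorem genSignal_one (ε : ℝ) : c.genSignal ε 1 = 0 := by
  ext p
  simp [genSignal, genFast, secondOrder_const]

theorem obsSignal_one (p : EuclideanSpace ℝ (Fin m) × EuclideanSpace ℝ (Fin n)) (k : Fin d) :
    c.obsSignal 1 p k = c.h p.1 p.2 k := by
  simp only [obsSignal, Pi.one_apply, one_mul, partialD_const]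
  simp [Matrix.mulVec, dotProduct]

theorem genDagger_one (μ : Kernel (EuclideanSpace ℝ (Fin m)) (EuclideanSpace ℝ (Fin n)))
    (Φ : EuclideanSpace ℝ (Fin m) → EuclideanSpace ℝ (Fin n) → EuclideanSpace ℝ (Fin m)) :
    c.genDagger μ Φ 1 = 0 := by
  ext x
  exact congrFun (secondOrder_const _ _ (1 : ℝ)) x

theorem obsBar_one (μ : Kernel (EuclideanSpace ℝ (Fin m)) (EuclideanSpace ℝ (Fin n)))
    (x : EuclideanSpace ℝ (Fin m)) (k : Fin d) : c.obsBar μ 1 x k = c.hBar μ x k := by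
  have h : ∀ i : Fin m, partialD i (1 : EuclideanSpace ℝ (Fin m) → ℝ) = 0 := fun i =>
    partialD_const i 1
  simp only [obsBar, Pi.one_apply, one_mul, h]
  simp [Matrix.mulVec, dotProduct]

variable {Ω : Type*} {mΩ : MeasurableSpace Ω} {ℱ : Filtration ℝ≥0 mΩ} {Q : Measure Ω} {T : ℝ≥0}
  {W : ℝ≥0 → Ω → Fin w → ℝ} {V : ℝ≥0 → Ω → Fin v → ℝ} {U : ℝ≥0 → Ω → Fin u → ℝ}
  {X : ℝ≥0 → Ω → EuclideanSpace ℝ (Fin m)} {Z : ℝ≥0 → Ω → EuclideanSpace ℝ (Fin n)}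

theorem isStronglyProgressive_sensor (hX : Adapted ℱ X) (hXc : ∀ ω, Continuous fun t => X t ω)
    (hZ : Adapted ℱ Z) (hZc : ∀ ω, Continuous fun t => Z t ω) :
    IsStronglyProgressive ℱ (c.sensor X Z) := by
  have h1 : IsStronglyProgressive ℱ fun t ω => (X t ω, Z t ω) :=
    StronglyAdapted.isStronglyProgressive_of_continuous
      (fun t => (hX t).stronglyMeasurable.prodMk (hZ t).stronglyMeasurable)
      fun ω => (hXc ω).prodMk (hZc ω)
  intro t
  refine Measurable.stronglyMeasurable ?_
  have h2 : Measurable fun p : EuclideanSpace ℝ (Fin m) × EuclideanSpace ℝ (Fin n) =>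
      fun k => c.h p.1 p.2 k :=
    measurable_pi_lambda _ fun k => (by fun_prop : Measurable fun y : EuclideanSpace ℝ (Fin d) =>
      y k).comp c.measurable_h
  exact h2.comp (h1 t).measurable

variable {𝕏 : Type*} [NormedAddCommGroup 𝕏] [NormedSpace ℝ 𝕏] [MeasurableSpace 𝕏]
  [OpensMeasurableSpace 𝕏] {A : (𝕏 → ℝ) → 𝕏 → ℝ} {M : (𝕏 → ℝ) → 𝕏 → Fin d → ℝ} {ν : Measure 𝕏}
  {ρ : Ω → C(ℝ≥0, FiniteMeasure 𝕏)} {c}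

/-- The mass of a solution of the Zakai equation is bounded below in probability, uniformly on
`[0, T]`, by a bound that depends only on the bound of the sensor function. -/
theorem SolvesZakai.measure_exists_mass_lt [IsProbabilityMeasure Q] [IsProbabilityMeasure ν]
    (hBM : IsBrownianMotion ℱ Q fun t ω => Sum.elim (W t ω) (Sum.elim (V t ω) (U t ω)))
    (hρ : c.SolvesZakai ℱ Q T W U X Z A M ν ρ) (hA : A 1 = 0) {C : ℝ} (hC : 0 ≤ C)
    (hM : ∀ x k, |M 1 x k| ≤ C) (hη : IsStronglyProgressive ℱ (c.sensor X Z))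
    (hηC : ∀ r ω i, |c.sensor X Z r ω i| ≤ C) {R : ℝ} (hR : 0 < R) :
    Q {ω | ∃ t ≤ T, ∫ _, (1 : ℝ) ∂(ρ ω t : Measure 𝕏)
        < Real.exp (-(10 * d * C ^ 2 * T + 5 * R)) / 4}
      ≤ ENNReal.ofReal (4 * d * C ^ 2 * T / R ^ 2) + ENNReal.ofReal (4 * d * C ^ 2 * T / R) := by
  have hone : (fun x => (1 : 𝕏 →ᵇ ℝ) x) = 1 := rfl
  have h := measure_exists_lt_exp_neg (c.isBrownianMotion_obsNoise hBM) hC hη hηC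
    (H := fun s ω k => ∫ p, M 1 p k ∂(ρ ω s : Measure 𝕏))
    (M := fun t ω => ∫ _, (1 : ℝ) ∂(ρ ω t : Measure 𝕏)) (T := T)
    (fun t => hρ.adapted t 1)
    (fun ω => (FiniteMeasure.continuous_integral_boundedContinuousFunction
      (1 : 𝕏 →ᵇ ℝ)).comp (ρ ω).continuous)
    (fun t ω => integral_nonneg fun _ => zero_le_one)
    (by
      filter_upwards [hρ.initial 1 isC2b_one] with ω hω
      simpa using hω)
    (fun r ω k => by
      refine (norm_integral_le_of_norm_le_const (f := fun p => M 1 p k)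
        (Eventually.of_forall fun x => hM x k)).trans_eq ?_
      rw [integral_const, smul_eq_mul, mul_one])
    (by
      have := hρ.evolution 1 isC2b_one
      simp only [hA, Pi.zero_apply, integral_zero, sub_zero, Pi.one_apply] at this
      exact this) hR
  simpa only [Fintype.card_fin] using h

/-- The bound of `SolvesZakai.measure_exists_mass_lt` tends to zero as `R` tends to infinity. -/
theorem exists_tail_le (d : ℕ) (C : ℝ) (T : ℝ≥0) {q : ℝ≥0∞} (hq : 0 < q) : ∃ R : ℝ, 0 < R ∧
    ENNReal.ofReal (4 * d * C ^ 2 * T / R ^ 2) + ENNReal.ofReal (4 * d * C ^ 2 * T / R) ≤ q := by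
  have h1 : Tendsto (fun R : ℝ => ENNReal.ofReal (4 * d * C ^ 2 * T / R ^ 2)
      + ENNReal.ofReal (4 * d * C ^ 2 * T / R)) atTop (𝓝 0) := by
    have := (ENNReal.tendsto_ofReal ((tendsto_pow_atTop (α := ℝ) two_ne_zero).const_div_atTop
      (4 * d * C ^ 2 * T))).add (ENNReal.tendsto_ofReal (tendsto_id.const_div_atTop
      (4 * d * C ^ 2 * (T : ℝ))))
    simpa using this
  obtain ⟨R, hR, hR0⟩ := ((ENNReal.tendsto_nhds_zero.1 h1 q hq).and (eventually_gt_atTop 0)).exists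
  exact ⟨R, hR0, hR⟩

/-- A solution of the Zakai equation with bounded sensor function almost surely never vanishes. -/
theorem SolvesZakai.ae_ne_zero [IsProbabilityMeasure Q] [IsProbabilityMeasure ν]
    (hBM : IsBrownianMotion ℱ Q fun t ω => Sum.elim (W t ω) (Sum.elim (V t ω) (U t ω)))
    (hρ : c.SolvesZakai ℱ Q T W U X Z A M ν ρ) (hA : A 1 = 0) {C : ℝ} (hC : 0 ≤ C)
    (hM : ∀ x k, |M 1 x k| ≤ C) (hη : IsStronglyProgressive ℱ (c.sensor X Z))
    (hηC : ∀ r ω i, |c.sensor X Z r ω i| ≤ C) : ∀ᵐ ω ∂Q, ∀ t ≤ T, ρ ω t ≠ 0 := by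
  refine le_antisymm (le_of_forall_gt fun q hq => ?_) zero_le
  obtain ⟨q', hq', hq'q⟩ := exists_between hq
  obtain ⟨R, hR, hRq⟩ := exists_tail_le d C T hq'
  refine lt_of_le_of_lt ((measure_mono fun ω hω => ?_).trans
    ((hρ.measure_exists_mass_lt hBM hA hC hM hη hηC hR).trans hRq)) hq'q
  simp only [mem_compl_iff, mem_ofPred_eq, not_forall, not_not] at hω
  obtain ⟨t, ht, h0⟩ := hω
  refine ⟨t, ht, ?_⟩
  rw [h0]
  simp only [FiniteMeasure.toMeasure_zero, integral_zero_measure]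
  positivity

end Coefficients

end Zakai

/-! ### The exponential density -/

section Density

variable {Ω : Type*} {mΩ : MeasurableSpace Ω} {ι : Type*} [Fintype ι]
  {ℱ : Filtration ℝ≥0 mΩ} {Q : Measure Ω} {β : ℝ≥0 → Ω → ι → ℝ}

variable [IsProbabilityMeasure Q]

/-- The Itô integral of an integrand bounded by `C`, together with its quadratic variation, is
approximated along a grid through a given time by sums whose coefficients are bounded by `C`. -/
theorem exists_bounded_approximation (hβ : IsBrownianMotion ℱ Q β) {T : ℝ≥0} {C : ℝ} (hC : 0 ≤ C)
    {H : ℝ≥0 → Ω → ι → ℝ} {J : ℝ≥0 → Ω → ℝ} (hHC : ∀ r ω i, |H r ω i| ≤ C)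
    (hJ : IsItoIntegral ℱ Q T β H J) {t : ℝ≥0} (ht : t ≤ T) {δ q : ℝ} (hδ : 0 < δ) (hq : 0 < q) :
    ∃ (s : ℕ → ℝ≥0) (k N : ℕ) (ζ : ℕ → Ω → ι → ℝ), Monotone s ∧ s 0 = 0 ∧ k ≤ N ∧ s k = t ∧
      s N = T ∧ (∀ j, Measurable[ℱ (s j)] (ζ j)) ∧ (∀ j ω i, |ζ j ω i| ≤ C) ∧
      Q {ω | ¬ ∀ j ≤ N, |incSum β s ζ j ω - J (s j) ω| ≤ δ ∧
        |incVar s ζ j ω - ∫ r in Iic (s j), ∑ i, H r ω i ^ 2 ∂leb| ≤ δ} ≤ ENNReal.ofReal q := by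
  classical
  obtain ⟨S, hS1, hS2⟩ := hJ.approx
  set p : ℝ := (Fintype.card ι : ℝ) with hp
  have hp0 : 0 ≤ p := by positivity
  obtain ⟨l, hl, -, hl1⟩ := exists_pos_le_mul_le (c := 2 * C * p * T) (a := δ / 2) (e := 1)
    (by positivity) (by positivity) one_pos
  obtain ⟨e1, he1, he1a, he1b⟩ := exists_pos_le_mul_le (c := 2 * C / l) (a := δ / 2)
    (e := q * δ ^ 2 / 16) (by positivity) (by positivity) (by positivity)
  have hq4 : 0 < ENNReal.ofReal (q / 4) := by simpa using hq
  obtain ⟨n, hn1, hn2⟩ := ((hS1 (ENNReal.ofReal e1) (by simpa using he1)).eventually_le_const hq4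
    |>.and ((hS2 (δ / 2) (by positivity)).eventually_le_const hq4)).exists
  obtain ⟨s, N, hs, h0, hN, hT, -, hA'⟩ := exists_grid (insert t (S n).times) T one_pos
  have hA : ∀ a ∈ (S n).times, ∀ k, a ≤ s k ∨ s (k + 1) ≤ a := fun a ha =>
    hA' a (Finset.mem_insert_of_mem ha)
  -- the time `t` has been put on the grid
  obtain ⟨k, hk, hsk⟩ := exists_eq_of_grid h0 (ht.trans_eq hN.symm)
    (hA' t (Finset.mem_insert_self _ _))
  let x : ℕ → Ω → ι → ℝ := fun j => (S n).value (s (j + 1))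
  -- clamping to the bound of `H` only moves the values closer to those of `H`
  let ζ : ℕ → Ω → ι → ℝ := fun j ω i => clamp C (x j ω i)
  have hxm : ∀ j, Measurable[ℱ (s j)] (x j) := (S n).measurable_value hA
  have hζm : ∀ j, Measurable[ℱ (s j)] (ζ j) := fun j =>
    @measurable_pi_lambda _ _ _ (ℱ (s j)) _ _ fun i => measurable_clamp.comp
      ((@measurable_const _ _ _ (ℱ (s j)) C).prodMk ((measurable_pi_apply i).comp (hxm j)))
  have hζC : ∀ j ω i, |ζ j ω i| ≤ C := fun j ω i => abs_clamp_le hC _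
  obtain ⟨Cx, hCx⟩ := (S n).exists_abs_value_le
  refine ⟨s, k, N, ζ, hs, h0, hk, hsk, hN, hζm, hζC, ?_⟩
  set B1 : Set Ω := {ω | ENNReal.ofReal e1 ≤ ∫⁻ r in Iic T,
    ∑ i, ENNReal.ofReal (((S n).value r ω i - H r ω i) ^ 2) ∂leb}
  set B2 : Set Ω := {ω | ∃ t ≤ T, δ / 2 ≤ |(S n).integral β t ω - J t ω|}
  set B3 : Set Ω := {ω | ∃ j ≤ N, δ / 2 ≤ |incSum β s (fun j ω i => x j ω i - ζ j ω i) j ω|}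
  let F : Ω → ℝ≥0 → ℝ := fun ω r => ∑ i, ((S n).value r ω i - H r ω i) ^ 2
  have hF0 : ∀ ω r, 0 ≤ F ω r := fun ω r => Finset.sum_nonneg fun i _ => sq_nonneg _
  have hHm : ∀ ω i, Measurable fun r => H r ω i := fun ω i =>
    measurable_path (u := fun r ω => H r ω i) (isStronglyProgressive_eval hJ.progressive i) ω
  have hFm : ∀ ω, Measurable (F ω) := fun ω => Finset.measurable_sum _ fun i _ =>
    (((S n).measurable_value_path ω i).sub (hHm ω i)).pow_const 2
  have hF : ∀ ω, ω ∉ B1 → IntegrableOn (F ω) (Iic T) leb ∧ ∫ r in Iic T, F ω r ∂leb ≤ e1 :=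
    fun ω hω => integrableOn_and_setIntegral_le (hFm ω) he1.le hω
  have hconst : ∀ c : ℝ, IntegrableOn (fun _ : ℝ≥0 => c) (Iic T) leb := fun c =>
    integrableOn_of_bounded measurable_const (C := |c|) (fun _ => le_rfl) T
  have hintc : ∀ (r : ℝ≥0) (c : ℝ), ∫ _ in Iic r, c ∂leb = r * c := fun r c => by
    rw [setIntegral_const, measureReal_def, leb_Iic, ENNReal.toReal_ofReal r.coe_nonneg, smul_eq_mul]
  have hval : ∀ ω, ∀ j, ∀ r ∈ Ioc (s j) (s (j + 1)), (S n).value r ω = x j ω :=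
    fun ω j r hr => (S n).value_eq_of_mem_cell hA hr ω
  have hvar : {ω | e1 < incVar s (fun j ω i => x j ω i - ζ j ω i) N ω} ⊆ B1 := by
    intro ω hω
    by_contra hcon
    obtain ⟨hFi, hFe⟩ := hF ω hcon
    have h1 := incVar_le_setIntegral hs hT (ζ := fun j ω i => x j ω i - ζ j ω i) (ω := ω)
      (f := F ω) hFi (hF0 ω) (N := N) (fun j _ r hr => by
        refine Finset.sum_le_sum fun i _ => ?_
        rw [hval ω j r hr, sq_le_sq]
        exact abs_sub_clamp_le (hHC r ω i) _) le_rfl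
    rw [hN] at h1
    exact absurd (h1.trans hFe) (not_le.2 hω)
  have hB3 : Q B3 ≤ Q B1 + ENNReal.ofReal (q / 4) := by
    refine (measure_exists_le_abs_incSum hβ hs (ζ := fun j ω i => x j ω i - ζ j ω i)
      (C := Cx + C) (fun k => (hxm k).sub (hζm k)) (fun k ω i => ?_) N
      (by positivity) he1.le).trans ?_
    · exact (abs_sub _ _).trans (add_le_add (hCx _ _ _) (hζC _ _ _))
    · refine add_le_add (measure_mono hvar) (ENNReal.ofReal_le_ofReal ?_)
      rw [div_le_iff₀ (by positivity)]
      linarith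
  have hsub : {ω | ¬ ∀ j ≤ N, |incSum β s ζ j ω - J (s j) ω| ≤ δ ∧
      |incVar s ζ j ω - ∫ r in Iic (s j), ∑ i, H r ω i ^ 2 ∂leb| ≤ δ} ⊆ B1 ∪ B2 ∪ B3 := by
    intro ω hω
    by_contra hcon
    simp only [mem_union, not_or] at hcon
    obtain ⟨⟨hb1, hb2⟩, hb3⟩ := hcon
    refine hω fun j hj => ⟨?_, ?_⟩
    · have h3 : |incSum β s x j ω - incSum β s ζ j ω| < δ / 2 := by
        rw [← incSum_sub]
        exact not_le.1 fun h => hb3 ⟨j, hj, h⟩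
      have h2 : |incSum β s x j ω - J (s j) ω| < δ / 2 := by
        rw [← (S n).integral_eq_incSum hs h0 hA]
        exact not_le.1 fun h => hb2 ⟨s j, hT j, h⟩
      rw [abs_lt] at h3 h2
      rw [abs_le]
      constructor <;> linarith [h3.1, h3.2, h2.1, h2.2]
    · obtain ⟨hFi, hFe⟩ := hF ω hb1
      have hi : IntegrableOn (fun r => 2 * C / l * F ω r + 2 * C * p * l) (Iic T) leb :=
        (hFi.const_mul _).add (hconst _)
      have h3 := abs_sum_sub_setIntegral_le hs h0 hT (ξ := fun j i => ζ j ω i ^ 2)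
        (H := fun r i => H r ω i ^ 2) (η := fun _ _ => 1)
        (f := fun r => 2 * C / l * F ω r + 2 * C * p * l) (fun _ => hconst 1)
        (integrableOn_of_bounded (C := p * C ^ 2) (Finset.measurable_sum _ fun i _ =>
          ((hHm ω i).pow_const 2).mul_const 1) (fun r => by
            refine (Finset.abs_sum_le_sum_abs _ _).trans
              ((Finset.sum_le_card_nsmul _ _ (C ^ 2) fun i _ => ?_).trans (by simp [p]))
            rw [mul_one, abs_pow]
            exact pow_le_pow_left₀ (abs_nonneg _) (hHC r ω i) 2) T)
        hi (N := N) (fun j' _ r hr => by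
          calc |∑ i, (ζ j' ω i ^ 2 - H r ω i ^ 2) * 1|
              ≤ ∑ i, |(ζ j' ω i ^ 2 - H r ω i ^ 2) * 1| := Finset.abs_sum_le_sum_abs _ _
            _ ≤ ∑ i, 2 * C * (l + ((S n).value r ω i - H r ω i) ^ 2 / l) := by
                refine Finset.sum_le_sum fun i _ => ?_
                rw [mul_one, sq_sub_sq, abs_mul]
                refine mul_le_mul ((abs_add_le _ _).trans ?_) ?_ (abs_nonneg _) (by positivity)
                · linarith [hζC j' ω i, hHC r ω i]
                · have h4 := abs_clamp_sub_le (a := C) (b := 0) (y := H r ω i) hC le_rfl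
                    (by simpa using hHC r ω i) (x j' ω i)
                  rw [hval ω j' r hr]
                  linarith [abs_le_add_sq_div (y := x j' ω i - H r ω i) hl]
            _ = 2 * C / l * F ω r + 2 * C * p * l := by
                rw [← Finset.mul_sum, Finset.sum_add_distrib, ← Finset.sum_div]
                simp only [Finset.sum_const, Finset.card_univ, nsmul_eq_mul, F, p]
                field_simp
                ring) hj
      have h4 : ∫ r in Ioc 0 (s j), (2 * C / l * F ω r + 2 * C * p * l) ∂leb ≤ δ := by
        refine (setIntegral_mono_set hi (ae_of_all _ fun r => ?_)
          (LE.le.eventuallyLE fun r hr => (mem_Ioc.1 hr).2.trans (hT j))).trans ?_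
        · have := hF0 ω r
          simp only [Pi.zero_apply]
          positivity
        · rw [integral_add (hFi.const_mul _) (hconst _), integral_const_mul, hintc]
          have g1 : 2 * C / l * ∫ r in Iic T, F ω r ∂leb ≤ δ / 2 :=
            (mul_le_mul_of_nonneg_left hFe (by positivity)).trans he1b
          nlinarith
      refine le_trans (le_of_eq ?_) (h3.trans h4)
      simp only [mul_one, hintc, ← Finset.sum_mul]
      rfl
  calc Q _ ≤ Q B1 + Q B2 + Q B3 := by
        refine (measure_mono hsub).trans ?_
        exact (measure_union_le _ _).trans (add_le_add (measure_union_le _ _) le_rfl)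
    _ ≤ ENNReal.ofReal (q / 4) + ENNReal.ofReal (q / 4)
        + (ENNReal.ofReal (q / 4) + ENNReal.ofReal (q / 4)) := by
        gcongr
        exact hB3.trans (by gcongr)
    _ = ENNReal.ofReal q := by
        have h4 : 0 ≤ q / 4 := by positivity
        rw [← ENNReal.ofReal_add h4 h4, ← ENNReal.ofReal_add (by positivity) (by positivity)]
        congr 1
        ring

theorem incSum_const_mul (β : ℝ≥0 → Ω → ι → ℝ) (s : ℕ → ℝ≥0) (a : ℝ) (ζ : ℕ → Ω → ι → ℝ) (k : ℕ)
    (ω : Ω) : incSum β s (fun j ω i => a * ζ j ω i) k ω = a * incSum β s ζ k ω := by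
  simp only [incSum, Finset.mul_sum, mul_assoc]

theorem incVar_const_mul (s : ℕ → ℝ≥0) (a : ℝ) (ζ : ℕ → Ω → ι → ℝ) (k : ℕ) (ω : Ω) :
    incVar s (fun j ω i => a * ζ j ω i) k ω = a ^ 2 * incVar s ζ k ω := by
  simp only [incVar, mul_pow, ← Finset.mul_sum, mul_assoc]

/-- For coefficients bounded by `C`, the discrete exponential density has conditional expectation
one, and its second moment is bounded in terms of `C` only. -/
theorem lintegral_exp_neg_incSum (hβ : IsBrownianMotion ℱ Q β) {s : ℕ → ℝ≥0} (hs : Monotone s)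
    {C : ℝ} {ζ : ℕ → Ω → ι → ℝ} (hζ : ∀ k, Measurable[ℱ (s k)] (ζ k))
    (hζC : ∀ j ω i, |ζ j ω i| ≤ C) {k N : ℕ} (hkN : k ≤ N) :
    (∀ B, MeasurableSet[ℱ (s k)] B → ∫⁻ ω in B, ENNReal.ofReal (Real.exp
      (-((incSum β s ζ N ω - incSum β s ζ k ω) + (incVar s ζ N ω - incVar s ζ k ω) / 2))) ∂Q
        = Q B) ∧
    ∫⁻ ω, ENNReal.ofReal (Real.exp
      (-((incSum β s ζ N ω - incSum β s ζ k ω) + (incVar s ζ N ω - incVar s ζ k ω) / 2)) ^ 2) ∂Q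
        ≤ ENNReal.ofReal (Real.exp (Fintype.card ι * C ^ 2 * ((s N : ℝ) - s 0))) := by
  have hmul : ∀ a : ℝ, ∀ j, Measurable[ℱ (s j)] fun ω i => a * ζ j ω i := fun a j =>
    @measurable_pi_lambda _ _ _ (ℱ (s j)) _ _ fun i =>
      ((measurable_pi_apply i).comp (hζ j)).const_mul a
  -- both parts use the exponential martingale, with the coefficients `-ζ` and `-2ζ`
  constructor
  · intro B hB
    have h := lintegral_mul_exp_incSum hβ hs (hmul (-1)) hkN
      (G := B.indicator 1) (measurable_const.indicator hB)
    have hB' := ℱ.le _ B hB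
    rw [lintegral_indicator_one hB'] at h
    rw [← h, ← lintegral_indicator hB']
    refine lintegral_congr fun ω => ?_
    by_cases hω : ω ∈ B
    · simp only [indicator_of_mem hω, Pi.one_apply, one_mul, incSum_const_mul, incVar_const_mul]
      congr 2
      ring
    · simp only [indicator_of_notMem hω, zero_mul]
  · have h := lintegral_mul_exp_incSum hβ hs (hmul (-2)) hkN
      (G := fun _ => 1) measurable_const
    rw [lintegral_one, measure_univ] at h
    simp only [one_mul, incSum_const_mul, incVar_const_mul] at h
    calc _ ≤ ∫⁻ ω, ENNReal.ofReal (Real.exp (Fintype.card ι * C ^ 2 * ((s N : ℝ) - s 0)))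
          * ENNReal.ofReal (Real.exp ((-2 * incSum β s ζ N ω - -2 * incSum β s ζ k ω)
            - ((-2) ^ 2 * incVar s ζ N ω - (-2) ^ 2 * incVar s ζ k ω) / 2)) ∂Q := by
          refine lintegral_mono fun ω => ?_
          rw [← ENNReal.ofReal_mul (Real.exp_pos _).le, ← Real.exp_add, ← Real.exp_nat_mul]
          refine ENNReal.ofReal_le_ofReal (Real.exp_le_exp.2 ?_)
          have h1 := incVar_le hs (fun k i => hζC k ω i) N
          have h2 : 0 ≤ incVar s ζ k ω :=
            Finset.sum_nonneg fun j _ => sum_sq_mul_nonneg hs j ω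
          push_cast
          linarith
      _ = _ := by rw [lintegral_const_mul' _ _ ENNReal.ofReal_ne_top, h, mul_one]

theorem le_min_add_sq_div {x a : ℝ} (hx : 0 ≤ x) (ha : 0 < a) : x ≤ min x a + x ^ 2 / a := by
  rcases le_total x a with h | h
  · rw [min_eq_left h]
    linarith [show 0 ≤ x ^ 2 / a by positivity]
  · have : x ≤ x ^ 2 / a := by
      rw [le_div_iff₀ ha]
      nlinarith
    linarith [show 0 ≤ min x a from le_min hx ha.le]

/-- Conditional expectations pass to almost sure limits of densities bounded in `L²`. -/
theorem setLIntegral_eq_of_tendsto_of_sq_le {R : Ω → ℝ} {Rn : ℕ → Ω → ℝ}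
    (hm : ∀ n, Measurable (Rn n)) (hR0 : ∀ n ω, 0 ≤ Rn n ω)
    (hlim : ∀ᵐ ω ∂Q, Tendsto (fun n => Rn n ω) atTop (𝓝 (R ω))) {K : ℝ≥0∞} (hK : K ≠ ∞)
    (hsq : ∀ n, ∫⁻ ω, ENNReal.ofReal (Rn n ω ^ 2) ∂Q ≤ K) {B : Set Ω}
    (hRn : ∀ n, ∫⁻ ω in B, ENNReal.ofReal (Rn n ω) ∂Q = Q B) :
    ∫⁻ ω in B, ENNReal.ofReal (R ω) ∂Q = Q B := by
  have hlim' := ae_restrict_of_ae (s := B) hlim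
  -- the upper bound is Fatou's lemma; for the lower bound the densities are truncated at `a`, which
  -- costs at most `K / a`
  refine le_antisymm ?_ ?_
  · calc ∫⁻ ω in B, ENNReal.ofReal (R ω) ∂Q
        = ∫⁻ ω in B, liminf (fun n => ENNReal.ofReal (Rn n ω)) atTop ∂Q := by
          refine lintegral_congr_ae ?_
          filter_upwards [hlim'] with ω hω
          exact ((ENNReal.tendsto_ofReal hω).liminf_eq).symm
      _ ≤ liminf (fun n => ∫⁻ ω in B, ENNReal.ofReal (Rn n ω) ∂Q) atTop :=
          lintegral_liminf_le fun n => (hm n).ennreal_ofReal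
      _ = Q B := by simp only [hRn, liminf_const]
  · have key : ∀ a : ℝ, 0 < a →
        Q B ≤ ∫⁻ ω in B, ENNReal.ofReal (R ω) ∂Q + K / ENNReal.ofReal a := by
      intro a ha
      have h1 : Tendsto (fun n => ∫⁻ ω in B, ENNReal.ofReal (min (Rn n ω) a) ∂Q) atTop
          (𝓝 (∫⁻ ω in B, ENNReal.ofReal (min (R ω) a) ∂Q)) := by
        refine tendsto_lintegral_of_dominated_convergence (fun _ => ENNReal.ofReal a)
          (fun n => ((hm n).min measurable_const).ennreal_ofReal)
          (fun n => ae_of_all _ fun ω => ENNReal.ofReal_le_ofReal (min_le_right _ _)) ?_ ?_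
        · rw [lintegral_const]
          exact ENNReal.mul_ne_top ENNReal.ofReal_ne_top (measure_ne_top _ _)
        · filter_upwards [hlim'] with ω hω
          exact ENNReal.tendsto_ofReal (hω.min tendsto_const_nhds)
      have h2 : ∀ n, Q B ≤ ∫⁻ ω in B, ENNReal.ofReal (min (Rn n ω) a) ∂Q
          + K / ENNReal.ofReal a := by
        intro n
        rw [← hRn n]
        calc ∫⁻ ω in B, ENNReal.ofReal (Rn n ω) ∂Q
            ≤ ∫⁻ ω in B, (ENNReal.ofReal (min (Rn n ω) a)
              + ENNReal.ofReal (Rn n ω ^ 2) / ENNReal.ofReal a) ∂Q := by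
              refine lintegral_mono fun ω => ?_
              rw [← ENNReal.ofReal_div_of_pos ha, ← ENNReal.ofReal_add
                (le_min (hR0 n ω) ha.le) (by positivity)]
              exact ENNReal.ofReal_le_ofReal (le_min_add_sq_div (hR0 n ω) ha)
          _ ≤ _ := by
              rw [lintegral_add_left ((hm n).min measurable_const).ennreal_ofReal]
              gcongr
              simp only [div_eq_mul_inv]
              rw [lintegral_mul_const _ ((hm n).pow_const 2).ennreal_ofReal]
              gcongr
              exact (setLIntegral_le_lintegral _ _).trans (hsq n)
      refine (ge_of_tendsto' (h1.add_const _) h2).trans ?_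
      gcongr
      exact min_le_left _ _
    have h3 : Tendsto (fun a : ℝ => ∫⁻ ω in B, ENNReal.ofReal (R ω) ∂Q + K / ENNReal.ofReal a) atTop
        (𝓝 (∫⁻ ω in B, ENNReal.ofReal (R ω) ∂Q + K / ∞)) :=
      tendsto_const_nhds.add
        (ENNReal.Tendsto.const_div ENNReal.tendsto_ofReal_atTop (Or.inr hK))
    rw [ENNReal.div_top, add_zero] at h3
    exact ge_of_tendsto h3 ((eventually_gt_atTop 0).mono key)

/-- The exponential `exp(-(J_T - J_t) - (1/2) ∫_t^T |H|² ds)` of the Itô integral `J` of a bounded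
integrand `H` has conditional expectation one given `ℱ_t`. It is a limit of discrete exponential
densities that are bounded in `L²`. -/
theorem aemeasurable_and_setLIntegral_exp (hβ : IsBrownianMotion ℱ Q β) {T : ℝ≥0} {C : ℝ}
    (hC : 0 ≤ C) {H : ℝ≥0 → Ω → ι → ℝ} {J : ℝ≥0 → Ω → ℝ} (hHC : ∀ r ω i, |H r ω i| ≤ C)
    (hJ : IsItoIntegral ℱ Q T β H J) {t : ℝ≥0} (ht : t ≤ T) :
    AEMeasurable (fun ω => Real.exp (-((J T ω - J t ω) + (∫ r in Iic T, ∑ i, H r ω i ^ 2 ∂leb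
      - ∫ r in Iic t, ∑ i, H r ω i ^ 2 ∂leb) / 2))) Q ∧
    ∀ B, MeasurableSet[ℱ t] B → ∫⁻ ω in B, ENNReal.ofReal (Real.exp (-((J T ω - J t ω)
      + (∫ r in Iic T, ∑ i, H r ω i ^ 2 ∂leb - ∫ r in Iic t, ∑ i, H r ω i ^ 2 ∂leb) / 2))) ∂Q
        = Q B := by
  have hq : ∀ n : ℕ, (0 : ℝ) < (1 / 2) ^ n := fun n => by positivity
  choose s k N ζ hs h0 hkN hk hN hζ hζC hζJ using fun n : ℕ =>
    exists_bounded_approximation hβ hC hHC hJ ht (δ := 1 / ((n : ℝ) + 1)) (by positivity) (hq n)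
  let L : ℕ → Ω → ℝ := fun n ω => (incSum β (s n) (ζ n) (N n) ω - incSum β (s n) (ζ n) (k n) ω)
    + (incVar (s n) (ζ n) (N n) ω - incVar (s n) (ζ n) (k n) ω) / 2
  have hLm : ∀ n, Measurable (L n) := fun n => by
    have h1 : ∀ j, Measurable (incSum β (s n) (ζ n) j) := fun j =>
      (measurable_incSum hβ (hs n) (hζ n) j).mono (ℱ.le _) le_rfl
    have h2 : ∀ j, Measurable (incVar (s n) (ζ n) j) := fun j =>
      (measurable_incVar (hs n) (hζ n) j).mono (ℱ.le _) le_rfl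
    exact ((h1 _).sub (h1 _)).add (((h2 _).sub (h2 _)).div_const 2)
  have hlim : ∀ᵐ ω ∂Q, Tendsto (fun n => Real.exp (-L n ω)) atTop (𝓝 (Real.exp (-((J T ω - J t ω)
      + (∫ r in Iic T, ∑ i, H r ω i ^ 2 ∂leb - ∫ r in Iic t, ∑ i, H r ω i ^ 2 ∂leb) / 2)))) := by
    -- errors with summable probabilities: Borel–Cantelli
    have hsum : ∑' n, Q {ω | ¬ ∀ j ≤ N n, |incSum β (s n) (ζ n) j ω - J (s n j) ω|
        ≤ 1 / ((n : ℝ) + 1) ∧ |incVar (s n) (ζ n) j ω - ∫ r in Iic (s n j), ∑ i, H r ω i ^ 2 ∂leb|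
          ≤ 1 / ((n : ℝ) + 1)} ≠ ∞ := by
      refine ne_top_of_le_ne_top ?_ (ENNReal.tsum_le_tsum hζJ)
      rw [← ENNReal.ofReal_tsum_of_nonneg (fun n => (hq n).le) summable_geometric_two]
      exact ENNReal.ofReal_ne_top
    filter_upwards [ae_eventually_notMem hsum] with ω hω
    refine (Real.continuous_exp.tendsto _).comp (Tendsto.neg ?_)
    rw [tendsto_iff_dist_tendsto_zero]
    have h3 : Tendsto (fun n : ℕ => 3 * (1 / ((n : ℝ) + 1))) atTop (𝓝 0) := by
      simpa using tendsto_one_div_add_atTop_nhds_zero_nat.const_mul (3 : ℝ)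
    refine squeeze_zero' (Eventually.of_forall fun _ => dist_nonneg) ?_ h3
    filter_upwards [hω] with n hn
    have hn := not_not.1 hn
    obtain ⟨a1, a2⟩ := hn (N n) le_rfl
    obtain ⟨b1, b2⟩ := hn (k n) (hkN n)
    rw [hN n] at a1 a2
    rw [hk n] at b1 b2
    rw [Real.dist_eq]
    rw [abs_le] at a1 a2 b1 b2 ⊢
    simp only [L]
    constructor <;> linarith [a1.1, a1.2, a2.1, a2.2, b1.1, b1.2, b2.1, b2.2]
  refine ⟨aemeasurable_of_tendsto_metrizable_ae' (fun n => ((hLm n).neg.exp).aemeasurable) hlim,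
    fun B hB => ?_⟩
  refine setLIntegral_eq_of_tendsto_of_sq_le (fun n => (hLm n).neg.exp)
    (fun n ω => (Real.exp_pos _).le) hlim
    (K := ENNReal.ofReal (Real.exp (Fintype.card ι * C ^ 2 * T))) ENNReal.ofReal_ne_top
    (fun n => ?_) fun n => ?_
  · have h := (lintegral_exp_neg_incSum hβ (hs n) (hζ n) (hζC n) (hkN n)).2
    rwa [hN n, h0 n, NNReal.coe_zero, sub_zero] at h
  · refine (lintegral_exp_neg_incSum hβ (hs n) (hζ n) (hζC n) (hkN n)).1 B ?_
    rwa [hk n]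

/-- A version of the Itô integral vanishes at time zero, since the elementary integrals do. -/
theorem IsItoIntegral.ae_eq_zero {T : ℝ≥0} {H : ℝ≥0 → Ω → ι → ℝ} {J : ℝ≥0 → Ω → ℝ}
    (hJ : IsItoIntegral ℱ Q T β H J) : ∀ᵐ ω ∂Q, J 0 ω = 0 := by
  obtain ⟨S, -, hS⟩ := hJ.approx
  have h1 : ∀ n : ℕ, Q {ω | 1 / ((n : ℝ) + 1) ≤ |J 0 ω|} = 0 := fun n => by
    refine le_antisymm (ge_of_tendsto' (hS (1 / ((n : ℝ) + 1)) (by positivity))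
      fun l => measure_mono fun ω hω => ⟨0, zero_le, ?_⟩) zero_le
    have : (S l).integral β 0 ω = 0 := by simp [SimpleIntegrand.integral]
    rw [this, zero_sub, abs_neg]
    exact hω
  have h2 : ∀ᵐ ω ∂Q, ∀ n : ℕ, ¬ 1 / ((n : ℝ) + 1) ≤ |J 0 ω| :=
    ae_all_iff.2 fun n => by simpa [ae_iff] using h1 n
  filter_upwards [h2] with ω hω
  by_contra h
  obtain ⟨n, hn⟩ := exists_nat_one_div_lt (abs_pos.2 h)
  exact hω n hn.le

end Density

/-! ### The Kallianpur–Striebel formula -/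

section Bayes

variable {Ω : Type*} {𝒴 𝒢 mΩ : MeasurableSpace Ω}

/-- Bayes' formula. If `g ↦ ∫ g w dP` agrees with `g ↦ ∫ g dQ` on the `𝒢`-measurable functions, then
conditional expectations under `P` and `Q` given a smaller `σ`-algebra `𝒴` are related by the
conditional weight `P[w | 𝒴]`. -/
theorem condExp_mul_weight (h𝒴 : 𝒴 ≤ 𝒢) (h𝒢 : 𝒢 ≤ mΩ) {Q P : Measure Ω} [IsFiniteMeasure Q]
    [IsFiniteMeasure P] {w : Ω → ℝ}
    (hw : ∀ g : Ω → ℝ, StronglyMeasurable[𝒢] g → Integrable g Q →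
      Integrable (g * w) P ∧ ∫ ω, (g * w) ω ∂P = ∫ ω, g ω ∂Q)
    {f : Ω → ℝ} (hf : StronglyMeasurable[𝒢] f) (hfi : Integrable f Q) :
    P[f * w | 𝒴] =ᵐ[P] Q[f | 𝒴] * P[w | 𝒴] := by
  have hm := h𝒴.trans h𝒢
  have hset : ∀ g : Ω → ℝ, StronglyMeasurable[𝒢] g → Integrable g Q → ∀ s, MeasurableSet[𝒴] s →
      ∫ ω in s, (g * w) ω ∂P = ∫ ω in s, g ω ∂Q := by
    intro g hg hgi s hs
    have h1 := (hw (s.indicator g) (hg.indicator (h𝒴 s hs)) (hgi.indicator (hm s hs))).2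
    have h2 : s.indicator g * w = s.indicator (g * w) := by
      ext ω
      by_cases hω : ω ∈ s <;> simp [hω]
    rwa [h2, integral_indicator (hm s hs), integral_indicator (hm s hs)] at h1
  have hpm : StronglyMeasurable[𝒴] Q[f | 𝒴] := stronglyMeasurable_condExp
  have hpw := (hw _ (hpm.mono h𝒴) integrable_condExp).1
  have hwi : Integrable w P := by
    have h1 : (fun _ : Ω => (1 : ℝ)) * w = w := one_mul w
    have h2 := (hw (fun _ => 1) stronglyMeasurable_const (integrable_const 1)).1
    rwa [h1] at h2
  refine EventuallyEq.trans (EventuallyEq.symm ?_)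
    (condExp_mul_of_stronglyMeasurable_left hpm hpw hwi)
  refine ae_eq_condExp_of_forall_setIntegral_eq hm (hw f hf hfi).1
    (fun s _ _ => integrable_condExp.integrableOn) (fun s hs _ => ?_)
    stronglyMeasurable_condExp.aestronglyMeasurable
  rw [setIntegral_condExp hm hpw hs, hset _ (hpm.mono h𝒴) integrable_condExp s hs,
    setIntegral_condExp hm hfi hs, hset f hf hfi s hs]

/-- A density that gives all `𝒢`-measurable events their `Q`-probability does not change the
integrals of `𝒢`-measurable functions. -/
theorem integrable_mul_density (h𝒢 : 𝒢 ≤ mΩ) {Q : Measure Ω} [IsFiniteMeasure Q] {R : Ω → ℝ}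
    (hR : AEMeasurable R Q) (hR0 : ∀ ω, 0 ≤ R ω)
    (h : ∀ B, MeasurableSet[𝒢] B → ∫⁻ ω in B, ENNReal.ofReal (R ω) ∂Q = Q B) {g : Ω → ℝ}
    (hg : StronglyMeasurable[𝒢] g) (hgi : Integrable g Q) :
    Integrable (fun ω => R ω * g ω) Q ∧ ∫ ω, R ω * g ω ∂Q = ∫ ω, g ω ∂Q := by
  have htrim : (Q.withDensity fun ω => ENNReal.ofReal (R ω)).trim h𝒢 = Q.trim h𝒢 := by
    refine @Measure.ext _ 𝒢 _ _ fun B hB => ?_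
    rw [trim_measurableSet_eq h𝒢 hB, trim_measurableSet_eq h𝒢 hB, withDensity_apply _ (h𝒢 B hB),
      h B hB]
  have h1 : Integrable g (Q.withDensity fun ω => ENNReal.ofReal (R ω)) := by
    refine integrable_of_integrable_trim h𝒢 ?_
    rw [htrim]
    exact hgi.trim h𝒢 hg
  have h2 : ∫ ω, g ω ∂(Q.withDensity fun ω => ENNReal.ofReal (R ω)) = ∫ ω, g ω ∂Q := by
    rw [integral_trim h𝒢 hg, htrim, ← integral_trim h𝒢 hg]
  have hlt : ∀ᵐ ω ∂Q, ENNReal.ofReal (R ω) < ∞ := ae_of_all _ fun _ => ENNReal.ofReal_lt_top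
  rw [integrable_withDensity_iff_integrable_smul₀' hR.ennreal_ofReal hlt] at h1
  rw [integral_withDensity_eq_integral_toReal_smul₀ hR.ennreal_ofReal hlt] at h2
  simp only [ENNReal.toReal_ofReal (hR0 _), smul_eq_mul] at h1 h2
  exact ⟨h1, h2⟩

end Bayes

section Filter

namespace Coefficients

variable {m n d w v u : ℕ} {c : Coefficients m n d w v u}
  {Ω : Type*} {mΩ : MeasurableSpace Ω} {ℱ : Filtration ℝ≥0 mΩ} {Q : Measure Ω}
  [IsProbabilityMeasure Q] {T : ℝ≥0}
  {W : ℝ≥0 → Ω → Fin w → ℝ} {V : ℝ≥0 → Ω → Fin v → ℝ} {U : ℝ≥0 → Ω → Fin u → ℝ}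
  {X : ℝ≥0 → Ω → EuclideanSpace ℝ (Fin m)} {Z : ℝ≥0 → Ω → EuclideanSpace ℝ (Fin n)}

/-- The observation `σ`-algebra is contained in the completion of `ℱ_t`. -/
theorem observationAlgebra_le
    (hBM : IsBrownianMotion ℱ Q fun t ω => Sum.elim (W t ω) (Sum.elim (V t ω) (U t ω)))
    (hη : IsStronglyProgressive ℱ (c.sensor X Z)) (t : ℝ≥0) :
    c.observationAlgebra Q W U X Z t ≤ eventuallyMeasurableSpace (ℱ t) (ae Q) ⊓ mΩ := by
  have hℱ : ∀ s ≤ t, ℱ s ≤ eventuallyMeasurableSpace (ℱ t) (ae Q) ⊓ mΩ := fun s hs =>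
    (ℱ.mono hs).trans (le_inf (le_eventuallyMeasurableSpace) (ℱ.le t))
  refine sup_le (iSup_le fun s => ?_) (MeasurableSpace.generateFrom_le fun A hA => ?_)
  · refine le_trans (Measurable.comap_le ?_) (hℱ s s.2)
    exact measurable_driftedPath (c.isBrownianMotion_obsNoise hBM) hη s
  · exact MeasurableSpace.measurableSet_inf.2
      ⟨⟨∅, @MeasurableSet.empty _ (ℱ t), ae_eq_empty.2 hA.2⟩, hA.1⟩

/-- The weight `D_T / D_t` is the exponential density over `(t, T]`. -/
theorem girsanovDensity_mul_inv (J : ℝ≥0 → Ω → ℝ) (t : ℝ≥0) (ω : Ω) :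
    c.girsanovDensity X Z J T ω * (c.girsanovDensity X Z J t ω)⁻¹
      = Real.exp (-((J T ω - J t ω) + (∫ r in Iic T, ∑ k, c.sensor X Z r ω k ^ 2 ∂leb
        - ∫ r in Iic t, ∑ k, c.sensor X Z r ω k ^ 2 ∂leb) / 2)) := by
  rw [girsanovDensity, girsanovDensity, ← Real.exp_neg, ← Real.exp_add]
  congr 1
  ring

/-- The Kallianpur–Striebel formula `ρ_t(φ) = π_t(φ) ρ_t(1)`. -/
theorem IsUnnormalizedFilter.ae_eq_mul
    {ρ : Ω → C(ℝ≥0, FiniteMeasure (EuclideanSpace ℝ (Fin m) × EuclideanSpace ℝ (Fin n)))}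
    {π : Ω → C(ℝ≥0, ProbabilityMeasure (EuclideanSpace ℝ (Fin m) × EuclideanSpace ℝ (Fin n)))}
    (hρ : c.IsUnnormalizedFilter ℱ Q T W U X Z ρ) (hπ : c.IsFilter Q T W U X Z π)
    (hBM : IsBrownianMotion ℱ Q fun t ω => Sum.elim (W t ω) (Sum.elim (V t ω) (U t ω)))
    (hX : Adapted ℱ X) (hZ : Adapted ℱ Z) {C : ℝ} (hC : 0 ≤ C)
    (hη : IsStronglyProgressive ℱ (c.sensor X Z))
    (hηC : ∀ r ω i, |c.sensor X Z r ω i| ≤ C) {t : ℝ≥0} (ht : t ≤ T)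
    {φ : EuclideanSpace ℝ (Fin m) × EuclideanSpace ℝ (Fin n) → ℝ} (hφ : IsC2b φ) :
    ∀ᵐ ω ∂Q, ∫ p, φ p ∂(ρ ω t).toMeasure
      = (∫ p, φ p ∂(π ω t).toMeasure) * ∫ _, (1 : ℝ) ∂(ρ ω t).toMeasure := by
  obtain ⟨J, hJ, hρ⟩ := hρ
  have hβ := c.isBrownianMotion_obsNoise hBM
  set D := c.girsanovDensity X Z J with hD
  have hexp := fun t ht => aemeasurable_and_setLIntegral_exp hβ hC hηC hJ (t := t) ht
  simp only [← girsanovDensity_mul_inv] at hexp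
  -- the density on `[0, T]` is the one on `(0, T]`, as the integral starts at zero
  have hD0 : ∀ᵐ ω ∂Q, D T ω * (D 0 ω)⁻¹ = D T ω := by
    filter_upwards [hJ.ae_eq_zero] with ω hω
    have h0 : leb.restrict (Iic (0 : ℝ≥0)) = 0 := by
      rw [Measure.restrict_eq_zero, leb_Iic]
      simp
    have : D 0 ω = 1 := by
      rw [hD, girsanovDensity, hω, h0]
      simp
    rw [this, inv_one, mul_one]
  have hDm : AEMeasurable (D T) Q := (hexp 0 zero_le).1.congr hD0
  set P := Q.withDensity fun ω => ENNReal.ofReal (D T ω) with hP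
  have hPfin : IsFiniteMeasure P := by
    refine isFiniteMeasure_withDensity ?_
    have h1 := (hexp 0 zero_le).2 univ MeasurableSet.univ
    rw [setLIntegral_univ] at h1
    rw [← lintegral_congr_ae (hD0.mono fun ω hω => congrArg ENNReal.ofReal hω), h1]
    exact measure_ne_top _ _
  -- the density is positive, so statements that hold `P`-almost surely hold `Q`-almost surely
  have hQP : Q ≪ P := withDensity_absolutelyContinuous' hDm.ennreal_ofReal
    (ae_of_all _ fun ω => (ENNReal.ofReal_pos.2 (Real.exp_pos _)).ne')
  have hDpos : ∀ t ω, 0 < D t ω := fun t ω => Real.exp_pos _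
  have hPint : ∀ g : Ω → ℝ, (Integrable (g * fun ω => (D t ω)⁻¹) P
        ↔ Integrable (fun ω => D T ω * (D t ω)⁻¹ * g ω) Q)
      ∧ ∫ ω, (g * fun ω => (D t ω)⁻¹) ω ∂P = ∫ ω, D T ω * (D t ω)⁻¹ * g ω ∂Q := by
    intro g
    have hlt : ∀ᵐ ω ∂Q, ENNReal.ofReal (D T ω) < ∞ := ae_of_all _ fun _ => ENNReal.ofReal_lt_top
    have heq : (fun ω => (ENNReal.ofReal (D T ω)).toReal • (g * fun ω => (D t ω)⁻¹) ω)
        = fun ω => D T ω * (D t ω)⁻¹ * g ω := by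
      ext ω
      rw [ENNReal.toReal_ofReal (hDpos T ω).le, smul_eq_mul, Pi.mul_apply]
      ring
    rw [hP, integrable_withDensity_iff_integrable_smul₀' hDm.ennreal_ofReal hlt,
      integral_withDensity_eq_integral_toReal_smul₀ hDm.ennreal_ofReal hlt, heq]
    exact ⟨Iff.rfl, rfl⟩
  set 𝒢 := eventuallyMeasurableSpace (ℱ t) (ae Q) ⊓ mΩ with h𝒢def
  have h𝒢 : 𝒢 ≤ mΩ := inf_le_right
  have hR : ∀ B, MeasurableSet[𝒢] B →
      ∫⁻ ω in B, ENNReal.ofReal (D T ω * (D t ω)⁻¹) ∂Q = Q B := by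
    intro B hB
    obtain ⟨B', hB', hBB'⟩ := (MeasurableSpace.measurableSet_inf.1 hB).1
    rw [setLIntegral_congr hBB', measure_congr hBB']
    exact (hexp t ht).2 B' hB'
  have hw : ∀ g : Ω → ℝ, StronglyMeasurable[𝒢] g → Integrable g Q →
      Integrable (g * fun ω => (D t ω)⁻¹) P
        ∧ ∫ ω, (g * fun ω => (D t ω)⁻¹) ω ∂P = ∫ ω, g ω ∂Q := by
    intro g hg hgi
    obtain ⟨h1, h2⟩ := integrable_mul_density h𝒢 (hexp t ht).1
      (fun ω => (mul_pos (hDpos T ω) (inv_pos.2 (hDpos t ω))).le) hR hg hgi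
    exact ⟨(hPint g).1.2 h1, (hPint g).2.trans h2⟩
  obtain ⟨Cφ, hCφ⟩ := hφ.2
  have hf : Measurable[ℱ t] fun ω => φ (X t ω, Z t ω) :=
    hφ.1.continuous.measurable.comp ((hX t).prodMk (hZ t))
  have hfi : Integrable (fun ω => φ (X t ω, Z t ω)) Q :=
    Integrable.of_bound (hf.mono (ℱ.le t) le_rfl).aestronglyMeasurable Cφ
      (ae_of_all _ fun ω => by simpa using hCφ 0 (by norm_num) (X t ω, Z t ω))
  have hf𝒢 : StronglyMeasurable[𝒢] fun ω => φ (X t ω, Z t ω) :=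
    (hf.mono (le_inf (le_eventuallyMeasurableSpace) (ℱ.le t))
      le_rfl).stronglyMeasurable
  have hbayes := hQP.ae_le (condExp_mul_weight (observationAlgebra_le hBM hη t) h𝒢 hw hf𝒢 hfi)
  have h1 := hρ t ht 1 isC2b_one
  simp only [Pi.one_apply, one_mul] at h1
  filter_upwards [hbayes, hρ t ht φ hφ, h1, hπ t ht φ hφ] with ω h2 h3 h4 h5
  rw [h3, h5, h4]
  exact h2

end Coefficients

end Filter

/-! ### Trigonometric test functions -/

/-- A linear change of variables in a function of one real variable with bounded derivatives gives a
function in `C²_b`. -/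
theorem isC2b_comp_continuousLinearMap {V : Type*} [NormedAddCommGroup V] [NormedSpace ℝ V]
    {g : ℝ → ℝ} (hg : ContDiff ℝ 2 g) (hg1 : ∀ k x, |iteratedDeriv k g x| ≤ 1) (L : V →L[ℝ] ℝ) :
    IsC2b (g ∘ L) := by
  refine ⟨hg.comp L.contDiff, max 1 ‖L‖ ^ 2, fun k hk p => ?_⟩
  rw [L.iteratedFDeriv_comp_right hg p (by exact_mod_cast hk)]
  refine (ContinuousMultilinearMap.norm_compContinuousLinearMap_le _ _).trans ?_
  rw [norm_iteratedFDeriv_eq_norm_iteratedDeriv, Finset.prod_const, Finset.card_univ,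
    Fintype.card_fin, Real.norm_eq_abs]
  calc |iteratedDeriv k g (L p)| * ‖L‖ ^ k ≤ 1 * max 1 ‖L‖ ^ k := by
        gcongr
        · exact hg1 k _
        · exact le_max_right _ _
    _ ≤ max 1 ‖L‖ ^ 2 := by
        rw [one_mul]
        exact pow_le_pow_right₀ (le_max_left _ _) hk

section Trigonometric

variable {E : Type*} [NormedAddCommGroup E] [InnerProductSpace ℝ E]

/-- The bounded continuous function `x ↦ cos ⟨x, ξ⟩`. -/
def cosWave (ξ : E) : E →ᵇ ℝ :=
  BoundedContinuousFunction.ofNormedAddCommGroup (fun x => Real.cos (inner ℝ x ξ)) (by fun_prop) 1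
    fun _ => Real.abs_cos_le_one _

/-- The bounded continuous function `x ↦ sin ⟨x, ξ⟩`. -/
def sinWave (ξ : E) : E →ᵇ ℝ :=
  BoundedContinuousFunction.ofNormedAddCommGroup (fun x => Real.sin (inner ℝ x ξ)) (by fun_prop) 1
    fun _ => Real.abs_sin_le_one _

theorem cosWave_apply (ξ x : E) : cosWave ξ x = Real.cos (inner ℝ x ξ) := rfl

theorem sinWave_apply (ξ x : E) : sinWave ξ x = Real.sin (inner ℝ x ξ) := rfl

variable {F : Type*} [NormedAddCommGroup F] [NormedSpace ℝ F]

theorem isC2b_cosWave_fst (ξ : E) : IsC2b fun p : E × F => cosWave ξ p.1 := by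
  have := isC2b_comp_continuousLinearMap Real.contDiff_cos Real.abs_iteratedDeriv_cos_le_one
    ((innerSL ℝ ξ).comp (ContinuousLinearMap.fst ℝ E F))
  convert this using 2 with p
  simp [cosWave_apply, real_inner_comm]

theorem isC2b_sinWave_fst (ξ : E) : IsC2b fun p : E × F => sinWave ξ p.1 := by
  have := isC2b_comp_continuousLinearMap Real.contDiff_sin Real.abs_iteratedDeriv_sin_le_one
    ((innerSL ℝ ξ).comp (ContinuousLinearMap.fst ℝ E F))
  convert this using 2 with p
  simp [sinWave_apply, real_inner_comm]

variable [MeasurableSpace E] [BorelSpace E] [SecondCountableTopology E]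

theorem charFun_eq_integral_cosWave (ν : Measure E) [IsFiniteMeasure ν] (ξ : E) :
    charFun ν ξ = (∫ x, cosWave ξ x ∂ν : ℝ) + (∫ x, sinWave ξ x ∂ν : ℝ) * Complex.I := by
  have h : ∀ x : E, Complex.exp (inner ℝ x ξ * Complex.I)
      = (cosWave ξ x : ℂ) + (sinWave ξ x : ℂ) * Complex.I := fun x => by
    rw [Complex.exp_mul_I, cosWave_apply, sinWave_apply, Complex.ofReal_cos, Complex.ofReal_sin]
  rw [charFun_apply, ← integral_complex_ofReal, ← integral_complex_ofReal]
  simp only [h]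
  rw [integral_add ((cosWave ξ).integrable ν).ofReal
    (((sinWave ξ).integrable ν).ofReal.mul_const _), integral_mul_const]

/-- A finite measure is determined by the integrals of `cos ⟨x, ξ⟩` and `sin ⟨x, ξ⟩` for `ξ` in a
dense set. -/
theorem eq_of_integral_cosWave_eq [CompleteSpace E] {ν ν' : Measure E} [IsFiniteMeasure ν]
    [IsFiniteMeasure ν'] {ι : Type*} {ξ : ι → E} (hξ : DenseRange ξ)
    (hcos : ∀ i, ∫ x, cosWave (ξ i) x ∂ν = ∫ x, cosWave (ξ i) x ∂ν')
    (hsin : ∀ i, ∫ x, sinWave (ξ i) x ∂ν = ∫ x, sinWave (ξ i) x ∂ν') : ν = ν' := by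
  refine Measure.ext_of_charFun (hξ.equalizer continuous_charFun continuous_charFun ?_)
  ext i
  simp only [Function.comp_apply, charFun_eq_integral_cosWave, hcos, hsin]

end Trigonometric

/-! ### The filter as a normalized path -/

theorem integral_marginalPath {K 𝕏 𝕐 : Type*} [TopologicalSpace K] [TopologicalSpace 𝕏]
    [MeasurableSpace 𝕏] [TopologicalSpace 𝕐] [MeasurableSpace 𝕐] [BorelSpace 𝕏]
    [OpensMeasurableSpace (𝕏 × 𝕐)] (μ : C(K, FiniteMeasure (𝕏 × 𝕐))) (t : K) (φ : 𝕏 →ᵇ ℝ) :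
    ∫ x, φ x ∂(marginalPath μ t : Measure 𝕏) = ∫ p, φ p.1 ∂(μ t : Measure (𝕏 × 𝕐)) := by
  have hfst : Measurable (Prod.fst : 𝕏 × 𝕐 → 𝕏) := continuous_fst.measurable
  change ∫ x, φ x ∂((μ t).map Prod.fst : Measure 𝕏) = _
  rw [FiniteMeasure.toMeasure_map, integral_map hfst.aemeasurable
    φ.continuous.measurable.aestronglyMeasurable]

theorem marginalPath_ne_zero {K 𝕏 𝕐 : Type*} [TopologicalSpace K] [TopologicalSpace 𝕏]
    [MeasurableSpace 𝕏] [TopologicalSpace 𝕐] [MeasurableSpace 𝕐] [BorelSpace 𝕏]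
    [OpensMeasurableSpace (𝕏 × 𝕐)] (μ : C(K, FiniteMeasure (𝕏 × 𝕐))) (t : K) (h : μ t ≠ 0) :
    marginalPath μ t ≠ 0 := by
  intro h0
  have h1 := integral_marginalPath μ t 1
  rw [h0] at h1
  have h2 := integral_one_pos h
  simp only [BoundedContinuousFunction.coe_one, Pi.one_apply] at h1
  rw [← h1] at h2
  simp at h2

namespace Coefficients

variable {m n d w v u : ℕ} {c : Coefficients m n d w v u}
  {Ω : Type*} {mΩ : MeasurableSpace Ω} {ℱ : Filtration ℝ≥0 mΩ} {Q : Measure Ω}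
  [IsProbabilityMeasure Q] {T : ℝ≥0}
  {W : ℝ≥0 → Ω → Fin w → ℝ} {V : ℝ≥0 → Ω → Fin v → ℝ} {U : ℝ≥0 → Ω → Fin u → ℝ}
  {X : ℝ≥0 → Ω → EuclideanSpace ℝ (Fin m)} {Z : ℝ≥0 → Ω → EuclideanSpace ℝ (Fin n)}
  {ρ : Ω → C(ℝ≥0, FiniteMeasure (EuclideanSpace ℝ (Fin m) × EuclideanSpace ℝ (Fin n)))}
  {π : Ω → C(ℝ≥0, ProbabilityMeasure (EuclideanSpace ℝ (Fin m) × EuclideanSpace ℝ (Fin n)))}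

/-- The Kallianpur–Striebel formula at all times simultaneously, for a test function of the slow
variable: both sides are continuous in time, so a countable dense set of times suffices. -/
theorem IsUnnormalizedFilter.ae_forall_eq_mul
    (hρ : c.IsUnnormalizedFilter ℱ Q T W U X Z ρ) (hπ : c.IsFilter Q T W U X Z π)
    (hBM : IsBrownianMotion ℱ Q fun t ω => Sum.elim (W t ω) (Sum.elim (V t ω) (U t ω)))
    (hX : Adapted ℱ X) (hZ : Adapted ℱ Z) {C : ℝ} (hC : 0 ≤ C)
    (hη : IsStronglyProgressive ℱ (c.sensor X Z))
    (hηC : ∀ r ω i, |c.sensor X Z r ω i| ≤ C) {φ : EuclideanSpace ℝ (Fin m) →ᵇ ℝ}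
    (hφ : IsC2b fun p : EuclideanSpace ℝ (Fin m) × EuclideanSpace ℝ (Fin n) => φ p.1) :
    ∀ᵐ ω ∂Q, ∀ t : Icc 0 T,
      ∫ x, φ x ∂(restrictPath T (marginalPath (ρ ω)) t).toMeasure
        = (∫ x, φ x ∂(restrictPath T (marginalPath (toFinitePath (π ω))) t).toMeasure)
          * ∫ _, (1 : ℝ) ∂(restrictPath T (marginalPath (ρ ω)) t).toMeasure := by
  have : Nonempty (Icc 0 T) := ⟨⟨0, le_rfl, zero_le⟩⟩
  have h := ae_all_iff.2 fun i => hρ.ae_eq_mul hπ hBM hX hZ hC hη hηC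
    (TopologicalSpace.denseSeq (Icc 0 T) i).2.2 hφ
  filter_upwards [h] with ω hω
  have hcont : ∀ (κ : C(Icc 0 T, FiniteMeasure (EuclideanSpace ℝ (Fin m))))
      (ψ : EuclideanSpace ℝ (Fin m) →ᵇ ℝ), Continuous fun t => ∫ x, ψ x ∂(κ t).toMeasure :=
    fun κ ψ => (FiniteMeasure.continuous_integral_boundedContinuousFunction ψ).comp κ.continuous
  refine congrFun ((TopologicalSpace.denseRange_denseSeq (Icc 0 T)).equalizer (hcont _ φ)
    ((hcont _ φ).mul (hcont _ 1)) (funext fun i => ?_))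
  have h1 : ∀ (κ : C(ℝ≥0, FiniteMeasure (EuclideanSpace ℝ (Fin m) × EuclideanSpace ℝ (Fin n))))
      (t : Icc 0 T) (ψ : EuclideanSpace ℝ (Fin m) →ᵇ ℝ),
      ∫ x, ψ x ∂(restrictPath T (marginalPath κ) t).toMeasure = ∫ p, ψ p.1 ∂(κ t).toMeasure :=
    fun κ t ψ => integral_marginalPath κ t ψ
  simp only [Function.comp_apply, h1]
  exact (hω i).trans (congrArg _ (h1 _ _ 1).symm)

/-- Normalizing the marginals of the unnormalized filter gives the marginals of the filter. -/
theorem IsUnnormalizedFilter.ae_eq_normalizedPath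
    (hρ : c.IsUnnormalizedFilter ℱ Q T W U X Z ρ) (hπ : c.IsFilter Q T W U X Z π)
    (hBM : IsBrownianMotion ℱ Q fun t ω => Sum.elim (W t ω) (Sum.elim (V t ω) (U t ω)))
    (hX : Adapted ℱ X) (hZ : Adapted ℱ Z) {C : ℝ} (hC : 0 ≤ C)
    (hη : IsStronglyProgressive ℱ (c.sensor X Z))
    (hηC : ∀ r ω i, |c.sensor X Z r ω i| ≤ C)
    (hρ0 : ∀ᵐ ω ∂Q, ∀ t, restrictPath T (marginalPath (ρ ω)) t ≠ 0) :
    ∀ᵐ ω ∂Q, toFinitePath (normalizedPath (restrictPath T (marginalPath (ρ ω))))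
      = restrictPath T (marginalPath (toFinitePath (π ω))) := by
  set ξ := TopologicalSpace.denseSeq (EuclideanSpace ℝ (Fin m))
  have hcos := ae_all_iff.2 fun i => hρ.ae_forall_eq_mul hπ hBM hX hZ hC hη hηC
    (isC2b_cosWave_fst (F := EuclideanSpace ℝ (Fin n)) (ξ i))
  have hsin := ae_all_iff.2 fun i => hρ.ae_forall_eq_mul hπ hBM hX hZ hC hη hηC
    (isC2b_sinWave_fst (F := EuclideanSpace ℝ (Fin n)) (ξ i))
  filter_upwards [hcos, hsin, hρ0] with ω h1 h2 h3
  refine ContinuousMap.ext fun t => FiniteMeasure.toMeasure_injective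
    (eq_of_integral_cosWave_eq (TopologicalSpace.denseRange_denseSeq _) (fun i => ?_) fun i => ?_)
  · rw [integral_toFinitePath_normalizedPath h3, h1 i t,
      mul_div_cancel_right₀ _ (integral_one_pos (h3 t)).ne']
  · rw [integral_toFinitePath_normalizedPath h3, h2 i t,
      mul_div_cancel_right₀ _ (integral_one_pos (h3 t)).ne']

end Coefficients

end

end MultiscaleFilter

theorem mainTheorem6 {m n d w v u : ℕ} (c : Coefficients m n d w v u) (T : ℝ≥0)
    {Ω : Type*} {mΩ : MeasurableSpace Ω} (Q : Measure Ω) [IsProbabilityMeasure Q]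
    (ℱ : Filtration ℝ≥0 mΩ)
    -- the driving Brownian motion `(W, V, U)`
    (W : ℝ≥0 → Ω → Fin w → ℝ) (V : ℝ≥0 → Ω → Fin v → ℝ) (U : ℝ≥0 → Ω → Fin u → ℝ)
    (hBM : IsBrownianMotion ℱ Q fun t ω => Sum.elim (W t ω) (Sum.elim (V t ω) (U t ω)))
    -- the signal processes
    (X : Ioo (0 : ℝ) 1 → ℝ≥0 → Ω → EuclideanSpace ℝ (Fin m))
    (Z : Ioo (0 : ℝ) 1 → ℝ≥0 → Ω → EuclideanSpace ℝ (Fin n))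
    (hXZ : ∀ ε, c.IsSignal ℱ Q T W V (X ε) (Z ε) ε)
    -- the stationary distributions of the fast process and the corrector `𝒢_F⁻¹(-b_I)`
    (μ : Kernel (EuclideanSpace ℝ (Fin m)) (EuclideanSpace ℝ (Fin n))) [IsMarkovKernel μ]
    (hμ : ∀ x, c.IsStationaryDistribution x (μ x))
    (Φ : EuclideanSpace ℝ (Fin m) → EuclideanSpace ℝ (Fin n) → EuclideanSpace ℝ (Fin m))
    (hΦ : c.IsPoissonSolution μ Φ)
    (havg : c.AveragesExist μ Φ)
    -- boundedness of `h`, of the averaged sensor function and of the coefficients of `𝒢^†`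
    (hh : ∃ C : ℝ, ∀ x z, ‖c.h x z‖ ≤ C)
    (hhBar : ∃ C : ℝ, ∀ x k, |c.hBar μ x k| ≤ C)
    (hbDagger : ∃ C : ℝ, ∀ x i, |c.bDagger μ Φ x i| ≤ C)
    (haDagger : ∃ C : ℝ, ∀ x i j, |c.aDagger μ Φ x i j| ≤ C)
    -- solutions of the Zakai equation and of the homogenized Zakai equation
    (ρ : Ioo (0 : ℝ) 1 → Ω →
      C(ℝ≥0, FiniteMeasure (EuclideanSpace ℝ (Fin m) × EuclideanSpace ℝ (Fin n))))
    (hρ : ∀ ε, c.SolvesZakai ℱ Q T W U (X ε) (Z ε) (c.genSignal ε) c.obsSignal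
      (Q.map fun ω => (X ε 0 ω, Z ε 0 ω)) (ρ ε))
    (ρ0 : Ioo (0 : ℝ) 1 → Ω → C(ℝ≥0, FiniteMeasure (EuclideanSpace ℝ (Fin m))))
    (hρ0 : ∀ ε, c.SolvesZakai ℱ Q T W U (X ε) (Z ε) (c.genDagger μ Φ) (c.obsBar μ)
      (Q.map fun ω => X ε 0 ω) (ρ0 ε))
    -- `ρ^{ε,x} - ρ^0 ⇒ 0` in `C([0,T]; S(ℝ^m))`
    (hconv : TendstoInDistribution
      (fun ε ω => subPath (restrictPath T (marginalPath (ρ ε ω))) (restrictPath T (ρ0 ε ω)))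
      smallScale (fun _ : Ω => 0) (fun _ => Q) Q) :
    -- the normalized filters are well defined
    (∀ ε, ∀ᵐ ω ∂Q, ∀ t ≤ T, ρ ε ω t ≠ 0 ∧ ρ0 ε ω t ≠ 0) ∧
    -- convergence for `π^ε` given by the Kallianpur–Striebel ratio
    TendstoInDistribution
      (fun ε ω => subPath
        (toFinitePath (normalizedPath (restrictPath T (marginalPath (ρ ε ω)))))
        (toFinitePath (normalizedPath (restrictPath T (ρ0 ε ω)))))
      smallScale (fun _ : Ω => 0) (fun _ => Q) Q ∧
    -- convergence for `π^ε` given as the conditional law of the signal, when `ρ^ε` is the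
    -- unnormalized conditional law
    ∀ π : Ioo (0 : ℝ) 1 → Ω →
        C(ℝ≥0, ProbabilityMeasure (EuclideanSpace ℝ (Fin m) × EuclideanSpace ℝ (Fin n))),
      (∀ ε, c.IsUnnormalizedFilter ℱ Q T W U (X ε) (Z ε) (ρ ε)) →
      (∀ ε, c.IsFilter Q T W U (X ε) (Z ε) (π ε)) →
      TendstoInDistribution
        (fun ε ω => subPath
          (restrictPath T (marginalPath (toFinitePath (π ε ω))))
          (toFinitePath (normalizedPath (restrictPath T (ρ0 ε ω)))))
        smallScale (fun _ : Ω => 0) (fun _ => Q) Q := by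
  -- a common nonnegative bound for the coordinates of `h` and of its average
  obtain ⟨C₁, hC₁⟩ := hh
  obtain ⟨C₂, hC₂⟩ := hhBar
  set C := max 0 (max C₁ C₂) with hCdef
  have hC : 0 ≤ C := le_max_left _ _
  have hhC : ∀ x z k, |c.h x z k| ≤ C := fun x z k =>
    ((PiLp.norm_apply_le (c.h x z) k).trans (hC₁ x z)).trans
      ((le_max_left _ _).trans (le_max_right _ _))
  have hX : ∀ ε, Adapted ℱ (X ε) := fun ε => (hXZ ε).1.adapted
  have hZ : ∀ ε, Adapted ℱ (Z ε) := fun ε => (hXZ ε).2.adapted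
  have hη : ∀ ε, IsStronglyProgressive ℱ (c.sensor (X ε) (Z ε)) := fun ε =>
    c.isStronglyProgressive_sensor (hX ε) (hXZ ε).1.continuous_paths (hZ ε)
      (hXZ ε).2.continuous_paths
  have hηC : ∀ ε r ω i, |c.sensor (X ε) (Z ε) r ω i| ≤ C := fun ε r ω i => hhC _ _ _
  have hM : ∀ p k, |c.obsSignal 1 p k| ≤ C := fun p k => by
    rw [Coefficients.obsSignal_one]
    exact hhC _ _ _
  have hM0 : ∀ x k, |c.obsBar μ 1 x k| ≤ C := fun x k => by
    rw [Coefficients.obsBar_one]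
    exact (hC₂ x k).trans ((le_max_right _ _).trans (le_max_right _ _))
  have hX0 : ∀ ε, Measurable (X ε 0) := fun ε => (hX ε 0).mono (ℱ.le 0) le_rfl
  have hZ0 : ∀ ε, Measurable (Z ε 0) := fun ε => (hZ ε 0).mono (ℱ.le 0) le_rfl
  have hν : ∀ ε, IsProbabilityMeasure (Q.map fun ω => (X ε 0 ω, Z ε 0 ω)) := fun ε =>
    Measure.isProbabilityMeasure_map ((hX0 ε).prodMk (hZ0 ε)).aemeasurable
  have hν0 : ∀ ε, IsProbabilityMeasure (Q.map fun ω => X ε 0 ω) := fun ε =>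
    Measure.isProbabilityMeasure_map (hX0 ε).aemeasurable
  have hρne : ∀ ε, ∀ᵐ ω ∂Q, ∀ t ≤ T, ρ ε ω t ≠ 0 := fun ε =>
    (hρ ε).ae_ne_zero hBM (c.genSignal_one _) hC hM (hη ε) (hηC ε)
  have hρ0ne : ∀ ε, ∀ᵐ ω ∂Q, ∀ t ≤ T, ρ0 ε ω t ≠ 0 := fun ε =>
    (hρ0 ε).ae_ne_zero hBM (c.genDagger_one μ Φ) hC hM0 (hη ε) (hηC ε)
  have hmass : ∀ ε ω (t : Icc 0 T) (φ : EuclideanSpace ℝ (Fin m) →ᵇ ℝ),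
      ∫ x, φ x ∂(restrictPath T (marginalPath (ρ ε ω)) t).toMeasure
        = ∫ p, φ p.1 ∂(ρ ε ω t).toMeasure := fun ε ω t φ => integral_marginalPath (ρ ε ω) t φ
  have hmarg : ∀ ε, ∀ᵐ ω ∂Q, ∀ t, restrictPath T (marginalPath (ρ ε ω)) t ≠ 0 := fun ε =>
    (hρne ε).mono fun ω hω t => marginalPath_ne_zero _ _ (hω t t.2.2)
  have hcount : smallScale.IsCountablyGenerated := by
    unfold smallScale
    infer_instance
  have hratio := tendstoInDistribution_normalizedPath (l := smallScale) (Q := Q)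
    (μ := fun ε ω => restrictPath T (marginalPath (ρ ε ω)))
    (ν := fun ε ω => restrictPath T (ρ0 ε ω)) ?_ ?_ hmarg
    (fun ε => (hρ0ne ε).mono fun ω hω t => hω t t.2.2) ?_ hconv
  · refine ⟨fun ε => ?_, hratio, fun π hρπ hπ => ?_⟩
    · filter_upwards [hρne ε, hρ0ne ε] with ω h1 h2 t ht using ⟨h1 t ht, h2 t ht⟩
    -- the filter is almost surely the normalized path
    · refine hratio.congr (fun ε => ?_) EventuallyEq.rfl
      filter_upwards [(hρπ ε).ae_eq_normalizedPath (hπ ε) hBM (hX ε) (hZ ε) hC (hη ε) (hηC ε)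
        (hmarg ε)] with ω hω
      rw [hω]
  · intro ε t φ
    simp only [hmass]
    exact (((hρ ε).adapted t (φ.compContinuous ⟨Prod.fst, continuous_fst⟩)).mono (ℱ.le _)
      le_rfl).aemeasurable
  · exact fun ε t φ => (((hρ0 ε).adapted t φ).mono (ℱ.le _) le_rfl).aemeasurable
  · intro q hq
    obtain ⟨R, hR, hRq⟩ := Coefficients.exists_tail_le d C T hq
    refine ⟨Real.exp (-(10 * d * C ^ 2 * T + 5 * R)) / 4, by positivity,
      fun ε => (measure_mono fun ω hω => ?_).trans
      (((hρ ε).measure_exists_mass_lt hBM (c.genSignal_one _) hC hM (hη ε) (hηC ε)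
        hR).trans hRq)⟩
    obtain ⟨t, ht⟩ := hω
    exact ⟨t, t.2.2, (hmass ε ω t 1).symm.trans_lt ht⟩
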